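/- **Types and processes.** Session types are the closed expressions of the grammar $A ::= \alpha \mid \mathbf 1 \mid B\otimes A \mid \oplus\{l:A_l\}_{l\in L}\mid \&\{l:A_l\}_{l\in L}\mid \rho\alpha.A$ ($L$ a finite set of labels); a closed type is positive unless it is of the form $\&\{\dots\}$. Processes, up to renaming of bound names, are $$P ::= a\to b \mid (a:A\leftarrow P;\,Q) \mid \mathsf{close}\,a \mid \mathsf{wait}\,a;P \mid \mathsf{send}\,a\,b;P \mid b\leftarrow\mathsf{recv}\,a;P \mid a.k;P \mid \mathsf{case}\,a\,\{l\Rightarrow P_l\}_{l\in L} \mid \mathsf{send}\,a\,\mathsf{unfold};P \mid \mathsf{recv}\,a\,\mathsf{unfold};P \mid p \mid \mathsf{fix}\,p.P .$$ Here $(a:A\leftarrow P;Q)$, also written $\mathrm{Cut}_{a:A}(P,Q)$, binds $a$ in $P$ and $Q$. The judgment $\Pi;\Delta\vdash P::c:C$ ($\Delta$ a linear context of channels, $\Pi$ a structural context of process variables; all channel names in $\Delta,c$ distinct, bound channels distinct from all names in scope) is defined by the rules - $\Pi;a:A\vdash (a\to b)::b:A$ for $A$ positive; if $\Pi;\Delta_1\vdash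 P::a:A$ and $\Pi;a:A,\Delta_2\vdash Q::c:C$ then $\Pi;\Delta_1,\Delta_2\vdash \mathrm{Cut}_{a:A}(P,Q)::c:C$; - $\Pi;\cdot\vdash\mathsf{close}\,a::a:\mathbf 1$; if $\Pi;\Delta\vdash P::c:C$ then $\Pi;\Delta,a:\mathbf 1\vdash\mathsf{wait}\,a;P::c:C$; - if $\Pi;\Delta\vdash P::a:A$ then $\Pi;\Delta,b:B\vdash\mathsf{send}\,a\,b;P::a:B\otimes A$; if $\Pi;\Delta,a:A,b:B\vdash P::c:C$ then $\Pi;\Delta,a:B\otimes A\vdash b\leftarrow\mathsf{recv}\,a;P::c:C$; - if $k\in L$ and $\Pi;\Delta\vdash P::a:A_k$ then $\Pi;\Delta\vdash a.k;P::a:\oplus\{l:A_l\}_{l\in L}$; if $\Pi;\Delta,a:A_l\vdash P_l::c:C$ for all $l\in L$ then $\Pi;\Delta,a:\oplus\{l:A_l\}_{l\in L}\vdash\mathsf{case}\,a\{l\Rightarrow P_l\}_{l\in L}::c:C$; - if $\Pi;\Delta\vdash P_l::a:A_l$ for all $l\in L$ then $\Pi;\Delta\vdash\mathsf{case}\,a\{l\Rightarrow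 P_l\}_{l\in L}::a:\&\{l:A_l\}_{l\in L}$; if $k\in L$ and $\Pi;\Delta,a:A_k\vdash P::c:C$ then $\Pi;\Delta,a:\&\{l:A_l\}_{l\in L}\vdash a.k;P::c:C$; - if $\Pi;\Delta\vdash P::a:[\rho\alpha.A/\alpha]A$ then $\Pi;\Delta\vdash\mathsf{send}\,a\,\mathsf{unfold};P::a:\rho\alpha.A$; if $\Pi;\Delta,a:[\rho\alpha.A/\alpha]A\vdash P::c:C$ then $\Pi;\Delta,a:\rho\alpha.A\vdash\mathsf{recv}\,a\,\mathsf{unfold};P::c:C$; - $\Pi,p:\{c:C\leftarrow\Delta\};\Delta\vdash p::c:C$; if $\Pi,p:\{c:C\leftarrow\Delta\};\Delta\vdash P::c:C$ then $\Pi;\Delta\vdash\mathsf{fix}\,p.P::c:C$. **Dynamics.** Configurations are finite multisets of judgments $\mathsf{proc}(c,P)$ ($P$ provides $c$), $\mathsf{msg}(c,m)$ ($c$ carries the message $m$, where $m$ is $\ast$, $(e;d)$, $(k;d)$ or $(\mathsf{unfold};d)$ with continuation channel $d$), and the persistent $\mathsf{type}(c,A)$. They are rewritten by the following rules (persistent judgments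 are kept): - $\mathsf{msg}(a,m),\mathsf{proc}(b,a\to b)\to\mathsf{msg}(b,m)$; - $\mathsf{proc}(c,\mathrm{Cut}_{a:A}(P,Q))\to\exists b.\ \mathsf{proc}(b,[b/a]P),\mathsf{proc}(c,[b/a]Q),\mathsf{type}(b,A)$; - $\mathsf{proc}(a,\mathsf{close}\,a)\to\mathsf{msg}(a,\ast)$; $\ \mathsf{msg}(a,\ast),\mathsf{proc}(c,\mathsf{wait}\,a;P)\to\mathsf{proc}(c,P)$; - $\mathsf{proc}(a,\mathsf{send}\,a\,b;P),\mathsf{type}(a,B\otimes A)\to\exists d.\ \mathsf{proc}(d,[d/a]P),\mathsf{msg}(a,(b;d)),\mathsf{type}(d,A)$; - $\mathsf{msg}(a,(e;d)),\mathsf{proc}(c,b\leftarrow\mathsf{recv}\,a;P)\to\mathsf{proc}(c,[e,d/b,a]P)$; - $\mathsf{proc}(a,a.k;P),\mathsf{type}(a,\oplus\{l:A_l\}_{l\in L})\to\exists d.\ \mathsf{msg}(a,(k;d)),\mathsf{proc}(d,[d/a]P),\mathsf{type}(d,A_k)$; - $\mathsf{msg}(a,(k;d)),\mathsf{proc}(c,\mathsf{case}\,a\{l\Rightarrow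 P_l\})\to\mathsf{proc}(c,[d/a]P_k)$ for $c\ne a$; $\ \mathsf{msg}(a,(k;d)),\mathsf{proc}(a,\mathsf{case}\,a\{l\Rightarrow P_l\})\to\mathsf{proc}(d,[d/a]P_k)$; - $\mathsf{proc}(c,a.k;P),\mathsf{type}(a,\&\{l:A_l\}_{l\in L})\to\exists d.\ \mathsf{msg}(a,(k;d)),\mathsf{proc}(c,[d/a]P),\mathsf{type}(d,A_k)$; - $\mathsf{proc}(a,\mathsf{send}\,a\,\mathsf{unfold};P),\mathsf{type}(a,\rho\alpha.A)\to\exists d.\ \mathsf{msg}(a,(\mathsf{unfold};d)),\mathsf{proc}(d,[d/a]P),\mathsf{type}(d,[\rho\alpha.A/\alpha]A)$; $\ \mathsf{msg}(a,(\mathsf{unfold};d)),\mathsf{proc}(c,\mathsf{recv}\,a\,\mathsf{unfold};P)\to\mathsf{proc}(c,[d/a]P)$; - $\mathsf{proc}(c,\mathsf{fix}\,p.P)\to\mathsf{proc}(c,[\mathsf{fix}\,p.P/p]P)$. A trace is a finite or infinite sequence of rewriting steps $M_0\to M_1\to\cdots$ in which the name chosen for an existential variable occurs in no earlier multiset. An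 execution is a maximally long trace. It is fair if every rule instantiation applicable to some $M_i$ is applied (up to equality of its left-hand side and of its existentially quantified right-hand side) at some later step. A fair execution of $\cdot;c_1:A_1,\dots,c_n:A_n\vdash P::c_0:A_0$ is one that starts from $\mathsf{proc}(c_0,P),\mathsf{type}(c_0,A_0),\dots,\mathsf{type}(c_n,A_n)$. **Observations.** Communications are finite or infinite trees $v ::= \bot_A\mid\ast\mid(k,v)\mid(v,v')\mid(\mathsf{unfold},v)$. For a trace $T$ let $\mathcal T$ be the set of all judgments in it. The judgment $T\rightsquigarrow v/c:A$ is coinductively defined by the rules: $\bot_A/c:A$ if $\mathsf{type}(c,A)\in\mathcal T$ and no $\mathsf{msg}(c,m)$ is in $\mathcal T$; $\ast/c:\mathbf 1$ if $\mathsf{msg}(c,\ast)\in\mathcal T$; $(l,v)/c:A$ for $A=\oplus\{l:A_l\}_{l\in L}$ or $A=\&\{l:A_l\}_{l\in L}$ if $l\in L$, $\mathsf{msg}(c,(l;d))\in\mathcal T$, $\mathsf{type}(c,A)\in\mathcal T$ and $v/d:A_l$; $(u,v)/c:A\otimes B$ if $\mathsf{msg}(c,(a;d))\in\mathcal T$,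 $u/a:A$ and $v/d:B$; $(\mathsf{unfold},v)/c:\rho\alpha.A$ if $\mathsf{msg}(c,(\mathsf{unfold};d))\in\mathcal T$ and $v/d:[\rho\alpha.A/\alpha]A$. The operational observation of $\cdot;c_1:A_1,\dots,c_n:A_n\vdash P::c_0:A_0$ is the unique tuple $(c_i:v_i)_{0\le i\le n}$ such that $T\rightsquigarrow v_i/c_i:A_i$ for all $i$ for some fair execution $T$ of the process. **Congruence.** A typed context $\cdot;\Delta'\vdash K[\cdot]::b:B$ with a hole of type $\Delta\vdash c:C$ is derived by the typing rules and exactly one instance of the axiom $\cdot;\Delta\vdash[\cdot]::c:C$; plugging a process into the hole may capture its free channels. Processes $\cdot;\Delta\vdash P::c:C$ and $\cdot;\Delta\vdash Q::c:C$ are observationally congruent, $P\approx Q$, if for every such context the operational observations of $\cdot;\Delta'\vdash K[P]::b:B$ and $\cdot;\Delta'\vdash K[Q]::b:B$ exist and are equal. **Proposition.** Let $\cdot;\Delta_1\vdash P_1::c_1:C_1$, $\ \cdot;c_1:C_1,\Delta_2\vdash P_2::c_2:C_2$ and $\cdot;c_2:C_2,\Delta_3\vdash P_3::c_3:C_3$,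 where the channel names $c_1,c_2,c_3$ and those of $\Delta_1,\Delta_2,\Delta_3$ are pairwise distinct. Then $$\mathrm{Cut}_{c_1:C_1}\bigl(P_1,\mathrm{Cut}_{c_2:C_2}(P_2,P_3)\bigr)\ \approx\ \mathrm{Cut}_{c_2:C_2}\bigl(\mathrm{Cut}_{c_1:C_1}(P_1,P_2),P_3\bigr)$$ as processes $\cdot;\Delta_1,\Delta_2,\Delta_3\vdash\,\cdot\,::c_3:C_3$. -/

import Mathlib

namespace OCS

/-- Channel names (the countably infinite supply of constants). -/
abbrev Chan := ℕ

/-- Labels of internal and external choices. -/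
abbrev Label := ℕ

/-! ### Session types -/

/-- Session types with free type variables among `Fin n` (de Bruijn indices). The index sets of
choices are finite sets of labels. -/
inductive STy : ℕ → Type
  /-- type variable -/
  | var {n : ℕ} (i : Fin n) : STy n
  /-- `1` -/
  | one {n : ℕ} : STy n
  /-- `B ⊗ A`: send a channel of type `B`, continue as `A` -/
  | tensor {n : ℕ} (B A : STy n) : STy n
  /-- internal choice `⊕{l : A l}` -/
  | plus {n : ℕ} (L : Finset Label) (A : {l // l ∈ L} → STy n) : STy n
  /-- external choice `&{l : A l}` -/
  | amp {n : ℕ} (L : Finset Label) (A : {l // l ∈ L} → STy n) : STy n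
  /-- recursive type `ρα.A` -/
  | mu {n : ℕ} (A : STy (n + 1)) : STy n

/-- Renaming of type variables. -/
def STy.ren : {n m : ℕ} → (Fin n → Fin m) → STy n → STy m
  | _, _, f, .var i => .var (f i)
  | _, _, _, .one => .one
  | _, _, f, .tensor B A => .tensor (B.ren f) (A.ren f)
  | _, _, f, .plus L A => .plus L (fun l => (A l).ren f)
  | _, _, f, .amp L A => .amp L (fun l => (A l).ren f)
  | _, _, f, .mu A => .mu (A.ren (Fin.cases 0 (fun i => (f i).succ)))

/-- Simultaneous capture-avoiding substitution for type variables. -/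
def STy.subst : {n m : ℕ} → (Fin n → STy m) → STy n → STy m
  | _, _, s, .var i => s i
  | _, _, _, .one => .one
  | _, _, s, .tensor B A => .tensor (B.subst s) (A.subst s)
  | _, _, s, .plus L A => .plus L (fun l => (A l).subst s)
  | _, _, s, .amp L A => .amp L (fun l => (A l).subst s)
  | _, _, s, .mu A => .mu (A.subst (Fin.cases (.var 0) (fun i => (s i).ren Fin.succ)))

/-- `[ρα.A/α]A`. -/
def STy.unfold {n : ℕ} (A : STy (n + 1)) : STy n :=
  A.subst (Fin.cases (.mu A) .var)

/-- Closed session types. -/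
abbrev Ty := STy 0

/-- Positive types; the only negative type former is `&`. -/
inductive Positive : Ty → Prop
  | one : Positive .one
  | tensor (B A : Ty) : Positive (.tensor B A)
  | plus (L : Finset Label) (A : {l // l ∈ L} → Ty) : Positive (.plus L A)
  | mu (A : STy 1) : Positive (.mu A)

/-! ### Processes -/

/-- Processes up to renaming of bound names. Free and bound channels are de Bruijn indices:
below `k` channel binders, an index `i < k` is bound and an index `i ≥ k` is the free channel
name `i - k`. Process variables are de Bruijn indices of a second sort, bound by `fix`. -/
inductive Proc : Type
  /-- forward all messages from `a` to `b` -/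
  | fwd (a b : Chan)
  /-- process composition over a private channel of type `A`, bound (as index `0`) in `P`, `Q` -/
  | cut (A : Ty) (P Q : Proc)
  | close (a : Chan)
  | wait (a : Chan) (P : Proc)
  /-- send the channel `b` over `a`, continue as `P` -/
  | sendC (a b : Chan) (P : Proc)
  /-- receive a channel over `a`, bind it (as index `0`) in `P` -/
  | recvC (a : Chan) (P : Proc)
  /-- send the label `k` over `a`, continue as `P` -/
  | sendL (a : Chan) (k : Label) (P : Proc)
  /-- `case a {l ⇒ P l}` -/
  | branch (a : Chan) (L : Finset Label) (P : {l // l ∈ L} → Proc)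
  /-- send an unfold message over `a` -/
  | sendU (a : Chan) (P : Proc)
  /-- receive an unfold message over `a` -/
  | recvU (a : Chan) (P : Proc)
  /-- process variable -/
  | pvar (i : ℕ)
  /-- `fix p.P` -/
  | fix (P : Proc)

/-- Extend a renaming of channels under a channel binder. -/
def liftRen (f : ℕ → ℕ) : ℕ → ℕ
  | 0 => 0
  | n + 1 => f n + 1

/-- Capture-avoiding renaming of free channels. -/
def Proc.ren : (Chan → Chan) → Proc → Proc
  | f, .fwd a b => .fwd (f a) (f b)
  | f, .cut A P Q => .cut A (P.ren (liftRen f)) (Q.ren (liftRen f))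
  | f, .close a => .close (f a)
  | f, .wait a P => .wait (f a) (P.ren f)
  | f, .sendC a b P => .sendC (f a) (f b) (P.ren f)
  | f, .recvC a P => .recvC (f a) (P.ren (liftRen f))
  | f, .sendL a k P => .sendL (f a) k (P.ren f)
  | f, .branch a L P => .branch (f a) L (fun l => (P l).ren f)
  | f, .sendU a P => .sendU (f a) (P.ren f)
  | f, .recvU a P => .recvU (f a) (P.ren f)
  | _, .pvar i => .pvar i
  | f, .fix P => .fix (P.ren f)

/-- Capture-avoiding renaming of free process variables. -/
def Proc.pren : (ℕ → ℕ) → Proc → Proc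
  | _, .fwd a b => .fwd a b
  | g, .cut A P Q => .cut A (P.pren g) (Q.pren g)
  | _, .close a => .close a
  | g, .wait a P => .wait a (P.pren g)
  | g, .sendC a b P => .sendC a b (P.pren g)
  | g, .recvC a P => .recvC a (P.pren g)
  | g, .sendL a k P => .sendL a k (P.pren g)
  | g, .branch a L P => .branch a L (fun l => (P l).pren g)
  | g, .sendU a P => .sendU a (P.pren g)
  | g, .recvU a P => .recvU a (P.pren g)
  | g, .pvar i => .pvar (g i)
  | g, .fix P => .fix (P.pren (liftRen g))

/-- Extend a substitution for process variables under a binder of a process variable. -/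
def liftSub (s : ℕ → Proc) : ℕ → Proc
  | 0 => .pvar 0
  | n + 1 => (s n).pren Nat.succ

/-- Simultaneous substitution for process variables, avoiding capture of channels and of process
variables. -/
def Proc.subst : (ℕ → Proc) → Proc → Proc
  | _, .fwd a b => .fwd a b
  | s, .cut A P Q =>
      .cut A (P.subst (fun i => (s i).ren Nat.succ)) (Q.subst (fun i => (s i).ren Nat.succ))
  | _, .close a => .close a
  | s, .wait a P => .wait a (P.subst s)
  | s, .sendC a b P => .sendC a b (P.subst s)
  | s, .recvC a P => .recvC a (P.subst (fun i => (s i).ren Nat.succ))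
  | s, .sendL a k P => .sendL a k (P.subst s)
  | s, .branch a L P => .branch a L (fun l => (P l).subst s)
  | s, .sendU a P => .sendU a (P.subst s)
  | s, .recvU a P => .recvU a (P.subst s)
  | s, .pvar i => s i
  | s, .fix P => .fix (P.subst (liftSub s))

/-- `[fix p.P/p]P`. -/
def Proc.unfold (P : Proc) : Proc :=
  P.subst (fun i => match i with
    | 0 => .fix P
    | n + 1 => .pvar n)

/-- `[d/a]P` for a free channel `a`. -/
def Proc.rename (a d : Chan) (P : Proc) : Proc :=
  P.ren (fun x => if x = a then d else x)

/-- Instantiate the outermost bound channel (index `0`) by `b`. -/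
def Proc.inst (b : Chan) (P : Proc) : Proc :=
  P.ren (fun x => match x with
    | 0 => b
    | n + 1 => n)

/-- Bind the free channel `a`: it becomes index `0`. -/
def Proc.bind (a : Chan) (P : Proc) : Proc :=
  P.ren (fun x => if x = a then 0 else x + 1)

/-- Process composition written with a channel name: `a` is bound in `P` and `Q`. -/
def Proc.comp (a : Chan) (A : Ty) (P Q : Proc) : Proc :=
  .cut A (P.bind a) (Q.bind a)

/-- Free channel names of a process. -/
def Proc.fcn : Proc → Set Chan
  | .fwd a b => {a, b}
  | .cut _ P Q => {x | x + 1 ∈ P.fcn ∨ x + 1 ∈ Q.fcn}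
  | .close a => {a}
  | .wait a P => {a} ∪ P.fcn
  | .sendC a b P => {a, b} ∪ P.fcn
  | .recvC a P => {a} ∪ {x | x + 1 ∈ P.fcn}
  | .sendL a _ P => {a} ∪ P.fcn
  | .branch a _ P => {a} ∪ ⋃ l, (P l).fcn
  | .sendU a P => {a} ∪ P.fcn
  | .recvU a P => {a} ∪ P.fcn
  | .pvar _ => ∅
  | .fix P => P.fcn

/-! ### Typing -/

/-- Linear contexts `c₁ : A₁, …, cₙ : Aₙ`. -/
abbrev LCtx := Multiset (Chan × Ty)

/-- The same context below one more channel binder. -/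
def LCtx.shift (Δ : LCtx) : LCtx := Δ.map (fun x => (x.1 + 1, x.2))

/-- Type `{c : C ← Δ}` of a process variable. -/
structure PTy where
  ctx : LCtx
  chan : Chan
  ty : Ty

/-- Structural contexts of process variables; the head is the most recently bound one. -/
abbrev PCtx := List PTy

/-- The same context below one more channel binder. -/
def PCtx.shift (Ψ : PCtx) : PCtx := Ψ.map (fun t => ⟨LCtx.shift t.ctx, t.chan + 1, t.ty⟩)

/-- The typing rules for `Ψ ; Δ ⊢ P :: c : C`. -/
inductive HasType : PCtx → LCtx → Proc → Chan → Ty → Prop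
  | fwd {Ψ : PCtx} {a b : Chan} {A : Ty} : Positive A → HasType Ψ {(a, A)} (.fwd a b) b A
  | cut {Ψ : PCtx} {Δ₁ Δ₂ : LCtx} {A C : Ty} {P Q : Proc} {c : Chan} :
      HasType Ψ.shift (LCtx.shift Δ₁) P 0 A →
      HasType Ψ.shift ((0, A) ::ₘ LCtx.shift Δ₂) Q (c + 1) C →
      HasType Ψ (Δ₁ + Δ₂) (.cut A P Q) c C
  | oneR {Ψ : PCtx} {a : Chan} : HasType Ψ 0 (.close a) a .one
  | oneL {Ψ : PCtx} {Δ : LCtx} {a c : Chan} {C : Ty} {P : Proc} :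
      HasType Ψ Δ P c C → HasType Ψ ((a, .one) ::ₘ Δ) (.wait a P) c C
  | tensorR {Ψ : PCtx} {Δ : LCtx} {a b : Chan} {A B : Ty} {P : Proc} :
      HasType Ψ Δ P a A → HasType Ψ ((b, B) ::ₘ Δ) (.sendC a b P) a (.tensor B A)
  | tensorL {Ψ : PCtx} {Δ : LCtx} {a c : Chan} {A B C : Ty} {P : Proc} :
      HasType Ψ.shift ((0, B) ::ₘ (a + 1, A) ::ₘ LCtx.shift Δ) P (c + 1) C →
      HasType Ψ ((a, .tensor B A) ::ₘ Δ) (.recvC a P) c C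
  | plusR {Ψ : PCtx} {Δ : LCtx} {a : Chan} {L : Finset Label} {A : {l // l ∈ L} → Ty}
      {P : Proc} (k : {l // l ∈ L}) :
      HasType Ψ Δ P a (A k) → HasType Ψ Δ (.sendL a k P) a (.plus L A)
  | plusL {Ψ : PCtx} {Δ : LCtx} {a c : Chan} {C : Ty} {L : Finset Label}
      {A : {l // l ∈ L} → Ty} {P : {l // l ∈ L} → Proc} :
      (∀ l, HasType Ψ ((a, A l) ::ₘ Δ) (P l) c C) →
      HasType Ψ ((a, .plus L A) ::ₘ Δ) (.branch a L P) c C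
  | ampR {Ψ : PCtx} {Δ : LCtx} {a : Chan} {L : Finset Label}
      {A : {l // l ∈ L} → Ty} {P : {l // l ∈ L} → Proc} :
      (∀ l, HasType Ψ Δ (P l) a (A l)) → HasType Ψ Δ (.branch a L P) a (.amp L A)
  | ampL {Ψ : PCtx} {Δ : LCtx} {a c : Chan} {C : Ty} {L : Finset Label}
      {A : {l // l ∈ L} → Ty} {P : Proc} (k : {l // l ∈ L}) :
      HasType Ψ ((a, A k) ::ₘ Δ) P c C →
      HasType Ψ ((a, .amp L A) ::ₘ Δ) (.sendL a k P) c C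
  | muR {Ψ : PCtx} {Δ : LCtx} {a : Chan} {A : STy 1} {P : Proc} :
      HasType Ψ Δ P a A.unfold → HasType Ψ Δ (.sendU a P) a (.mu A)
  | muL {Ψ : PCtx} {Δ : LCtx} {a c : Chan} {A : STy 1} {C : Ty} {P : Proc} :
      HasType Ψ ((a, A.unfold) ::ₘ Δ) P c C →
      HasType Ψ ((a, .mu A) ::ₘ Δ) (.recvU a P) c C
  | pvar {Ψ : PCtx} {i : ℕ} {t : PTy} :
      Ψ[i]? = some t → HasType Ψ t.ctx (.pvar i) t.chan t.ty
  | fix {Ψ : PCtx} {Δ : LCtx} {c : Chan} {C : Ty} {P : Proc} :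
      HasType (⟨Δ, c, C⟩ :: Ψ) Δ P c C → HasType Ψ Δ (.fix P) c C

/-- The channel names in `Δ ⊢ _ :: c : C` are pairwise distinct. -/
def WF (Δ : LCtx) (c : Chan) : Prop := (c ::ₘ Δ.map Prod.fst).Nodup

/-- `· ; Δ ⊢ P :: c : C`: `P` is a closed process using `Δ` and providing `c : C`. Distinctness of
channel names need only be required at the root: it is inherited by all premises. -/
def Typed (Δ : LCtx) (P : Proc) (c : Chan) (C : Ty) : Prop :=
  WF Δ c ∧ HasType [] Δ P c C

/-! ### Multiset rewriting semantics -/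

/-- Message contents; `d` is the continuation channel. -/
inductive Msg : Type
  | close
  | chan (e d : Chan)
  | label (k : Label) (d : Chan)
  | unfold (d : Chan)

/-- Judgments. `typ` is persistent, `proc` and `msg` are ephemeral. -/
inductive Judg : Type
  /-- the process `P` provides `c` -/
  | proc (c : Chan) (P : Proc)
  /-- the channel `c` carries the message `m` -/
  | msg (c : Chan) (m : Msg)
  /-- the channel `c` has type `A` -/
  | typ (c : Chan) (A : Ty)

/-- Channel names in a message. -/
def Msg.names : Msg → Set Chan
  | .close => ∅
  | .chan e d => {e, d}
  | .label _ d => {d}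
  | .unfold d => {d}

/-- Channel names in a judgment. -/
def Judg.names : Judg → Set Chan
  | .proc c P => {c} ∪ P.fcn
  | .msg c m => {c} ∪ m.names
  | .typ c _ => {c}

/-- Multisets of judgments. -/
abbrev Config := Multiset Judg

/-- Channel names in a multiset of judgments. -/
def Config.names (M : Config) : Set Chan := {x | ∃ j ∈ M, x ∈ j.names}

/-- Instantiations `r(θ)` of the rules of the multiset rewriting system: one constructor for each
rule `r`, whose arguments are the matching substitution `θ`. -/
inductive Inst : Type
  | fwd (a b : Chan) (m : Msg)
  | cut (c : Chan) (A : Ty) (P Q : Proc)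
  | close (a : Chan)
  | wait (a c : Chan) (P : Proc)
  | sendC (a b : Chan) (P : Proc) (B A : Ty)
  | recvC (a e d c : Chan) (P : Proc)
  /-- the provider of an internal choice sends a label -/
  | plusSend (a : Chan) (L : Finset Label) (A : {l // l ∈ L} → Ty) (k : {l // l ∈ L}) (P : Proc)
  /-- a client, which provides a channel `c` other than `a`, receives a label over `a` -/
  | plusRecv (a d c : Chan) (ne : c ≠ a) (L : Finset Label) (k : {l // l ∈ L})
      (P : {l // l ∈ L} → Proc)
  /-- a client of an external choice sends a label -/
  | ampSend (a c : Chan) (L : Finset Label) (A : {l // l ∈ L} → Ty) (k : {l // l ∈ L}) (P : Proc)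
  /-- the provider of `a` receives a label over `a` -/
  | ampRecv (a d : Chan) (L : Finset Label) (k : {l // l ∈ L}) (P : {l // l ∈ L} → Proc)
  | sendU (a : Chan) (A : STy 1) (P : Proc)
  | recvU (a d c : Chan) (P : Proc)
  | fix (c : Chan) (P : Proc)

/-- The active multiset `F(θ)` of `r(θ) : F(θ) → ∃ n. G(θ, n)`. -/
def Inst.lhs : Inst → Config
  | .fwd a b m => {.msg a m, .proc b (.fwd a b)}
  | .cut c A P Q => {.proc c (.cut A P Q)}
  | .close a => {.proc a (.close a)}
  | .wait a c P => {.msg a .close, .proc c (.wait a P)}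
  | .sendC a b P B A => {.proc a (.sendC a b P), .typ a (.tensor B A)}
  | .recvC a e d c P => {.msg a (.chan e d), .proc c (.recvC a P)}
  | .plusSend a L A k P => {.proc a (.sendL a k P), .typ a (.plus L A)}
  | .plusRecv a d c _ L k P => {.msg a (.label k d), .proc c (.branch a L P)}
  | .ampSend a c L A k P => {.proc c (.sendL a k P), .typ a (.amp L A)}
  | .ampRecv a d L k P => {.msg a (.label k d), .proc a (.branch a L P)}
  | .sendU a A P => {.proc a (.sendU a P), .typ a (.mu A)}
  | .recvU a d c P => {.msg a (.unfold d), .proc c (.recvU a P)}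
  | .fix c P => {.proc c (.fix P)}

/-- Whether the rule has an existentially quantified name (no rule has more than one). -/
def Inst.bindsFresh : Inst → Prop
  | .cut .. | .sendC .. | .plusSend .. | .ampSend .. | .sendU .. => True
  | _ => False

/-- The multiset `G(θ, n)`, where `n` is the choice of the existentially quantified name (ignored
by the rules that have none). Persistent judgments are repeated. -/
def Inst.rhs : Inst → Chan → Config
  | .fwd _ b m, _ => {.msg b m}
  | .cut c A P Q, n => {.proc n (P.inst n), .proc c (Q.inst n), .typ n A}
  | .close a, _ => {.msg a .close}
  | .wait _ c P, _ => {.proc c P}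
  | .sendC a b P B A, n =>
      {.proc n (P.rename a n), .msg a (.chan b n), .typ n A, .typ a (.tensor B A)}
  | .recvC a e d c P, _ =>
      -- the simultaneous substitution `[e, d / b, a]`, where `b` is the bound index `0`
      {.proc c (P.ren (fun x => match x with
        | 0 => e
        | y + 1 => if y = a then d else y))}
  | .plusSend a L A k P, n =>
      {.msg a (.label k n), .proc n (P.rename a n), .typ n (A k), .typ a (.plus L A)}
  | .plusRecv a d c _ _ k P, _ => {.proc c ((P k).rename a d)}
  | .ampSend a c L A k P, n =>
      {.msg a (.label k n), .proc c (P.rename a n), .typ n (A k), .typ a (.amp L A)}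
  | .ampRecv a d _ k P, _ => {.proc d ((P k).rename a d)}
  | .sendU a A P, n =>
      {.msg a (.unfold n), .proc n (P.rename a n), .typ n A.unfold, .typ a (.mu A)}
  | .recvU a d c P, _ => {.proc c (P.rename a d)}
  | .fix c P, _ => {.proc c P.unfold}

/-- Equivalence of instantiations: equal active multisets and equal `∃ n. G(θ, n)`. -/
def Inst.Equiv (r s : Inst) : Prop :=
  r.lhs = s.lhs ∧ (r.bindsFresh ↔ s.bindsFresh) ∧ ∀ n, r.rhs n = s.rhs n

/-- `r(θ)` is applicable to `M`. -/
def Inst.Applicable (r : Inst) (M : Config) : Prop := ∃ M', M = r.lhs + M'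

/-- Finite or infinite traces from `M₀`. Step `i` (for `i < len`) leads from `state i` to
`state (i + 1)`; values of the functions past the length are irrelevant. -/
structure Trace (M₀ : Config) where
  len : ℕ∞
  state : ℕ → Config
  inst : ℕ → Inst
  fresh : ℕ → Chan
  start : state 0 = M₀
  step : ∀ i : ℕ, (i : ℕ∞) < len → ∃ M',
    state i = (inst i).lhs + M' ∧ state (i + 1) = (inst i).rhs (fresh i) + M'
  fresh_new : ∀ i j : ℕ, i ≤ j → (j : ℕ∞) < len → (inst j).bindsFresh →
    fresh j ∉ Config.names (state i)

/-- An execution is a maximally long trace. -/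
def Trace.IsExecution {M₀ : Config} (T : Trace M₀) : Prop :=
  ∀ n : ℕ, T.len = n → ∀ r : Inst, ¬ r.Applicable (T.state n)

/-- A fair execution: every applicable instantiation is eventually applied. -/
def Trace.IsFair {M₀ : Config} (T : Trace M₀) : Prop :=
  T.IsExecution ∧
  ∀ i : ℕ, (i : ℕ∞) ≤ T.len → ∀ r : Inst, r.Applicable (T.state i) →
    ∃ j : ℕ, i ≤ j ∧ (j : ℕ∞) < T.len ∧ (T.inst j).Equiv r

/-- The set of all judgments that appear in a trace. -/
def Trace.union {M₀ : Config} (T : Trace M₀) : Set Judg :=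
  {j | ∃ i : ℕ, (i : ℕ∞) ≤ T.len ∧ j ∈ T.state i}

/-- Initial configuration of `· ; Δ ⊢ P :: c : A`. -/
def initial (Δ : LCtx) (P : Proc) (c : Chan) (A : Ty) : Config :=
  .proc c P ::ₘ .typ c A ::ₘ Δ.map (fun x => .typ x.1 x.2)

/-! ### Observed communications -/

/-- Node labels of session-typed communications. -/
inductive CommHead : Type
  | bot (A : Ty)
  | star
  | label (k : Label)
  | pair
  | unfold

/-- Index type of the immediate subtrees of a node. -/
def CommHead.Arity : CommHead → Type
  | .bot _ => Empty
  | .star => Empty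
  | .label _ => Unit
  | .pair => Bool
  | .unfold => Unit

/-- Communications: finite or infinite trees
`v ::= ⊥_A | ∗ | (k, v) | (v, v') | (unfold, v)`. -/
abbrev Comm := PFunctor.M ⟨CommHead, CommHead.Arity⟩

def Comm.bot (A : Ty) : Comm := PFunctor.M.mk ⟨.bot A, fun e : Empty => e.elim⟩
def Comm.star : Comm := PFunctor.M.mk ⟨.star, fun e : Empty => e.elim⟩
def Comm.label (k : Label) (v : Comm) : Comm := PFunctor.M.mk ⟨.label k, fun _ : Unit => v⟩
def Comm.pair (u v : Comm) : Comm :=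
  PFunctor.M.mk ⟨.pair, fun b : Bool => if b then v else u⟩
def Comm.unfold (v : Comm) : Comm := PFunctor.M.mk ⟨.unfold, fun _ : Unit => v⟩

/-- One application of the rules for observing a communication `v : A` on a channel `c` in a trace
whose set of judgments is `T`; `R` holds of the premises. -/
inductive ObsRule (T : Set Judg) (R : Comm → Chan → Ty → Prop) : Comm → Chan → Ty → Prop
  | bot {c : Chan} {A : Ty} : Judg.typ c A ∈ T → (∀ m, Judg.msg c m ∉ T) →
      ObsRule T R (Comm.bot A) c A
  | one {c : Chan} : Judg.msg c .close ∈ T → ObsRule T R Comm.star c .one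
  | plus {c d : Chan} {L : Finset Label} {A : {l // l ∈ L} → Ty} (l : {l // l ∈ L}) {v : Comm} :
      Judg.msg c (.label l d) ∈ T → R v d (A l) → Judg.typ c (.plus L A) ∈ T →
      ObsRule T R (Comm.label l v) c (.plus L A)
  | amp {c d : Chan} {L : Finset Label} {A : {l // l ∈ L} → Ty} (l : {l // l ∈ L}) {v : Comm} :
      Judg.msg c (.label l d) ∈ T → R v d (A l) → Judg.typ c (.amp L A) ∈ T →
      ObsRule T R (Comm.label l v) c (.amp L A)
  | tensor {c a d : Chan} {A B : Ty} {u v : Comm} :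
      Judg.msg c (.chan a d) ∈ T → R u a A → R v d B →
      ObsRule T R (Comm.pair u v) c (.tensor A B)
  | mu {c d : Chan} {A : STy 1} {v : Comm} :
      Judg.msg c (.unfold d) ∈ T → R v d A.unfold →
      ObsRule T R (Comm.unfold v) c (.mu A)

/-- The coinductive judgment defined by these rules: the largest relation all of whose elements
are conclusions of rules with premises in the relation. -/
def Observes (T : Set Judg) (v : Comm) (c : Chan) (A : Ty) : Prop :=
  ∃ R : Comm → Chan → Ty → Prop, (∀ v c A, R v c A → ObsRule T R v c A) ∧ R v c A

/-- Tuples `(c₀ : v₀, …, cₙ : vₙ)` indexed by the channels of `Δ ⊢ _ :: c : A`. -/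
abbrev ObsTuple (Δ : LCtx) (c : Chan) (A : Ty) :=
  {x : Chan × Ty // x ∈ (c, A) ::ₘ Δ} → Comm

/-- The set of tuples of communications observed in some fair execution of
`· ; Δ ⊢ P :: c : A`. -/
def observations (Δ : LCtx) (P : Proc) (c : Chan) (A : Ty) : Set (ObsTuple Δ c A) :=
  {v | ∃ T : Trace (initial Δ P c A), T.IsFair ∧ ∀ x, Observes T.union (v x) x.1.1 x.1.2}

/-- `v` is the operational observation of `· ; Δ ⊢ P :: c : A`: it is observed in some fair
execution, and nothing else is observed in any fair execution. -/
def IsObservation (Δ : LCtx) (P : Proc) (c : Chan) (A : Ty) (v : ObsTuple Δ c A) : Prop :=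
  observations Δ P c A = {v}

/-! ### Contexts and observational congruence -/

/-- One-hole contexts. Binders carry channel names, which may capture free channels of the process
plugged into the hole. There is no context former for `fix`: the hole is typed without process
variables, so that it never lies below one. -/
inductive Hole : Type
  | hole
  | cutL (a : Chan) (A : Ty) (K : Hole) (Q : Proc)
  | cutR (a : Chan) (A : Ty) (P : Proc) (K : Hole)
  | wait (a : Chan) (K : Hole)
  | sendC (a b : Chan) (K : Hole)
  /-- `b` is bound in `K` -/
  | recvC (b a : Chan) (K : Hole)
  | sendL (a : Chan) (k : Label) (K : Hole)
  /-- the hole is in branch `k`; the other branches are given by `P` -/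
  | branch (a : Chan) (L : Finset Label) (k : {l // l ∈ L}) (K : Hole)
      (P : {l : {l // l ∈ L} // l ≠ k} → Proc)
  | sendU (a : Chan) (K : Hole)
  | recvU (a : Chan) (K : Hole)

/-- Plug a process into the hole. -/
def Hole.plug (R : Proc) : Hole → Proc
  | .hole => R
  | .cutL a A K Q => .comp a A (K.plug R) Q
  | .cutR a A P K => .comp a A P (K.plug R)
  | .wait a K => .wait a (K.plug R)
  | .sendC a b K => .sendC a b (K.plug R)
  | .recvC b a K => .recvC a ((K.plug R).bind b)
  | .sendL a k K => .sendL a k (K.plug R)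
  | .branch a L k K P =>
      .branch a L (fun l => if h : l = k then K.plug R else P ⟨l, h⟩)
  | .sendU a K => .sendU a (K.plug R)
  | .recvU a K => .recvU a (K.plug R)

/-- Typed contexts: `CtxTyped Δ' a' A' K Δ c C` means that `· ; Δ ⊢ K :: c : C` is derived by the
typing rules and exactly one instance of the axiom `· ; Δ' ⊢ [·] :: a' : A'`. The channel names in
each judgment are pairwise distinct. -/
inductive CtxTyped (Δ' : LCtx) (a' : Chan) (A' : Ty) : Hole → LCtx → Chan → Ty → Prop
  | hole : WF Δ' a' → CtxTyped Δ' a' A' .hole Δ' a' A'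
  | cutL {Δ₁ Δ₂ : LCtx} {a c : Chan} {A C : Ty} {K : Hole} {Q : Proc} :
      WF (Δ₁ + Δ₂) c → CtxTyped Δ' a' A' K Δ₁ a A → Typed ((a, A) ::ₘ Δ₂) Q c C →
      CtxTyped Δ' a' A' (.cutL a A K Q) (Δ₁ + Δ₂) c C
  | cutR {Δ₁ Δ₂ : LCtx} {a c : Chan} {A C : Ty} {P : Proc} {K : Hole} :
      WF (Δ₁ + Δ₂) c → Typed Δ₁ P a A → CtxTyped Δ' a' A' K ((a, A) ::ₘ Δ₂) c C →
      CtxTyped Δ' a' A' (.cutR a A P K) (Δ₁ + Δ₂) c C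
  | oneL {Δ : LCtx} {a c : Chan} {C : Ty} {K : Hole} :
      WF ((a, .one) ::ₘ Δ) c → CtxTyped Δ' a' A' K Δ c C →
      CtxTyped Δ' a' A' (.wait a K) ((a, .one) ::ₘ Δ) c C
  | tensorR {Δ : LCtx} {a b : Chan} {A B : Ty} {K : Hole} :
      WF ((b, B) ::ₘ Δ) a → CtxTyped Δ' a' A' K Δ a A →
      CtxTyped Δ' a' A' (.sendC a b K) ((b, B) ::ₘ Δ) a (.tensor B A)
  | tensorL {Δ : LCtx} {a b c : Chan} {A B C : Ty} {K : Hole} :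
      WF ((a, .tensor B A) ::ₘ Δ) c →
      CtxTyped Δ' a' A' K ((b, B) ::ₘ (a, A) ::ₘ Δ) c C →
      CtxTyped Δ' a' A' (.recvC b a K) ((a, .tensor B A) ::ₘ Δ) c C
  | plusR {Δ : LCtx} {a : Chan} {L : Finset Label} {A : {l // l ∈ L} → Ty} {K : Hole}
      (k : {l // l ∈ L}) :
      WF Δ a → CtxTyped Δ' a' A' K Δ a (A k) →
      CtxTyped Δ' a' A' (.sendL a k K) Δ a (.plus L A)
  | plusL {Δ : LCtx} {a c : Chan} {C : Ty} {L : Finset Label} {A : {l // l ∈ L} → Ty}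
      {k : {l // l ∈ L}} {K : Hole} {P : {l : {l // l ∈ L} // l ≠ k} → Proc} :
      WF ((a, .plus L A) ::ₘ Δ) c → CtxTyped Δ' a' A' K ((a, A k) ::ₘ Δ) c C →
      (∀ l, Typed ((a, A l.1) ::ₘ Δ) (P l) c C) →
      CtxTyped Δ' a' A' (.branch a L k K P) ((a, .plus L A) ::ₘ Δ) c C
  | ampR {Δ : LCtx} {a : Chan} {L : Finset Label} {A : {l // l ∈ L} → Ty}
      {k : {l // l ∈ L}} {K : Hole} {P : {l : {l // l ∈ L} // l ≠ k} → Proc} :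
      WF Δ a → CtxTyped Δ' a' A' K Δ a (A k) → (∀ l, Typed Δ (P l) a (A l.1)) →
      CtxTyped Δ' a' A' (.branch a L k K P) Δ a (.amp L A)
  | ampL {Δ : LCtx} {a c : Chan} {C : Ty} {L : Finset Label} {A : {l // l ∈ L} → Ty} {K : Hole}
      (k : {l // l ∈ L}) :
      WF ((a, .amp L A) ::ₘ Δ) c → CtxTyped Δ' a' A' K ((a, A k) ::ₘ Δ) c C →
      CtxTyped Δ' a' A' (.sendL a k K) ((a, .amp L A) ::ₘ Δ) c C
  | muR {Δ : LCtx} {a : Chan} {A : STy 1} {K : Hole} :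
      WF Δ a → CtxTyped Δ' a' A' K Δ a A.unfold →
      CtxTyped Δ' a' A' (.sendU a K) Δ a (.mu A)
  | muL {Δ : LCtx} {a c : Chan} {A : STy 1} {C : Ty} {K : Hole} :
      WF ((a, .mu A) ::ₘ Δ) c → CtxTyped Δ' a' A' K ((a, A.unfold) ::ₘ Δ) c C →
      CtxTyped Δ' a' A' (.recvU a K) ((a, .mu A) ::ₘ Δ) c C

/-- Observational congruence of `· ; Δ ⊢ P :: c : C` and `· ; Δ ⊢ Q :: c : C`: in every typed
context, the operational observations of the two processes exist and are equal. -/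
def ObsCongruent (Δ : LCtx) (c : Chan) (C : Ty) (P Q : Proc) : Prop :=
  Typed Δ P c C ∧ Typed Δ Q c C ∧
  ∀ (K : Hole) (Δ' : LCtx) (b : Chan) (B : Ty), CtxTyped Δ c C K Δ' b B →
    ∃ v : ObsTuple Δ' b B,
      IsObservation Δ' (K.plug P) b B v ∧ IsObservation Δ' (K.plug Q) b B v

end OCS

open OCS

namespace OCS

/-! ### Renaming -/

/-! Firing the two cuts on either side leads to the same configuration: three processes joined by
two fresh channels. It is therefore enough that firing a rule never changes what can be observed,
and this follows from confluence of rewriting on typed configurations.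

Confluence comes from linear typing. In a typed configuration every channel has one type, at most
one provider and at most one client (`WT`), and reduction preserves this (`Good.step`). Hence
applicable rules never compete for a process or a message (`Good.deterministic`), distinct rules
commute (`StepBy.diamond`), and a step is either absorbed by a finite reduction or can be postponed
past it, up to a permutation of fresh names (`Path.strip`). So no step forecloses an observation
that some finite reduction makes (`May.step`). Conversely a fair execution performs every finite
reduction up to renaming, so at each finite position of a communication tree it shows exactly what
some finite reduction shows (`Trace.IsFair.sees_iff`).

A channel carries at most one message in the course of a trace. The labels at finite positions
therefore determine the observed tree, by bisimulation (`Observes.eq`); the tree exists by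
corecursion (`Coherent.exists_observes`), and fair executions exist by dovetailing
(`Good.exists_fair`). Two typed processes thus have equal observations as soon as finite reductions
can show the same labels for both.

For compositions inside a context, note that the hole is never below a `fix`, so no rule duplicates
the plugged process. The two configurations are at all times equal or differ in one process at one
place (`CfgRel`), and their steps match one for one until the composition itself comes to the top of
a process. There `Assoc.join` makes the two configurations meet, and `May.step` transfers the
observation (`May.of_cfgRel`). -/

theorem liftRen_comp (f g : ℕ → ℕ) : liftRen g ∘ liftRen f = liftRen (g ∘ f) := by
  funext x; cases x <;> rfl

theorem liftRen_id : liftRen id = id := by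
  funext x; cases x <;> rfl

theorem Proc.ren_ren (P : Proc) : ∀ f g : ℕ → ℕ, (P.ren f).ren g = P.ren (g ∘ f) := by
  induction P <;> intro f g <;> simp_all [Proc.ren, liftRen_comp]

theorem Proc.ren_congr (P : Proc) :
    ∀ f g : ℕ → ℕ, (∀ x ∈ P.fcn, f x = g x) → P.ren f = P.ren g := by
  -- Index `0` is fixed by every lifted renaming, so below a binder agreement matters on successors
  -- only.
  have key : ∀ (f g : ℕ → ℕ) (s : Set ℕ), (∀ x, x + 1 ∈ s → f x = g x) →
      ∀ x ∈ s, liftRen f x = liftRen g x := by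
    intro f g s h x hx
    cases x with
    | zero => rfl
    | succ x => simp [liftRen, h x hx]
  induction P with
  | fwd a b => intro f g h; simp_all [Proc.ren, Proc.fcn]
  | cut A P Q ihP ihQ =>
    intro f g h
    simp only [Proc.ren, Proc.cut.injEq, true_and]
    exact ⟨ihP _ _ (key _ _ _ fun x hx => h x (Or.inl hx)),
      ihQ _ _ (key _ _ _ fun x hx => h x (Or.inr hx))⟩
  | close a => intro f g h; simp_all [Proc.ren, Proc.fcn]
  | wait a P ih =>
    intro f g h
    simp only [Proc.ren, Proc.wait.injEq]
    exact ⟨h a (Or.inl rfl), ih _ _ fun x hx => h x (Or.inr hx)⟩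
  | sendC a b P ih =>
    intro f g h
    simp only [Proc.ren, Proc.sendC.injEq]
    exact ⟨h a (Or.inl (Or.inl rfl)), h b (Or.inl (Or.inr rfl)),
      ih _ _ fun x hx => h x (Or.inr hx)⟩
  | recvC a P ih =>
    intro f g h
    simp only [Proc.ren, Proc.recvC.injEq]
    exact ⟨h a (Or.inl rfl), ih _ _ (key _ _ _ fun x hx => h x (Or.inr hx))⟩
  | sendL a k P ih =>
    intro f g h
    simp only [Proc.ren, Proc.sendL.injEq, true_and]
    exact ⟨h a (Or.inl rfl), ih _ _ fun x hx => h x (Or.inr hx)⟩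
  | branch a L P ih =>
    intro f g h
    simp only [Proc.ren, Proc.branch.injEq, heq_eq_eq, true_and]
    exact ⟨h a (Or.inl rfl), funext fun l => ih l _ _ fun x hx =>
      h x (Or.inr (Set.mem_iUnion.2 ⟨l, hx⟩))⟩
  | sendU a P ih =>
    intro f g h
    simp only [Proc.ren, Proc.sendU.injEq]
    exact ⟨h a (Or.inl rfl), ih _ _ fun x hx => h x (Or.inr hx)⟩
  | recvU a P ih =>
    intro f g h
    simp only [Proc.ren, Proc.recvU.injEq]
    exact ⟨h a (Or.inl rfl), ih _ _ fun x hx => h x (Or.inr hx)⟩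
  | pvar i => intro f g h; rfl
  | fix P ih => intro f g h; simp only [Proc.ren]; rw [ih f g h]

theorem Proc.ren_id (P : Proc) : P.ren id = P := by
  induction P <;> simp_all [Proc.ren, liftRen_id]

theorem Proc.ren_eq_self {P : Proc} {f : ℕ → ℕ} (h : ∀ x ∈ P.fcn, f x = x) : P.ren f = P :=
  (P.ren_congr f id h).trans P.ren_id

theorem Proc.ren_pren (P : Proc) : ∀ f g : ℕ → ℕ, (P.pren g).ren f = (P.ren f).pren g := by
  induction P <;> intro f g <;> simp_all [Proc.ren, Proc.pren]

/-- The processes substituted for variables have free channels of their own, so the renaming acts on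
them as well. Below a channel binder they are weakened, and weakening commutes with the lifted
renaming. -/
theorem Proc.ren_subst (P : Proc) : ∀ (f : ℕ → ℕ) (s : ℕ → Proc),
    (P.subst s).ren f = (P.ren f).subst fun i => (s i).ren f := by
  have key : ∀ (f : ℕ → ℕ) (s : ℕ → Proc),
      (fun i => ((s i).ren Nat.succ).ren (liftRen f)) = fun i => ((s i).ren f).ren Nat.succ := by
    intro f s; funext i; rw [Proc.ren_ren, Proc.ren_ren]; rfl
  have key2 : ∀ (f : ℕ → ℕ) (s : ℕ → Proc),
      (fun i => (liftSub s i).ren f) = liftSub fun i => (s i).ren f := by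
    intro f s; funext i; cases i with
    | zero => rfl
    | succ i => exact Proc.ren_pren _ _ _
  induction P <;> intro f s <;> simp_all [Proc.ren, Proc.subst]

theorem Proc.ren_unfold (P : Proc) (f : ℕ → ℕ) : P.unfold.ren f = (P.ren f).unfold := by
  unfold Proc.unfold
  rw [Proc.ren_subst]
  congr 1
  funext i; cases i <;> rfl

/-- Injectivity is needed because `rename` tests names for equality: no name other than `a` may be
sent to `f a`. -/
theorem Proc.ren_rename (P : Proc) {f : ℕ → ℕ} (hf : Function.Injective f) (a d : ℕ) :
    (P.rename a d).ren f = (P.ren f).rename (f a) (f d) := by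
  unfold Proc.rename
  rw [Proc.ren_ren, Proc.ren_ren]
  congr 1
  funext x
  by_cases h : x = a <;> simp [h, hf.eq_iff]

theorem Proc.ren_inst (P : Proc) (f : ℕ → ℕ) (b : ℕ) :
    (P.inst b).ren f = (P.ren (liftRen f)).inst (f b) := by
  unfold Proc.inst
  rw [Proc.ren_ren, Proc.ren_ren]
  congr 1
  funext x; cases x <;> rfl

/-! ### Renaming and substitution in typing derivations -/

/-- Renaming of the channels of a linear context. -/
def LCtx.ren (f : ℕ → ℕ) (Δ : LCtx) : LCtx := Δ.map fun x => (f x.1, x.2)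

theorem LCtx.ren_cons (f : ℕ → ℕ) (a : Chan) (A : Ty) (Δ : LCtx) :
    LCtx.ren f ((a, A) ::ₘ Δ) = (f a, A) ::ₘ LCtx.ren f Δ := by
  simp [LCtx.ren]

theorem LCtx.ren_add (f : ℕ → ℕ) (Δ Δ' : LCtx) :
    LCtx.ren f (Δ + Δ') = LCtx.ren f Δ + LCtx.ren f Δ' := by
  simp [LCtx.ren]

theorem LCtx.ren_ren (f g : ℕ → ℕ) (Δ : LCtx) : LCtx.ren g (LCtx.ren f Δ) = LCtx.ren (g ∘ f) Δ := by
  simp [LCtx.ren]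

theorem LCtx.shift_eq (Δ : LCtx) : LCtx.shift Δ = LCtx.ren Nat.succ Δ := rfl

theorem LCtx.ren_congr {f g : ℕ → ℕ} {Δ : LCtx} (h : ∀ x ∈ Δ, f x.1 = g x.1) :
    LCtx.ren f Δ = LCtx.ren g Δ :=
  Multiset.map_congr rfl fun x hx => by rw [h x hx]

theorem LCtx.ren_eq_self {f : ℕ → ℕ} {Δ : LCtx} (h : ∀ x ∈ Δ, f x.1 = x.1) :
    LCtx.ren f Δ = Δ :=
  (LCtx.ren_congr (g := id) h).trans (Multiset.map_id Δ)

theorem LCtx.ren_shift (f : ℕ → ℕ) (Δ : LCtx) :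
    LCtx.ren (liftRen f) (LCtx.shift Δ) = LCtx.shift (LCtx.ren f Δ) := by
  rw [LCtx.shift_eq, LCtx.shift_eq, LCtx.ren_ren, LCtx.ren_ren]; rfl

/-- Renaming of the channels in the types of process variables. -/
def PCtx.ren (f : ℕ → ℕ) (Ψ : PCtx) : PCtx := Ψ.map fun t => ⟨LCtx.ren f t.ctx, f t.chan, t.ty⟩

theorem PCtx.ren_shift (f : ℕ → ℕ) (Ψ : PCtx) :
    PCtx.ren (liftRen f) (PCtx.shift Ψ) = PCtx.shift (PCtx.ren f Ψ) := by
  simp [PCtx.ren, PCtx.shift, LCtx.ren_shift, liftRen]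

/-- The renaming may identify names: `HasType` does not ask for distinctness and linear contexts are
multisets. The types of process variables are renamed too, since an occurrence of a variable carries
no channels in its syntax. -/
theorem HasType.ren {Ψ : PCtx} {Δ : LCtx} {P : Proc} {c : Chan} {C : Ty}
    (h : HasType Ψ Δ P c C) : ∀ f : ℕ → ℕ,
    HasType (PCtx.ren f Ψ) (LCtx.ren f Δ) (P.ren f) (f c) C := by
  induction h with
  | fwd h => intro f; exact .fwd h
  | cut _ _ ih₁ ih₂ =>
    intro f
    rw [LCtx.ren_add]
    have h₁ := ih₁ (liftRen f)
    have h₂ := ih₂ (liftRen f)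
    rw [PCtx.ren_shift, LCtx.ren_shift] at h₁
    rw [PCtx.ren_shift, LCtx.ren_cons, LCtx.ren_shift] at h₂
    exact .cut h₁ h₂
  | oneR => intro f; exact .oneR
  | oneL _ ih => intro f; rw [LCtx.ren_cons]; exact .oneL (ih f)
  | tensorR _ ih => intro f; rw [LCtx.ren_cons]; exact .tensorR (ih f)
  | tensorL _ ih =>
    intro f
    rw [LCtx.ren_cons]
    have h := ih (liftRen f)
    rw [PCtx.ren_shift, LCtx.ren_cons, LCtx.ren_cons, LCtx.ren_shift] at h
    exact .tensorL h
  | plusR k _ ih => intro f; exact .plusR k (ih f)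
  | plusL _ ih =>
    intro f; rw [LCtx.ren_cons]
    exact .plusL fun l => by have := ih l f; rwa [LCtx.ren_cons] at this
  | ampR _ ih => intro f; exact .ampR fun l => ih l f
  | ampL k _ ih =>
    intro f; rw [LCtx.ren_cons]
    exact .ampL k (by have := ih f; rwa [LCtx.ren_cons] at this)
  | muR _ ih => intro f; exact .muR (ih f)
  | muL _ ih =>
    intro f; rw [LCtx.ren_cons]
    exact .muL (by have := ih f; rwa [LCtx.ren_cons] at this)
  | @pvar Ψ i t h =>
    intro f
    exact HasType.pvar (t := ⟨LCtx.ren f t.ctx, f t.chan, t.ty⟩) (by simp [PCtx.ren, h])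
  | fix _ ih => intro f; exact .fix (ih f)

theorem HasType.ren_nil {Δ : LCtx} {P : Proc} {c : Chan} {C : Ty}
    (h : HasType [] Δ P c C) (f : ℕ → ℕ) : HasType [] (LCtx.ren f Δ) (P.ren f) (f c) C :=
  h.ren f

/-- Weakening of process variables, used to carry a substitution below `fix`. -/
theorem HasType.pren {Ψ : PCtx} {Δ : LCtx} {P : Proc} {c : Chan} {C : Ty}
    (h : HasType Ψ Δ P c C) : ∀ (Ψ' : PCtx) (g : ℕ → ℕ),
    (∀ i t, Ψ[i]? = some t → Ψ'[g i]? = some t) → HasType Ψ' Δ (P.pren g) c C := by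
  have key : ∀ {Ψ Ψ' : PCtx} {g : ℕ → ℕ}, (∀ i t, Ψ[i]? = some t → Ψ'[g i]? = some t) →
      ∀ i t, Ψ.shift[i]? = some t → Ψ'.shift[g i]? = some t := by
    intro Ψ Ψ' g hg i t ht
    simp only [PCtx.shift, List.getElem?_map, Option.map_eq_some_iff] at ht ⊢
    obtain ⟨t', ht', rfl⟩ := ht
    exact ⟨t', hg _ _ ht', rfl⟩
  induction h with
  | fwd h => intro Ψ' g hg; exact .fwd h
  | cut _ _ ih₁ ih₂ => intro Ψ' g hg; exact .cut (ih₁ _ _ (key hg)) (ih₂ _ _ (key hg))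
  | oneR => intro Ψ' g hg; exact .oneR
  | oneL _ ih => intro Ψ' g hg; exact .oneL (ih _ _ hg)
  | tensorR _ ih => intro Ψ' g hg; exact .tensorR (ih _ _ hg)
  | tensorL _ ih => intro Ψ' g hg; exact .tensorL (ih _ _ (key hg))
  | plusR k _ ih => intro Ψ' g hg; exact .plusR k (ih _ _ hg)
  | plusL _ ih => intro Ψ' g hg; exact .plusL fun l => ih l _ _ hg
  | ampR _ ih => intro Ψ' g hg; exact .ampR fun l => ih l _ _ hg
  | ampL k _ ih => intro Ψ' g hg; exact .ampL k (ih _ _ hg)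
  | muR _ ih => intro Ψ' g hg; exact .muR (ih _ _ hg)
  | muL _ ih => intro Ψ' g hg; exact .muL (ih _ _ hg)
  | pvar h => intro Ψ' g hg; exact .pvar (hg _ _ h)
  | fix _ ih =>
    intro Ψ' g hg
    refine .fix (ih _ _ fun i t ht => ?_)
    cases i with
    | zero => simpa [liftRen] using ht
    | succ i => simpa [liftRen] using hg i t (by simpa using ht)

/-- A variable is typed in exactly the linear context recorded for it, so its substitute takes its
place without any splitting of resources. -/
theorem HasType.subst {Ψ : PCtx} {Δ : LCtx} {P : Proc} {c : Chan} {C : Ty}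
    (h : HasType Ψ Δ P c C) : ∀ (Ψ' : PCtx) (s : ℕ → Proc),
    (∀ i t, Ψ[i]? = some t → HasType Ψ' t.ctx (s i) t.chan t.ty) →
    HasType Ψ' Δ (P.subst s) c C := by
  have key : ∀ {Ψ Ψ' : PCtx} {s : ℕ → Proc},
      (∀ i t, Ψ[i]? = some t → HasType Ψ' t.ctx (s i) t.chan t.ty) →
      ∀ i t, Ψ.shift[i]? = some t →
        HasType Ψ'.shift t.ctx ((s i).ren Nat.succ) t.chan t.ty := by
    intro Ψ Ψ' s hs i t ht
    simp only [PCtx.shift, List.getElem?_map, Option.map_eq_some_iff] at ht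
    obtain ⟨t', ht', rfl⟩ := ht
    exact (hs _ _ ht').ren Nat.succ
  induction h with
  | fwd h => intro Ψ' s hs; exact .fwd h
  | cut _ _ ih₁ ih₂ => intro Ψ' s hs; exact .cut (ih₁ _ _ (key hs)) (ih₂ _ _ (key hs))
  | oneR => intro Ψ' s hs; exact .oneR
  | oneL _ ih => intro Ψ' s hs; exact .oneL (ih _ _ hs)
  | tensorR _ ih => intro Ψ' s hs; exact .tensorR (ih _ _ hs)
  | tensorL _ ih => intro Ψ' s hs; exact .tensorL (ih _ _ (key hs))
  | plusR k _ ih => intro Ψ' s hs; exact .plusR k (ih _ _ hs)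
  | plusL _ ih => intro Ψ' s hs; exact .plusL fun l => ih l _ _ hs
  | ampR _ ih => intro Ψ' s hs; exact .ampR fun l => ih l _ _ hs
  | ampL k _ ih => intro Ψ' s hs; exact .ampL k (ih _ _ hs)
  | muR _ ih => intro Ψ' s hs; exact .muR (ih _ _ hs)
  | muL _ ih => intro Ψ' s hs; exact .muL (ih _ _ hs)
  | pvar h => intro Ψ' s hs; exact hs _ _ h
  | @fix Ψ Δ c C P _ ih =>
    intro Ψ' s hs
    refine .fix (ih _ _ fun i t ht => ?_)
    cases i with
    | zero => exact .pvar (by simpa using ht)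
    | succ i => exact (hs i t (by simpa using ht)).pren _ _ (by simp)

theorem HasType.unfold {Δ : LCtx} {P : Proc} {c : Chan} {C : Ty}
    (h : HasType [⟨Δ, c, C⟩] Δ P c C) : HasType [] Δ P.unfold c C := by
  refine h.subst _ _ fun i t ht => ?_
  cases i with
  | zero =>
    obtain rfl : (⟨Δ, c, C⟩ : PTy) = t := by simpa using ht
    exact .fix h
  | succ i => simp at ht

/-- This confines the names of a typed process to its judgment. It makes untyped channels fresh, and
it yields the side conditions of reassociation. -/
theorem HasType.fcn {Ψ : PCtx} {Δ : LCtx} {P : Proc} {c : Chan} {C : Ty}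
    (h : HasType Ψ Δ P c C) : ∀ x ∈ P.fcn, x = c ∨ ∃ A, (x, A) ∈ Δ := by
  induction h with
  | fwd h => simp [Proc.fcn]
  | cut _ _ ih₁ ih₂ =>
    rintro x (hx | hx)
    · have := ih₁ _ hx
      simp [LCtx.shift] at this
      grind
    · have := ih₂ _ hx
      simp [LCtx.shift] at this
      grind
  | oneR => simp [Proc.fcn]
  | tensorL _ ih =>
    rintro x (hx | hx)
    · grind
    · have := ih _ hx
      simp [LCtx.shift] at this
      grind
  | oneL _ ih => intro x hx; simp [Proc.fcn] at hx ⊢; grind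
  | tensorR _ ih => intro x hx; simp [Proc.fcn] at hx ⊢; grind
  | plusR k _ ih => intro x hx; simp [Proc.fcn] at hx ⊢; grind
  | plusL _ ih =>
    intro x hx; simp only [Proc.fcn, Set.singleton_union, Set.mem_insert_iff,
      Set.mem_iUnion, Multiset.mem_cons, Prod.mk.injEq] at hx ih ⊢
    rcases hx with hx | ⟨l, hx⟩
    · grind
    · have := ih l x hx; grind
  | ampR _ ih =>
    intro x hx; simp only [Proc.fcn, Set.singleton_union, Set.mem_insert_iff,
      Set.mem_iUnion] at hx ih ⊢
    rcases hx with hx | ⟨l, hx⟩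
    · grind
    · have := ih l x hx; grind
  | ampL k _ ih => intro x hx; simp [Proc.fcn] at hx ih ⊢; grind
  | muR _ ih => intro x hx; simp [Proc.fcn] at hx ⊢; grind
  | muL _ ih => intro x hx; simp [Proc.fcn] at hx ih ⊢; grind
  | pvar h => simp [Proc.fcn]
  | fix _ ih => exact ih

theorem HasType.rename_provider {Δ : LCtx} {P : Proc} {a d : Chan} {C : Ty}
    (h : HasType [] Δ P a C) (ha : ∀ x ∈ Δ, x.1 ≠ a) : HasType [] Δ (P.rename a d) d C := by
  have := h.ren_nil fun x => if x = a then d else x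
  rwa [LCtx.ren_eq_self (fun x hx => if_neg (ha x hx)), if_pos rfl] at this

theorem HasType.rename_client {Δ : LCtx} {P : Proc} {a c d : Chan} {A C : Ty}
    (h : HasType [] ((a, A) ::ₘ Δ) P c C) (ha : ∀ x ∈ Δ, x.1 ≠ a) (hc : c ≠ a) :
    HasType [] ((d, A) ::ₘ Δ) (P.rename a d) c C := by
  have := h.ren_nil fun x => if x = a then d else x
  rwa [LCtx.ren_cons, LCtx.ren_eq_self (fun x hx => if_neg (ha x hx)), if_pos rfl,
    if_neg hc] at this

theorem LCtx.ren_shift_eq_self (Δ : LCtx) {f : ℕ → ℕ} (hf : ∀ x ∈ Δ, f (x.1 + 1) = x.1) :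
    LCtx.ren f (LCtx.shift Δ) = Δ := by
  rw [LCtx.shift_eq, LCtx.ren_ren]
  exact LCtx.ren_eq_self hf

theorem HasType.inst_provider {Δ : LCtx} {P : Proc} {A : Ty}
    (h : HasType [] (LCtx.shift Δ) P 0 A) (b : Chan) : HasType [] Δ (P.inst b) b A := by
  have := h.ren_nil fun x => match x with | 0 => b | n + 1 => n
  rwa [LCtx.ren_shift_eq_self _ (fun x _ => rfl)] at this

theorem HasType.inst_client {Δ : LCtx} {P : Proc} {c : Chan} {A C : Ty}
    (h : HasType [] ((0, A) ::ₘ LCtx.shift Δ) P (c + 1) C) (b : Chan) :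
    HasType [] ((b, A) ::ₘ Δ) (P.inst b) c C := by
  have := h.ren_nil fun x => match x with | 0 => b | n + 1 => n
  rwa [LCtx.ren_cons, LCtx.ren_shift_eq_self _ (fun x _ => rfl)] at this

/-- The simultaneous substitution of `e` for the index `0` and of `d` for the free channel `a`. -/
def recvRen (a e d : Chan) : ℕ → ℕ
  | 0 => e
  | y + 1 => if y = a then d else y

theorem HasType.inst_recv {Δ : LCtx} {P : Proc} {a c e d : Chan} {A B C : Ty}
    (h : HasType [] ((0, B) ::ₘ (a + 1, A) ::ₘ LCtx.shift Δ) P (c + 1) C)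
    (ha : ∀ x ∈ Δ, x.1 ≠ a) (hc : c ≠ a) :
    HasType [] ((e, B) ::ₘ (d, A) ::ₘ Δ) (P.ren (recvRen a e d)) c C := by
  have := h.ren_nil (recvRen a e d)
  rw [LCtx.ren_cons, LCtx.ren_cons,
    LCtx.ren_shift_eq_self _ (fun x hx => if_neg (ha x hx))] at this
  simpa [recvRen, hc] using this

/-- The label is a variable `l` tied to `k` by an equation. With the value of a subtype element in
its place, the index could not be unified by case analysis. -/
theorem HasType.sendL_inv {Δ : LCtx} {P : Proc} {a c : Chan} {l : Label} {C : Ty}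
    (h : HasType [] Δ (.sendL a l P) c C) :
    (∃ (L : Finset Label) (A : {l // l ∈ L} → Ty) (k : {l // l ∈ L}), k.1 = l ∧ c = a ∧
      C = .plus L A ∧ HasType [] Δ P a (A k)) ∨
    ∃ (L : Finset Label) (A : {l // l ∈ L} → Ty) (k : {l // l ∈ L}) (Δ' : LCtx), k.1 = l ∧
      Δ = (a, .amp L A) ::ₘ Δ' ∧ HasType [] ((a, A k) ::ₘ Δ') P c C := by
  cases h with
  | plusR k h => exact Or.inl ⟨_, _, k, rfl, rfl, rfl, h⟩
  | ampL k h => exact Or.inr ⟨_, _, k, _, rfl, rfl, h⟩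

/-! ### The parts of a rule instantiation -/

/-- The channel provided by the process that a rule rewrites. -/
def Inst.chan : Inst → Chan
  | .fwd _ b _ => b
  | .cut c _ _ _ => c
  | .close a => a
  | .wait _ c _ => c
  | .sendC a _ _ _ _ => a
  | .recvC _ _ _ c _ => c
  | .plusSend a _ _ _ _ => a
  | .plusRecv _ _ c _ _ _ _ => c
  | .ampSend _ c _ _ _ _ => c
  | .ampRecv a _ _ _ _ => a
  | .sendU a _ _ => a
  | .recvU _ _ c _ => c
  | .fix c _ => c

/-- The process that a rule rewrites. -/
def Inst.proc : Inst → Proc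
  | .fwd a b _ => .fwd a b
  | .cut _ A P Q => .cut A P Q
  | .close a => .close a
  | .wait a _ P => .wait a P
  | .sendC a b P _ _ => .sendC a b P
  | .recvC a _ _ _ P => .recvC a P
  | .plusSend a _ _ k P => .sendL a k P
  | .plusRecv a _ _ _ L _ P => .branch a L P
  | .ampSend a _ _ _ k P => .sendL a k P
  | .ampRecv a _ L _ P => .branch a L P
  | .sendU a _ P => .sendU a P
  | .recvU a _ _ P => .recvU a P
  | .fix _ P => .fix P

/-- The message that a rule consumes. -/
def Inst.inp : Inst → Option (Chan × Msg)
  | .fwd a _ m => some (a, m)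
  | .wait a _ _ => some (a, .close)
  | .recvC a e d _ _ => some (a, .chan e d)
  | .plusRecv a d _ _ _ k _ => some (a, .label k d)
  | .ampRecv a d _ k _ => some (a, .label k d)
  | .recvU a d _ _ => some (a, .unfold d)
  | _ => none

/-- The persistent premise of a rule. -/
def Inst.per : Inst → Option (Chan × Ty)
  | .sendC a _ _ B A => some (a, .tensor B A)
  | .plusSend a L A _ _ => some (a, .plus L A)
  | .ampSend a _ L A _ _ => some (a, .amp L A)
  | .sendU a A _ => some (a, .mu A)
  | _ => none

/-- The judgments `msg` for a list of channels and messages. -/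
def msgs (s : Multiset (Chan × Msg)) : Config := s.map fun x => .msg x.1 x.2

/-- The judgments `type` for a list of channels and types. -/
def typs (Θ : LCtx) : Config := Θ.map fun x => .typ x.1 x.2

/-- The ephemeral judgments that a rule consumes. -/
def Inst.eph (r : Inst) : Config := .proc r.chan r.proc ::ₘ msgs (r.inp.elim 0 fun x => {x})

/-- The judgments that a rule adds. -/
def Inst.out : Inst → Chan → Config
  | .fwd _ b m, _ => {.msg b m}
  | .cut c A P Q, n => {.proc n (P.inst n), .proc c (Q.inst n), .typ n A}
  | .close a, _ => {.msg a .close}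
  | .wait _ c P, _ => {.proc c P}
  | .sendC a b P _ A, n => {.proc n (P.rename a n), .msg a (.chan b n), .typ n A}
  | .recvC a e d c P, _ => {.proc c (P.ren (recvRen a e d))}
  | .plusSend a _ A k P, n => {.msg a (.label k n), .proc n (P.rename a n), .typ n (A k)}
  | .plusRecv a d c _ _ k P, _ => {.proc c ((P k).rename a d)}
  | .ampSend a c _ A k P, n => {.msg a (.label k n), .proc c (P.rename a n), .typ n (A k)}
  | .ampRecv a d _ k P, _ => {.proc d ((P k).rename a d)}
  | .sendU a A P, n => {.msg a (.unfold n), .proc n (P.rename a n), .typ n A.unfold}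
  | .recvU a d c P, _ => {.proc c (P.rename a d)}
  | .fix c P, _ => {.proc c P.unfold}

/-- Separates what a rule consumes from the type that it only reads. Several rules may read the same
persistent judgment; only ephemeral judgments could be competed for. -/
theorem Inst.lhs_eq (r : Inst) : r.lhs = r.eph + typs (r.per.elim 0 fun x => {x}) := by
  cases r <;> simp [Inst.lhs, Inst.eph, Inst.chan, Inst.proc, Inst.inp, Inst.per, msgs, typs]
  all_goals exact Multiset.pair_comm _ _

theorem Inst.rhs_eq (r : Inst) (n : Chan) :
    r.rhs n = r.out n + typs (r.per.elim 0 fun x => {x}) := by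
  cases r <;> simp [Inst.rhs, Inst.out, Inst.per, typs]
  -- What remains is `recvC`, whose substitution in `rhs` is `recvRen` written out.
  rfl

/-! ### Typed configurations -/

/-- `JTyped j Δ c C`: the ephemeral judgment `j` uses `Δ` and provides `c : C`. -/
inductive JTyped : Judg → LCtx → Chan → Ty → Prop
  | proc {Δ : LCtx} {P : Proc} {c : Chan} {C : Ty} :
      HasType [] Δ P c C → JTyped (.proc c P) Δ c C
  | close {a : Chan} : JTyped (.msg a .close) 0 a .one
  | chan {a e d : Chan} {B A : Ty} :
      JTyped (.msg a (.chan e d)) {(e, B), (d, A)} a (.tensor B A)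
  | plus {a d : Chan} {l : Label} {L : Finset Label} {A : {l // l ∈ L} → Ty}
      (k : {l // l ∈ L}) (h : k.1 = l) : JTyped (.msg a (.label l d)) {(d, A k)} a (.plus L A)
  | amp {a d : Chan} {l : Label} {L : Finset Label} {A : {l // l ∈ L} → Ty}
      (k : {l // l ∈ L}) (h : k.1 = l) : JTyped (.msg a (.label l d)) {(a, .amp L A)} d (A k)
  | unfold {a d : Chan} {A : STy 1} :
      JTyped (.msg a (.unfold d)) {(d, A.unfold)} a (.mu A)

/-- An ephemeral judgment with the channels that it uses and the channel that it provides. -/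
structure Cell where
  judg : Judg
  ctx : LCtx
  chan : Chan
  ty : Ty

/-- The channels provided by a multiset of judgments. -/
def provs (G : Multiset Cell) : LCtx := G.map fun g => (g.chan, g.ty)

/-- The channels used by a multiset of judgments. -/
def uses (G : Multiset Cell) : LCtx := G.bind Cell.ctx

theorem provs_add (G G' : Multiset Cell) : provs (G + G') = provs G + provs G' := by
  simp [provs]

theorem uses_add (G G' : Multiset Cell) : uses (G + G') = uses G + uses G' := by
  simp [uses]

theorem mem_provs {G : Multiset Cell} {g : Cell} (h : g ∈ G) : (g.chan, g.ty) ∈ provs G :=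
  Multiset.mem_map.2 ⟨g, h, rfl⟩

theorem mem_uses {G : Multiset Cell} {g : Cell} (h : g ∈ G) {x : Chan × Ty} (hx : x ∈ g.ctx) :
    x ∈ uses G :=
  Multiset.mem_bind.2 ⟨g, h, hx⟩

/-- Typing of a configuration with ephemeral part `G` and persistent part `Θ`: every channel has
one type, at most one provider and at most one client; `rk` witnesses that the relation between
the channels used and provided by the same judgment is acyclic. -/
structure WT (G : Multiset Cell) (Θ : LCtx) (rk : Chan → ℚ) : Prop where
  ok : ∀ g ∈ G, JTyped g.judg g.ctx g.chan g.ty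
  prov : ((provs G).map Prod.fst).Nodup
  use : ((uses G).map Prod.fst).Nodup
  tprov : ∀ x ∈ provs G, x ∈ Θ
  tuse : ∀ x ∈ uses G, x ∈ Θ
  func : ∀ x A B, (x, A) ∈ Θ → (x, B) ∈ Θ → A = B
  rank : ∀ g ∈ G, ∀ x ∈ g.ctx, rk x.1 < rk g.chan

theorem WT.mono {G G' : Multiset Cell} {Θ : LCtx} {rk : Chan → ℚ} (h : WT G Θ rk) (hG : G' ≤ G) :
    WT G' Θ rk := by
  obtain ⟨G₀, rfl⟩ := Multiset.le_iff_exists_add.1 hG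
  have hp := h.prov
  have hu := h.use
  have tp := h.tprov
  have tu := h.tuse
  rw [provs_add] at hp tp
  rw [uses_add] at hu tu
  rw [Multiset.map_add] at hp hu
  exact ⟨fun g hg => h.ok g (Multiset.mem_add.2 (Or.inl hg)),
    Multiset.nodup_of_le (Multiset.le_add_right _ _) hp,
    Multiset.nodup_of_le (Multiset.le_add_right _ _) hu,
    fun x hx => tp x (Multiset.mem_add.2 (Or.inl hx)),
    fun x hx => tu x (Multiset.mem_add.2 (Or.inl hx)), h.func,
    fun g hg => h.rank g (Multiset.mem_add.2 (Or.inl hg))⟩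

/-- The effect of a rule on the interface of the judgments it rewrites: it preserves the channels
used and provided, adds a fresh channel to both, or removes from both the channel of the message
that it consumes. -/
inductive Change (r : Inst) (n : Chan) (rk : Chan → ℚ) (G G' : Multiset Cell) : LCtx → Prop
  | keep : r.inp = none → provs G' = provs G → uses G' = uses G →
      (∀ g ∈ G', ∀ x ∈ g.ctx, rk x.1 < rk g.chan) → Change r n rk G G' 0
  | add {A : Ty} (q : ℚ) : r.inp = none → r.bindsFresh → provs G' = (n, A) ::ₘ provs G →
      uses G' = (n, A) ::ₘ uses G →
      (∀ g ∈ G', ∀ x ∈ g.ctx, Function.update rk n q x.1 < Function.update rk n q g.chan) →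
      Change r n rk G G' {(n, A)}
  | remove {a : Chan} {m : Msg} {A : Ty} : r.inp = some (a, m) → provs G = (a, A) ::ₘ provs G' →
      uses G = (a, A) ::ₘ uses G' → (∀ g ∈ G', ∀ x ∈ g.ctx, rk x.1 < rk g.chan) →
      Change r n rk G G' 0

/-- Density of `ℚ` gives a fresh channel a rank between those of the channels its provider uses and
that of the channel its client provides, without moving any existing rank. -/
theorem exists_between_ctx (rk : Chan → ℚ) (b : ℚ) (Δ : LCtx) (h : ∀ x ∈ Δ, rk x.1 < b) :
    ∃ q < b, ∀ x ∈ Δ, rk x.1 < q := by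
  induction Δ using Multiset.induction with
  | empty => exact ⟨b - 1, by linarith, by simp⟩
  | cons y Δ ih =>
    obtain ⟨q, hq, hΔ⟩ := ih fun x hx => h x (Multiset.mem_cons_of_mem hx)
    obtain ⟨q', hq', hb⟩ := exists_between (max_lt hq (h y (Multiset.mem_cons_self _ _)))
    refine ⟨q', hb, fun x hx => ?_⟩
    rcases Multiset.mem_cons.1 hx with rfl | hx
    · exact (le_max_right _ _).trans_lt hq'
    · exact (hΔ x hx).trans ((le_max_left _ _).trans_lt hq')

theorem JTyped.proc_inv {Δ : LCtx} {P : Proc} {c c' : Chan} {C : Ty}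
    (h : JTyped (.proc c P) Δ c' C) : c' = c ∧ HasType [] Δ P c C := by
  cases h with
  | proc h => exact ⟨rfl, h⟩

/-- What is known of a process in a typed configuration. -/
structure ProcWT (Δ : LCtx) (P : Proc) (c : Chan) (C : Ty) (Θ : LCtx) (rk : Chan → ℚ) : Prop where
  typed : HasType [] Δ P c C
  prov : (c, C) ∈ Θ
  use : ∀ x ∈ Δ, x ∈ Θ
  rank : ∀ x ∈ Δ, rk x.1 < rk c
  nodup : (Δ.map Prod.fst).Nodup

theorem WT.procWT {G : Multiset Cell} {Θ : LCtx} {rk : Chan → ℚ} (h : WT G Θ rk) {g : Cell}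
    (hg : g ∈ G) {c : Chan} {P : Proc} (hj : g.judg = .proc c P) :
    g.chan = c ∧ ProcWT g.ctx P c g.ty Θ rk := by
  have ok := h.ok g hg
  rw [hj] at ok
  obtain ⟨hc, ht⟩ := ok.proc_inv
  refine ⟨hc, ht, hc ▸ h.tprov _ (mem_provs hg), fun x hx => h.tuse _ (mem_uses hg hx),
    hc ▸ h.rank g hg, ?_⟩
  exact Multiset.nodup_of_le (Multiset.map_le_map (Multiset.le_bind _ hg)) h.use

theorem WT.of_eph_none {G : Multiset Cell} {Θ : LCtx} {rk : Chan → ℚ} (h : WT G Θ rk) {r : Inst}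
    (he : G.map Cell.judg = r.eph) (hr : r.inp = none) :
    ∃ Δ C, G = {⟨.proc r.chan r.proc, Δ, r.chan, C⟩} ∧ ProcWT Δ r.proc r.chan C Θ rk := by
  rw [Inst.eph, hr] at he
  obtain ⟨⟨j, Δ, c, C⟩, rfl, hj⟩ := Multiset.map_eq_singleton.1 he
  obtain ⟨hc, hp⟩ := h.procWT (Multiset.mem_singleton_self _) hj
  cases hj
  cases hc
  exact ⟨Δ, C, rfl, hp⟩

theorem WT.of_eph_some {G : Multiset Cell} {Θ : LCtx} {rk : Chan → ℚ} (h : WT G Θ rk) {r : Inst}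
    (he : G.map Cell.judg = r.eph) {a : Chan} {m : Msg} (hr : r.inp = some (a, m)) :
    ∃ Δ C Δ' c' C', G = {⟨.proc r.chan r.proc, Δ, r.chan, C⟩, ⟨.msg a m, Δ', c', C'⟩} ∧
      ProcWT Δ r.proc r.chan C Θ rk ∧ JTyped (.msg a m) Δ' c' C' := by
  classical
  rw [Inst.eph, hr] at he
  obtain ⟨⟨j, Δ, c, C⟩, hg, hj, he⟩ := (Multiset.map_eq_cons ..).2 he
  obtain ⟨⟨j', Δ', c', C'⟩, he', hj'⟩ := Multiset.map_eq_singleton.1 he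
  obtain ⟨hc, hp⟩ := h.procWT hg hj
  have hG : G = {⟨j, Δ, c, C⟩, ⟨j', Δ', c', C'⟩} := by
    rw [← Multiset.cons_erase hg, he']; rfl
  subst hG
  have ok := h.ok ⟨j', Δ', c', C'⟩ (by simp)
  cases hj
  cases hc
  cases hj'
  exact ⟨Δ, C, Δ', c', C', rfl, hp, ok⟩

/-- This is what the rank is for: a cycle through a single process is excluded, so renaming a used
channel does not touch the provided one, and a client is never mistaken for the provider. -/
theorem ProcWT.ne {Δ : LCtx} {P : Proc} {c : Chan} {C : Ty} {Θ : LCtx} {rk : Chan → ℚ}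
    (h : ProcWT Δ P c C Θ rk) : ∀ x ∈ Δ, x.1 ≠ c := by
  intro x hx he
  have := h.rank x hx
  rw [he] at this
  exact lt_irrefl _ this

theorem ProcWT.cons_ne {Δ : LCtx} {P : Proc} {a c : Chan} {A C : Ty} {Θ : LCtx} {rk : Chan → ℚ}
    (h : ProcWT ((a, A) ::ₘ Δ) P c C Θ rk) : (∀ x ∈ Δ, x.1 ≠ a) ∧ c ≠ a := by
  refine ⟨fun x hx he => ?_, fun he => h.ne _ (Multiset.mem_cons_self _ _) he.symm⟩
  have := h.nodup
  rw [Multiset.map_cons, Multiset.nodup_cons] at this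
  exact this.1 (Multiset.mem_map.2 ⟨x, hx, he⟩)

theorem update_rank {n : Chan} {rk : Chan → ℚ} {q : ℚ} {x : Chan} (h : x ≠ n) :
    Function.update rk n q x = rk x := Function.update_of_ne h _ _

/-- Subject reduction for the judgments that a rule rewrites. -/
theorem Inst.local_preservation {r : Inst} {n : Chan} {G : Multiset Cell} {Θ : LCtx}
    {rk : Chan → ℚ} (h : WT G Θ rk) (he : G.map Cell.judg = r.eph)
    (hp : ∀ x, r.per = some x → x ∈ Θ) (hn : r.bindsFresh → ∀ x ∈ Θ, x.1 ≠ n) :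
    ∃ G' Θ', r.out n = G'.map Cell.judg + typs Θ' ∧
      (∀ g ∈ G', JTyped g.judg g.ctx g.chan g.ty) ∧ Change r n rk G G' Θ' := by
  cases r with
  | fwd a b m =>
    obtain ⟨Δ, C, Δ', c', C', rfl, hP, hm⟩ := h.of_eph_some he rfl
    obtain ⟨ht, hprov, huse, hrk, hnd⟩ := hP
    simp only [Inst.chan, Inst.proc] at *
    have ha := h.tprov (c', C') (by simp [provs])
    have hrk' := h.rank ⟨.msg a m, Δ', c', C'⟩ (by simp)
    have hu := fun x hx => h.tuse x (mem_uses (g := ⟨.msg a m, Δ', c', C'⟩) (by simp) hx)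
    cases ht with
    | fwd hpos =>
      have hac := hrk (a, C) (by simp)
      have h1 := huse (a, C) (by simp)
      -- A message on `a` is provided on `a` unless its type is an external choice; that case is
      -- ruled out because only positive types are forwarded. The message can then be provided on
      -- `b` unchanged.
      have key : c' = a ∧ C' = C ∧ JTyped (.msg b m) Δ' b C := by
        cases hm with
        | close => obtain rfl := h.func _ _ _ ha h1; exact ⟨rfl, rfl, .close⟩
        | chan => obtain rfl := h.func _ _ _ ha h1; exact ⟨rfl, rfl, .chan⟩
        | plus k hk => obtain rfl := h.func _ _ _ ha h1; exact ⟨rfl, rfl, .plus k hk⟩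
        | amp k hk =>
          have := h.func _ _ _ (hu _ (Multiset.mem_singleton_self _)) h1
          subst this
          cases hpos
        | unfold => obtain rfl := h.func _ _ _ ha h1; exact ⟨rfl, rfl, .unfold⟩
      obtain ⟨rfl, rfl, hj⟩ := key
      refine ⟨{⟨.msg b m, Δ', b, C'⟩}, 0, by simp [Inst.out, typs], by simpa using hj,
        .remove (A := C') rfl ?_ ?_ ?_⟩
      · simp only [provs, Multiset.insert_eq_cons, Multiset.map_cons, Multiset.map_singleton]
        exact Multiset.pair_comm _ _
      · simp [uses]
      · simp only [Multiset.mem_singleton, forall_eq]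
        exact fun x hx => (hrk' x hx).trans hac
  | cut c A P Q =>
    obtain ⟨Δ, C, rfl, ht, hprov, huse, hrk, hnd⟩ := h.of_eph_none he rfl
    simp only [Inst.chan, Inst.proc] at *
    have hn' := hn trivial
    cases ht with
    | @cut _ Δ₁ Δ₂ _ _ _ _ _ h₁ h₂ =>
      -- The new channel lies above what `P` uses and below `c`.
      obtain ⟨q, hq, hΔ⟩ := exists_between_ctx rk (rk c) Δ₁ fun x hx => hrk x (by simp [hx])
      have hc := hn' _ hprov
      refine ⟨{⟨.proc n (P.inst n), Δ₁, n, A⟩, ⟨.proc c (Q.inst n), (n, A) ::ₘ Δ₂, c, C⟩},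
        {(n, A)}, by simp [Inst.out, typs], ?_, .add q rfl trivial ?_ ?_ ?_⟩
      · simp only [Multiset.insert_eq_cons, Multiset.mem_cons, Multiset.mem_singleton,
          forall_eq_or_imp, forall_eq]
        exact ⟨.proc (h₁.inst_provider n), .proc (h₂.inst_client n)⟩
      · simp [provs]
      · simp [uses]
      · simp only [Multiset.insert_eq_cons, Multiset.mem_cons, Multiset.mem_singleton,
          forall_eq_or_imp, forall_eq, Function.update_self, update_rank hc]
        refine ⟨fun x hx => ?_, hq, fun x hx => ?_⟩
        · rw [update_rank (hn' _ (huse x (by simp [hx])))]; exact hΔ x hx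
        · rw [update_rank (hn' _ (huse x (by simp [hx])))]; exact hrk x (by simp [hx])
  | close a =>
    obtain ⟨Δ, C, rfl, ht, hprov, huse, hrk, hnd⟩ := h.of_eph_none he rfl
    simp only [Inst.chan, Inst.proc] at *
    cases ht with
    | oneR =>
      exact ⟨{⟨.msg a .close, 0, a, .one⟩}, 0, by simp [Inst.out, typs], by simpa using .close,
        .keep rfl (by simp [provs]) (by simp [uses]) (by simp)⟩
  | wait a c P =>
    obtain ⟨Δ, C, Δ', c', C', rfl, hP, hm⟩ := h.of_eph_some he rfl
    simp only [Inst.chan, Inst.proc] at *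
    obtain ⟨ht, hprov, huse, hrk, hnd⟩ := hP
    cases hm
    cases ht with
    | @oneL _ Δ _ _ _ _ ht =>
      refine ⟨{⟨.proc c P, Δ, c, C⟩}, 0, by simp [Inst.out, typs], by simpa using .proc ht,
        .remove (A := .one) rfl ?_ ?_ ?_⟩
      · simp only [provs, Multiset.insert_eq_cons, Multiset.map_cons, Multiset.map_singleton]
        exact Multiset.pair_comm _ _
      · simp [uses]
      · simp only [Multiset.mem_singleton, forall_eq]
        exact fun x hx => hrk x (by simp [hx])
  | sendC a b P B A =>
    obtain ⟨Δ, C, rfl, hP⟩ := h.of_eph_none he rfl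
    simp only [Inst.chan, Inst.proc] at *
    have hne := hP.ne
    obtain ⟨ht, hprov, huse, hrk, hnd⟩ := hP
    have hn' := hn trivial
    cases ht with
    | @tensorR _ Δ _ _ A' B' _ ht =>
      have := h.func _ _ _ hprov (hp _ rfl)
      cases this
      obtain ⟨q, hq, hΔ⟩ := exists_between_ctx rk (rk a) Δ fun x hx => hrk x (by simp [hx])
      have hc := hn' _ hprov
      have hb := hn' _ (huse (b, B) (by simp))
      refine ⟨{⟨.proc n (P.rename a n), Δ, n, A⟩,
          ⟨.msg a (.chan b n), {(b, B), (n, A)}, a, .tensor B A⟩},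
        {(n, A)}, by simp [Inst.out, typs], ?_, .add q rfl trivial ?_ ?_ ?_⟩
      · simp only [Multiset.insert_eq_cons, Multiset.mem_cons, Multiset.mem_singleton,
          forall_eq_or_imp, forall_eq]
        exact ⟨.proc (ht.rename_provider fun x hx => hne x (by simp [hx])), .chan⟩
      · simp [provs]
      · simp [uses]
        rw [add_comm, Multiset.singleton_add, Multiset.cons_swap]
      · simp only [Multiset.insert_eq_cons, Multiset.mem_cons, Multiset.mem_singleton,
          forall_eq_or_imp, forall_eq, Function.update_self, update_rank hc, update_rank hb]
        refine ⟨fun x hx => ?_, hrk (b, B) (by simp), hq⟩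
        rw [update_rank (hn' _ (huse x (by simp [hx])))]; exact hΔ x hx
  | recvC a e d c P =>
    obtain ⟨Δ, C, Δ', c', C', rfl, hP, hm⟩ := h.of_eph_some he rfl
    simp only [Inst.chan, Inst.proc] at *
    obtain ⟨ht, hprov, huse, hrk, hnd⟩ := id hP
    have hrk' := h.rank ⟨.msg a (.chan e d), Δ', c', C'⟩ (by simp)
    have ha := h.tprov (c', C') (by simp [provs])
    cases ht with
    | @tensorL _ Δ _ _ A B _ _ ht =>
      have hne := hP.cons_ne
      have h1 := huse _ (Multiset.mem_cons_self _ _)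
      have h2 := hrk _ (Multiset.mem_cons_self _ _)
      cases hm
      have := h.func _ _ _ ha h1
      cases this
      refine ⟨{⟨.proc c (P.ren (recvRen a e d)), (e, B) ::ₘ (d, A) ::ₘ Δ, c, C⟩}, 0,
        by simp [Inst.out, typs], by simpa using .proc (ht.inst_recv hne.1 hne.2),
        .remove (A := .tensor B A) rfl ?_ ?_ ?_⟩
      · simp only [provs, Multiset.insert_eq_cons, Multiset.map_cons, Multiset.map_singleton]
        exact Multiset.pair_comm _ _
      · simp [uses]
        rw [add_comm, Multiset.singleton_add, Multiset.cons_swap]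
      · simp only [Multiset.insert_eq_cons, Multiset.mem_cons, Multiset.mem_singleton,
          forall_eq_or_imp, forall_eq] at hrk' ⊢
        exact ⟨hrk'.1.trans h2, hrk'.2.trans h2, fun x hx => hrk x (by simp [hx])⟩
  | plusSend a L A k P =>
    obtain ⟨Δ, C, rfl, hP⟩ := h.of_eph_none he rfl
    simp only [Inst.chan, Inst.proc] at *
    have hne := hP.ne
    obtain ⟨ht, hprov, huse, hrk, hnd⟩ := hP
    have hn' := hn trivial
    have h1 := hp _ rfl
    -- The same process sends labels for both kinds of choice. The type read by the rule decides
    -- which typing rule applies, since a channel has only one type.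
    rcases ht.sendL_inv with ⟨L', A', k', hk, -, rfl, ht'⟩ | ⟨L', A', k', Δ', hk, rfl, ht'⟩
    · have := h.func _ _ _ hprov h1
      cases this
      obtain rfl := Subtype.ext hk
      obtain ⟨q, hq, hΔ⟩ := exists_between_ctx rk (rk a) Δ hrk
      have hc := hn' _ hprov
      refine ⟨{⟨.msg a (.label k' n), {(n, A k')}, a, .plus L A⟩,
          ⟨.proc n (P.rename a n), Δ, n, A k'⟩},
        {(n, A k')}, by simp [Inst.out, typs], ?_, .add q rfl trivial ?_ ?_ ?_⟩
      · simp only [Multiset.insert_eq_cons, Multiset.mem_cons, Multiset.mem_singleton,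
          forall_eq_or_imp, forall_eq]
        exact ⟨.plus k' rfl, .proc (ht'.rename_provider hne)⟩
      · simp only [provs, Multiset.insert_eq_cons, Multiset.map_cons, Multiset.map_singleton]
        exact Multiset.pair_comm _ _
      · simp [uses]
      · simp only [Multiset.insert_eq_cons, Multiset.mem_cons, Multiset.mem_singleton,
          forall_eq_or_imp, forall_eq, Function.update_self, update_rank hc]
        refine ⟨hq, fun x hx => ?_⟩
        rw [update_rank (hn' _ (huse x hx))]; exact hΔ x hx
    · have := h.func _ _ _ (huse _ (Multiset.mem_cons_self _ _)) h1
      cases this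
  | plusRecv a d c hca L k P =>
    obtain ⟨Δ, C, Δ', c', C', rfl, hP, hm⟩ := h.of_eph_some he rfl
    simp only [Inst.chan, Inst.proc] at *
    obtain ⟨ht, hprov, huse, hrk, hnd⟩ := id hP
    have hrk' := h.rank ⟨.msg a (.label k d), Δ', c', C'⟩ (by simp)
    have ha := h.tprov (c', C') (by simp [provs])
    have hu := fun x hx => h.tuse x (mem_uses (g := ⟨.msg a (.label k d), Δ', c', C'⟩) (by simp) hx)
    cases ht with
    | ampR => exact absurd rfl hca
    | @plusL _ Δ _ _ _ _ A _ ht =>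
      have hne := hP.cons_ne
      have h1 := huse _ (Multiset.mem_cons_self _ _)
      have h2 := hrk _ (Multiset.mem_cons_self _ _)
      cases hm with
      | plus k' hk =>
        have := h.func _ _ _ ha h1
        cases this
        obtain rfl := Subtype.ext hk
        refine ⟨{⟨.proc c ((P k').rename a d), (d, A k') ::ₘ Δ, c, C⟩}, 0,
          by simp [Inst.out, typs], by simpa using .proc ((ht k').rename_client hne.1 hne.2),
          .remove (A := .plus L A) rfl ?_ ?_ ?_⟩
        · simp only [provs, Multiset.insert_eq_cons, Multiset.map_cons, Multiset.map_singleton]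
          exact Multiset.pair_comm _ _
        · simp [uses]
          rw [add_comm, Multiset.singleton_add]
        · simp only [Multiset.mem_cons, Multiset.mem_singleton,
            forall_eq_or_imp, forall_eq] at hrk' ⊢
          exact ⟨hrk'.trans h2, fun x hx => hrk x (by simp [hx])⟩
      | amp k' hk =>
        have := h.func _ _ _ (hu _ (Multiset.mem_singleton_self _)) h1
        cases this
  | ampSend a c L A k P =>
    obtain ⟨Δ, C, rfl, hP⟩ := h.of_eph_none he rfl
    simp only [Inst.chan, Inst.proc] at *
    obtain ⟨ht, hprov, huse, hrk, hnd⟩ := id hP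
    have hn' := hn trivial
    have h1 := hp _ rfl
    rcases ht.sendL_inv with ⟨L', A', k', hk, rfl, rfl, ht'⟩ | ⟨L', A', k', Δ', hk, rfl, ht'⟩
    · have := h.func _ _ _ hprov h1
      cases this
    · have := h.func _ _ _ (huse _ (Multiset.mem_cons_self _ _)) h1
      cases this
      obtain rfl := Subtype.ext hk
      have hne := hP.cons_ne
      -- The message uses `a` and provides `n`, while the client uses `n` and provides `c`: the rank
      -- of `n` must lie strictly between those of `a` and `c`.
      obtain ⟨q, hq, hc⟩ := exists_between (hrk _ (Multiset.mem_cons_self _ _))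
      have han := hn' _ h1
      have hcn := hn' _ hprov
      refine ⟨{⟨.msg a (.label k' n), {(a, .amp L A)}, n, A k'⟩,
          ⟨.proc c (P.rename a n), (n, A k') ::ₘ Δ', c, C⟩},
        {(n, A k')}, by simp [Inst.out, typs], ?_, .add q rfl trivial ?_ ?_ ?_⟩
      · simp only [Multiset.insert_eq_cons, Multiset.mem_cons, Multiset.mem_singleton,
          forall_eq_or_imp, forall_eq]
        exact ⟨.amp k' rfl, .proc (ht'.rename_client hne.1 hne.2)⟩
      · simp [provs]
      · simp [uses]
      · simp only [Multiset.insert_eq_cons, Multiset.mem_cons, Multiset.mem_singleton,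
          forall_eq_or_imp, forall_eq, Function.update_self, update_rank hcn, update_rank han]
        refine ⟨hq, hc, fun x hx => ?_⟩
        rw [update_rank (hn' _ (huse x (by simp [hx])))]; exact hrk x (by simp [hx])
  | ampRecv a d L k P =>
    obtain ⟨Δ, C, Δ', c', C', rfl, hP, hm⟩ := h.of_eph_some he rfl
    simp only [Inst.chan, Inst.proc] at *
    obtain ⟨ht, hprov, huse, hrk, hnd⟩ := id hP
    have hrk' := h.rank ⟨.msg a (.label k d), Δ', c', C'⟩ (by simp)
    have ha := h.tprov (c', C') (by simp [provs])
    have hu := fun x hx => h.tuse x (mem_uses (g := ⟨.msg a (.label k d), Δ', c', C'⟩) (by simp) hx)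
    have hne := hP.ne
    cases ht with
    | plusL => exact absurd rfl (hne _ (Multiset.mem_cons_self _ _))
    | @ampR _ Δ _ _ A _ ht =>
      cases hm with
      | plus k' hk =>
        have := h.func _ _ _ ha hprov
        cases this
      | amp k' hk =>
        have := h.func _ _ _ (hu _ (Multiset.mem_singleton_self _)) hprov
        cases this
        obtain rfl := Subtype.ext hk
        refine ⟨{⟨.proc d ((P k').rename a d), Δ, d, A k'⟩}, 0,
          by simp [Inst.out, typs], by simpa using .proc ((ht k').rename_provider hne),
          .remove (A := .amp L A) rfl ?_ ?_ ?_⟩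
        · simp [provs]
        · simp [uses]
          rw [add_comm, Multiset.singleton_add]
        · simp only [Multiset.mem_singleton, forall_eq] at hrk' ⊢
          -- The provider moves from `a` to the continuation `d`, which has higher rank because the
          -- message uses `a` and provides `d`.
          exact fun x hx => (hrk x hx).trans hrk'
  | sendU a A P =>
    obtain ⟨Δ, C, rfl, hP⟩ := h.of_eph_none he rfl
    simp only [Inst.chan, Inst.proc] at *
    have hne := hP.ne
    obtain ⟨ht, hprov, huse, hrk, hnd⟩ := hP
    have hn' := hn trivial
    cases ht with
    | muR ht =>
      have := h.func _ _ _ hprov (hp _ rfl)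
      cases this
      obtain ⟨q, hq, hΔ⟩ := exists_between_ctx rk (rk a) Δ hrk
      have hc := hn' _ hprov
      refine ⟨{⟨.msg a (.unfold n), {(n, A.unfold)}, a, .mu A⟩,
          ⟨.proc n (P.rename a n), Δ, n, A.unfold⟩},
        {(n, A.unfold)}, by simp [Inst.out, typs], ?_, .add q rfl trivial ?_ ?_ ?_⟩
      · simp only [Multiset.insert_eq_cons, Multiset.mem_cons, Multiset.mem_singleton,
          forall_eq_or_imp, forall_eq]
        exact ⟨.unfold, .proc (ht.rename_provider hne)⟩
      · simp only [provs, Multiset.insert_eq_cons, Multiset.map_cons, Multiset.map_singleton]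
        exact Multiset.pair_comm _ _
      · simp [uses]
      · simp only [Multiset.insert_eq_cons, Multiset.mem_cons, Multiset.mem_singleton,
          forall_eq_or_imp, forall_eq, Function.update_self, update_rank hc]
        refine ⟨hq, fun x hx => ?_⟩
        rw [update_rank (hn' _ (huse x hx))]; exact hΔ x hx
  | recvU a d c P =>
    obtain ⟨Δ, C, Δ', c', C', rfl, hP, hm⟩ := h.of_eph_some he rfl
    simp only [Inst.chan, Inst.proc] at *
    obtain ⟨ht, hprov, huse, hrk, hnd⟩ := id hP
    have hrk' := h.rank ⟨.msg a (.unfold d), Δ', c', C'⟩ (by simp)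
    have ha := h.tprov (c', C') (by simp [provs])
    cases ht with
    | @muL _ Δ _ _ A _ _ ht =>
      have hne := hP.cons_ne
      have h1 := huse _ (Multiset.mem_cons_self _ _)
      have h2 := hrk _ (Multiset.mem_cons_self _ _)
      cases hm
      have := h.func _ _ _ ha h1
      cases this
      refine ⟨{⟨.proc c (P.rename a d), (d, A.unfold) ::ₘ Δ, c, C⟩}, 0,
        by simp [Inst.out, typs], by simpa using .proc (ht.rename_client hne.1 hne.2),
        .remove (A := .mu A) rfl ?_ ?_ ?_⟩
      · simp only [provs, Multiset.insert_eq_cons, Multiset.map_cons, Multiset.map_singleton]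
        exact Multiset.pair_comm _ _
      · simp [uses]
        rw [add_comm, Multiset.singleton_add]
      · simp only [Multiset.mem_cons, Multiset.mem_singleton,
          forall_eq_or_imp, forall_eq] at hrk' ⊢
        exact ⟨hrk'.trans h2, fun x hx => hrk x (by simp [hx])⟩
  | fix c P =>
    obtain ⟨Δ, C, rfl, hP⟩ := h.of_eph_none he rfl
    simp only [Inst.chan, Inst.proc] at *
    obtain ⟨ht, hprov, huse, hrk, hnd⟩ := hP
    cases ht with
    | fix ht =>
      exact ⟨{⟨.proc c P.unfold, Δ, c, C⟩}, 0, by simp [Inst.out, typs],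
        by simpa using .proc ht.unfold,
        .keep rfl (by simp [provs]) (by simp [uses]) (by simpa using hrk)⟩

/-! ### Uniqueness of providers, clients, messages and receivers. -/

theorem WT.eq_of_prov {G : Multiset Cell} {Θ : LCtx} {rk : Chan → ℚ} (h : WT G Θ rk)
    {g g' : Cell} (hg : g ∈ G) (hg' : g' ∈ G) (he : g.chan = g'.chan) : g = g' := by
  have := h.prov
  rw [provs, Multiset.map_map] at this
  exact Multiset.inj_on_of_nodup_map this g hg g' hg' he

theorem WT.eq_of_use {G : Multiset Cell} {Θ : LCtx} {rk : Chan → ℚ} (h : WT G Θ rk)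
    {g g' : Cell} (hg : g ∈ G) (hg' : g' ∈ G) {a : Chan} {A B : Ty} (ha : (a, A) ∈ g.ctx)
    (ha' : (a, B) ∈ g'.ctx) : g = g' := by
  by_contra hne
  obtain ⟨G₁, rfl⟩ := Multiset.exists_cons_of_mem hg
  obtain ⟨G₂, rfl⟩ := Multiset.exists_cons_of_mem
    ((Multiset.mem_cons.1 hg').resolve_left fun e => hne e.symm)
  have := h.use
  simp only [uses, Multiset.cons_bind, Multiset.map_add] at this
  rw [Multiset.nodup_add] at this
  exact Multiset.disjoint_left.1 this.2.2 (Multiset.mem_map.2 ⟨_, ha, rfl⟩)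
    (Multiset.mem_add.2 (Or.inl (Multiset.mem_map.2 ⟨_, ha', rfl⟩)))

/-- `MTyped Θ m A`: a message `m` on a channel of type `A` respects the types in `Θ`. -/
inductive MTyped (Θ : Set (Chan × Ty)) : Msg → Ty → Prop
  | close : MTyped Θ .close .one
  | chan {e d : Chan} {B A : Ty} : (e, B) ∈ Θ → (d, A) ∈ Θ → MTyped Θ (.chan e d) (.tensor B A)
  | plus {d : Chan} {l : Label} {L : Finset Label} {A : {l // l ∈ L} → Ty}
      (k : {l // l ∈ L}) : k.1 = l → (d, A k) ∈ Θ → MTyped Θ (.label l d) (.plus L A)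
  | amp {d : Chan} {l : Label} {L : Finset Label} {A : {l // l ∈ L} → Ty}
      (k : {l // l ∈ L}) : k.1 = l → (d, A k) ∈ Θ → MTyped Θ (.label l d) (.amp L A)
  | unfold {d : Chan} {A : STy 1} : (d, A.unfold) ∈ Θ → MTyped Θ (.unfold d) (.mu A)

theorem MTyped.mono {Θ Θ' : Set (Chan × Ty)} (hΘ : Θ ⊆ Θ') {m : Msg} {A : Ty}
    (h : MTyped Θ m A) : MTyped Θ' m A := by
  cases h with
  | close => exact .close
  | chan h₁ h₂ => exact .chan (hΘ h₁) (hΘ h₂)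
  | plus k hk h => exact .plus k hk (hΘ h)
  | amp k hk h => exact .amp k hk (hΘ h)
  | unfold h => exact .unfold (hΘ h)

/-- A message on `a` is either provided on `a`, of positive type, or uses `a`, of negative type. -/
theorem WT.msg_cases {G : Multiset Cell} {Θ : LCtx} {rk : Chan → ℚ} (h : WT G Θ rk) {g : Cell}
    (hg : g ∈ G) {a : Chan} {m : Msg} (hj : g.judg = .msg a m) :
    ∃ A, MTyped {x | x ∈ Θ} m A ∧
      ((Positive A ∧ g.chan = a ∧ (a, A) ∈ provs G) ∨ (¬ Positive A ∧ (a, A) ∈ g.ctx)) := by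
  have ok := h.ok g hg
  have hp := mem_provs hg
  have hc := h.tprov _ hp
  have hu : ∀ x ∈ g.ctx, x ∈ Θ := fun x hx => h.tuse _ (mem_uses hg hx)
  obtain ⟨j, Δ, c, C⟩ := g
  dsimp only at hj ok hp hc hu ⊢
  subst hj
  cases ok with
  | close => exact ⟨_, .close, Or.inl ⟨.one, rfl, hp⟩⟩
  | chan =>
    exact ⟨_, .chan (hu _ (by simp)) (hu _ (by simp)), Or.inl ⟨.tensor _ _, rfl, hp⟩⟩
  | plus k hk => exact ⟨_, .plus k hk (hu _ (by simp)), Or.inl ⟨.plus _ _, rfl, hp⟩⟩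
  | amp k hk => exact ⟨_, .amp k hk hc, Or.inr ⟨nofun, Multiset.mem_singleton_self _⟩⟩
  | unfold => exact ⟨_, .unfold (hu _ (by simp)), Or.inl ⟨.mu _, rfl, hp⟩⟩

theorem WT.msg_mem {G : Multiset Cell} {Θ : LCtx} {rk : Chan → ℚ} (h : WT G Θ rk) {a : Chan}
    {m : Msg} (hm : .msg a m ∈ G.map Cell.judg) :
    ∃ A, (a, A) ∈ Θ ∧ MTyped {x | x ∈ Θ} m A ∧ ((a, A) ∈ provs G ∨ (a, A) ∈ uses G) := by
  obtain ⟨g, hg, hj⟩ := Multiset.mem_map.1 hm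
  obtain ⟨A, hA, ⟨-, -, ha⟩ | ⟨-, ha⟩⟩ := h.msg_cases hg hj
  · exact ⟨A, h.tprov _ ha, hA, Or.inl ha⟩
  · exact ⟨A, h.tuse _ (mem_uses hg ha), hA, Or.inr (mem_uses hg ha)⟩

/-- The channel has one type, so its polarity is common to both messages: they are both providers of
the channel or both clients of it, and each role is held only once. -/
theorem WT.msg_cell_unique {G : Multiset Cell} {Θ : LCtx} {rk : Chan → ℚ} (h : WT G Θ rk)
    {g g' : Cell} (hg : g ∈ G) (hg' : g' ∈ G) {a : Chan} {m m' : Msg} (hj : g.judg = .msg a m)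
    (hj' : g'.judg = .msg a m') : g = g' := by
  obtain ⟨A, -, hA⟩ := h.msg_cases hg hj
  obtain ⟨B, -, hB⟩ := h.msg_cases hg' hj'
  rcases hA with ⟨hA, hc, ha⟩ | ⟨hA, ha⟩ <;> rcases hB with ⟨hB, hc', hb⟩ | ⟨hB, hb⟩
  · exact h.eq_of_prov hg hg' (hc.trans hc'.symm)
  · cases h.func _ _ _ (h.tprov _ ha) (h.tuse _ (mem_uses hg' hb))
    exact absurd hA hB
  · cases h.func _ _ _ (h.tprov _ hb) (h.tuse _ (mem_uses hg ha))
    exact absurd hB hA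
  · exact h.eq_of_use hg hg' ha hb

theorem WT.msg_unique {G : Multiset Cell} {Θ : LCtx} {rk : Chan → ℚ} (h : WT G Θ rk)
    {a : Chan} {m m' : Msg} (hm : .msg a m ∈ G.map Cell.judg)
    (hm' : .msg a m' ∈ G.map Cell.judg) : m = m' := by
  obtain ⟨g, hg, hj⟩ := Multiset.mem_map.1 hm
  obtain ⟨g', hg', hj'⟩ := Multiset.mem_map.1 hm'
  cases h.msg_cell_unique hg hg' hj hj'
  rw [hj] at hj'
  cases hj'
  rfl

/-- The process that consumes a message is its client if the type is positive, and its provider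
otherwise. -/
theorem WT.receiver {G : Multiset Cell} {Θ : LCtx} {rk : Chan → ℚ} (h : WT G Θ rk) {g : Cell}
    (hg : g ∈ G) {r : Inst} (hj : g.judg = .proc r.chan r.proc) {a : Chan} {m : Msg}
    (hr : r.inp = some (a, m)) :
    (∃ A, Positive A ∧ (a, A) ∈ g.ctx) ∨ (g.chan = a ∧ ¬ Positive g.ty) := by
  obtain ⟨hc, hP⟩ := h.procWT hg hj
  have hne := hP.ne
  have ht := hP.typed
  generalize g.ctx = Δ at ht hne ⊢
  generalize g.ty = C at ht ⊢
  rw [hc]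
  cases r with
  | cut | close | sendC | plusSend | ampSend | sendU | fix => cases hr
  | fwd => cases hr; dsimp only [Inst.chan, Inst.proc] at *; cases ht with | fwd hpos => exact Or.inl ⟨_, hpos, Multiset.mem_singleton_self _⟩
  | wait => cases hr; dsimp only [Inst.chan, Inst.proc] at *; cases ht with | oneL _ => exact Or.inl ⟨_, .one, Multiset.mem_cons_self _ _⟩
  | recvC => cases hr; dsimp only [Inst.chan, Inst.proc] at *; cases ht with | tensorL _ => exact Or.inl ⟨_, .tensor _ _, Multiset.mem_cons_self _ _⟩
  | plusRecv =>
    cases hr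
    dsimp only [Inst.chan, Inst.proc] at *
    cases ht with
    | plusL _ => exact Or.inl ⟨_, .plus _ _, Multiset.mem_cons_self _ _⟩
    | ampR => exact absurd rfl ‹_›
  | ampRecv =>
    cases hr
    dsimp only [Inst.chan, Inst.proc] at *
    cases ht with
    | plusL _ => exact absurd rfl (hne _ (Multiset.mem_cons_self _ _))
    | ampR => exact Or.inr ⟨rfl, nofun⟩
  | recvU => cases hr; dsimp only [Inst.chan, Inst.proc] at *; cases ht with | muL _ => exact Or.inl ⟨_, .mu _, Multiset.mem_cons_self _ _⟩

/-- The polarity of the type of `a` decides whether its client or its provider receives; the two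
roles cannot be mixed, and each is held by one process. -/
theorem WT.receiver_unique {G : Multiset Cell} {Θ : LCtx} {rk : Chan → ℚ} (h : WT G Θ rk)
    {g g' : Cell} (hg : g ∈ G) (hg' : g' ∈ G) {r s : Inst} (hj : g.judg = .proc r.chan r.proc)
    (hj' : g'.judg = .proc s.chan s.proc) {a : Chan} {m m' : Msg}
    (hr : r.inp = some (a, m)) (hs : s.inp = some (a, m')) : g = g' := by
  rcases h.receiver hg hj hr with ⟨A, hA, ha⟩ | ⟨ha, hA⟩ <;>
    rcases h.receiver hg' hj' hs with ⟨B, hB, hb⟩ | ⟨hb, hB⟩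
  · exact h.eq_of_use hg hg' ha hb
  · have := h.func _ _ _ (h.tuse _ (mem_uses hg ha)) (hb ▸ h.tprov _ (mem_provs hg'))
    exact absurd (this ▸ hA) hB
  · have := h.func _ _ _ (h.tuse _ (mem_uses hg' hb)) (ha ▸ h.tprov _ (mem_provs hg))
    exact absurd (this ▸ hB) hA
  · exact h.eq_of_prov hg hg' (ha.trans hb.symm)

/-- The process determines the rule up to the consumed message and the type that is read. Only
`sendL` and `branch` serve two rules each: the type that is read separates the first pair, and
whether the provided channel is the one communicated on separates the second. -/
theorem Inst.eq_of_proc_eq {r s : Inst} (hc : r.chan = s.chan) (hP : r.proc = s.proc)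
    (hi : ∀ a m m', r.inp = some (a, m) → s.inp = some (a, m') → m = m')
    (hp : ∀ a A B, r.per = some (a, A) → s.per = some (a, B) → A = B) : r = s := by
  cases r <;> cases s <;> simp only [Inst.chan, Inst.proc, reduceCtorEq, Proc.fwd.injEq,
    Proc.cut.injEq, Proc.close.injEq, Proc.wait.injEq, Proc.sendC.injEq, Proc.recvC.injEq,
    Proc.sendL.injEq, Proc.branch.injEq, Proc.sendU.injEq, Proc.recvU.injEq, Proc.fix.injEq]
    at hc hP
  case fwd.fwd =>
    obtain ⟨rfl, rfl⟩ := hP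
    rw [hi _ _ _ rfl rfl]
  case cut.cut =>
    obtain ⟨rfl, rfl, rfl⟩ := hP
    rw [hc]
  case close.close => rw [hP]
  case wait.wait =>
    obtain ⟨rfl, rfl⟩ := hP
    rw [hc]
  case sendC.sendC =>
    obtain ⟨rfl, rfl, rfl⟩ := hP
    cases hp _ _ _ rfl rfl
    rfl
  case recvC.recvC =>
    obtain ⟨rfl, rfl⟩ := hP
    cases hi _ _ _ rfl rfl
    rw [hc]
  case plusSend.plusSend =>
    obtain ⟨rfl, hk, rfl⟩ := hP
    cases hp _ _ _ rfl rfl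
    cases Subtype.ext hk
    rfl
  case plusSend.ampSend =>
    obtain ⟨rfl, hk, rfl⟩ := hP
    cases hp _ _ _ rfl rfl
  case plusRecv.plusRecv =>
    obtain ⟨rfl, rfl, hP⟩ := hP
    cases hP
    subst hc
    have := hi _ _ _ rfl rfl
    simp only [Msg.label.injEq] at this
    cases Subtype.ext this.1
    cases this.2
    rfl
  case plusRecv.ampRecv =>
    obtain ⟨rfl, -, -⟩ := hP
    contradiction
  case ampSend.plusSend =>
    obtain ⟨rfl, hk, rfl⟩ := hP
    cases hp _ _ _ rfl rfl
  case ampSend.ampSend =>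
    obtain ⟨rfl, hk, rfl⟩ := hP
    cases hp _ _ _ rfl rfl
    cases Subtype.ext hk
    rw [hc]
  case ampRecv.plusRecv =>
    obtain ⟨rfl, -, -⟩ := hP
    exact absurd hc.symm ‹_›
  case ampRecv.ampRecv =>
    obtain ⟨rfl, rfl, hP⟩ := hP
    cases hP
    have := hi _ _ _ rfl rfl
    simp only [Msg.label.injEq] at this
    cases Subtype.ext this.1
    cases this.2
    rfl
  case sendU.sendU =>
    obtain ⟨rfl, rfl⟩ := hP
    cases hp _ _ _ rfl rfl
    rfl
  case recvU.recvU =>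
    obtain ⟨rfl, rfl⟩ := hP
    cases hi _ _ _ rfl rfl
    rw [hc]
  case fix.fix => rw [hc, hP]

/-! ### States -/

/-- A configuration together with the messages seen so far. -/
@[ext]
structure State where
  cfg : Config
  seen : Set (Chan × Msg)

/-- A rewriting step with the rule instantiation `r`, where `n` is the fresh name. -/
def StepBy (r : Inst) (n : Chan) (X Y : State) : Prop :=
  ∃ V, X.cfg = r.eph + V ∧ (∀ x, r.per = some x → .typ x.1 x.2 ∈ V) ∧ Y.cfg = r.out n + V ∧
    (r.bindsFresh → ∀ A, .typ n A ∉ X.cfg) ∧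
    Y.seen = X.seen ∪ {x | .msg x.1 x.2 ∈ r.out n}

/-- The invariant of the messages seen so far. -/
structure SeenOk (H : Set (Chan × Msg)) (G : Multiset Cell) (Θ : LCtx) : Prop where
  func : ∀ a m m', (a, m) ∈ H → (a, m') ∈ H → m = m'
  typed : ∀ a m, (a, m) ∈ H → ∃ A, (a, A) ∈ Θ ∧ MTyped {x | x ∈ Θ} m A
  live : ∀ a m, (a, m) ∈ H → .msg a m ∈ G.map Cell.judg ∨
    ∀ A, (a, A) ∉ provs G ∧ (a, A) ∉ uses G
  all : ∀ a m, .msg a m ∈ G.map Cell.judg → (a, m) ∈ H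

/-- Well-typed states. -/
def Good (X : State) : Prop :=
  ∃ G Θ rk, X.cfg = G.map Cell.judg + typs Θ ∧ WT G Θ rk ∧ SeenOk X.seen G Θ

theorem mem_typs {Θ : LCtx} {a : Chan} {A : Ty} : .typ a A ∈ typs Θ ↔ (a, A) ∈ Θ := by
  simp [typs]

theorem typ_notMem_judg {G : Multiset Cell} {Θ : LCtx} {rk : Chan → ℚ} (h : WT G Θ rk) {a : Chan}
    {A : Ty} : .typ a A ∉ G.map Cell.judg := by
  intro hm
  obtain ⟨g, hg, hj⟩ := Multiset.mem_map.1 hm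
  have := h.ok g hg
  rw [hj] at this
  cases this

theorem Inst.mem_eph {r : Inst} {j : Judg} :
    j ∈ r.eph ↔ j = .proc r.chan r.proc ∨ ∃ a m, r.inp = some (a, m) ∧ j = .msg a m := by
  unfold Inst.eph
  rcases hr : r.inp with - | ⟨a, m⟩
  · simp [msgs]
  · simp [msgs]

/-- A frame argument: the untouched cells `G₀` see only the interface of the rewritten part. A
common channel that disappears from it leaves both lists, and one that appears is untyped so far and
so collides with nothing in `G₀`. -/
theorem WT.change {G₁ G₀ G' : Multiset Cell} {Θ Θ' : LCtx} {rk : Chan → ℚ} {r : Inst} {n : Chan}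
    (h : WT (G₁ + G₀) Θ rk) (hok : ∀ g ∈ G', JTyped g.judg g.ctx g.chan g.ty)
    (hc : Change r n rk G₁ G' Θ') (hn : r.bindsFresh → ∀ x ∈ Θ, x.1 ≠ n) :
    ∃ rk', WT (G' + G₀) (Θ' + Θ) rk' := by
  have hok' : ∀ g ∈ G' + G₀, JTyped g.judg g.ctx g.chan g.ty := by
    intro g hg
    rcases Multiset.mem_add.1 hg with hg | hg
    · exact hok g hg
    · exact h.ok g (Multiset.mem_add.2 (Or.inr hg))
  have hrk₀ : ∀ g ∈ G₀, ∀ x ∈ g.ctx, rk x.1 < rk g.chan := fun g hg =>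
    h.rank g (Multiset.mem_add.2 (Or.inr hg))
  have hp := h.prov
  have hu := h.use
  have tp := h.tprov
  have tu := h.tuse
  rw [provs_add] at hp tp
  rw [uses_add] at hu tu
  cases hc with
  | keep _ h₁ h₂ hrk =>
    refine ⟨rk, hok', ?_, ?_, ?_, ?_, ?_, ?_⟩
    · rwa [provs_add, h₁]
    · rwa [uses_add, h₂]
    · rwa [provs_add, h₁, zero_add]
    · rwa [uses_add, h₂, zero_add]
    · rw [zero_add]; exact h.func
    · intro g hg
      rcases Multiset.mem_add.1 hg with hg | hg
      · exact hrk g hg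
      · exact hrk₀ g hg
  | @add A q _ hr h₁ h₂ hrk =>
    have hn := hn hr
    refine ⟨Function.update rk n q, hok', ?_, ?_, ?_, ?_, ?_, ?_⟩
    · rw [provs_add, h₁, Multiset.cons_add, Multiset.map_cons, Multiset.nodup_cons]
      refine ⟨fun hm => ?_, hp⟩
      obtain ⟨x, hx, he⟩ := Multiset.mem_map.1 hm
      exact hn _ (tp x hx) he
    · rw [uses_add, h₂, Multiset.cons_add, Multiset.map_cons, Multiset.nodup_cons]
      refine ⟨fun hm => ?_, hu⟩
      obtain ⟨x, hx, he⟩ := Multiset.mem_map.1 hm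
      exact hn _ (tu x hx) he
    · rw [provs_add, h₁, Multiset.cons_add, Multiset.singleton_add]
      intro x hx
      rcases Multiset.mem_cons.1 hx with rfl | hx
      · exact Multiset.mem_cons_self _ _
      · exact Multiset.mem_cons_of_mem (tp x hx)
    · rw [uses_add, h₂, Multiset.cons_add, Multiset.singleton_add]
      intro x hx
      rcases Multiset.mem_cons.1 hx with rfl | hx
      · exact Multiset.mem_cons_self _ _
      · exact Multiset.mem_cons_of_mem (tu x hx)
    · rw [Multiset.singleton_add]
      intro x B B' hB hB'
      rcases Multiset.mem_cons.1 hB with hB | hB <;> rcases Multiset.mem_cons.1 hB' with hB' | hB'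
      · cases hB; cases hB'; rfl
      · cases hB; exact absurd rfl (hn _ hB')
      · cases hB'; exact absurd rfl (hn _ hB)
      · exact h.func _ _ _ hB hB'
    · intro g hg
      rcases Multiset.mem_add.1 hg with hg | hg
      · exact hrk g hg
      · intro x hx
        have hg' : g ∈ G₁ + G₀ := Multiset.mem_add.2 (Or.inr hg)
        rw [update_rank (hn _ (h.tuse x (mem_uses hg' hx))),
          update_rank (hn _ (h.tprov _ (mem_provs hg')))]
        exact hrk₀ g hg x hx
  | remove _ h₁ h₂ hrk =>
    rw [h₁, Multiset.cons_add] at hp tp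
    rw [h₂, Multiset.cons_add] at hu tu
    rw [Multiset.map_cons] at hp hu
    refine ⟨rk, hok', ?_, ?_, ?_, ?_, ?_, ?_⟩
    · rw [provs_add]; exact (Multiset.nodup_cons.1 hp).2
    · rw [uses_add]; exact (Multiset.nodup_cons.1 hu).2
    · rw [provs_add, zero_add]; exact fun x hx => tp x (Multiset.mem_cons_of_mem hx)
    · rw [uses_add, zero_add]; exact fun x hx => tu x (Multiset.mem_cons_of_mem hx)
    · rw [zero_add]; exact h.func
    · intro g hg
      rcases Multiset.mem_add.1 hg with hg | hg
      · exact hrk g hg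
      · exact hrk₀ g hg

/-- The point of `live` is that a consumed message leaves its channel dead, neither provided nor
used. A typed message needs one of the two, so no second message can appear there. -/
theorem SeenOk.change {H : Set (Chan × Msg)} {G₁ G₀ G' : Multiset Cell} {Θ Θ' : LCtx}
    {rk rk' : Chan → ℚ} {r : Inst} {n : Chan} (hH : SeenOk H (G₁ + G₀) Θ)
    (h : WT (G₁ + G₀) Θ rk) (he : G₁.map Cell.judg = r.eph)
    (hc : Change r n rk G₁ G' Θ') (hn : r.bindsFresh → ∀ x ∈ Θ, x.1 ≠ n)
    (h' : WT (G' + G₀) (Θ' + Θ) rk') :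
    SeenOk (H ∪ {x | .msg x.1 x.2 ∈ G'.map Cell.judg}) (G' + G₀) (Θ' + Θ) := by
  have live : ∀ a m, (a, m) ∈ H → .msg a m ∈ (G' + G₀).map Cell.judg ∨
      ∀ A, (a, A) ∉ provs (G' + G₀) ∧ (a, A) ∉ uses (G' + G₀) := by
    intro a m ham
    rcases hH.live a m ham with hl | hd
    · rw [Multiset.map_add] at hl ⊢
      rcases Multiset.mem_add.1 hl with hl | hl
      · right
        rw [he, Inst.mem_eph] at hl
        rcases hl with hl | ⟨a', m', hr, hl⟩
        · cases hl
        cases hl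
        -- Only `remove` has an input, and it deletes the channel from both interfaces; as no
        -- channel is listed twice in either, none of its occurrences remain.
        cases hc with
        | keep hr' => rw [hr] at hr'; cases hr'
        | add _ hr' => rw [hr] at hr'; cases hr'
        | remove hr' h₁ h₂ =>
          rw [hr] at hr'
          cases hr'
          have hp := h.prov
          have hu := h.use
          rw [provs_add, h₁, Multiset.cons_add, Multiset.map_cons, Multiset.nodup_cons,
            ← provs_add] at hp
          rw [uses_add, h₂, Multiset.cons_add, Multiset.map_cons, Multiset.nodup_cons,
            ← uses_add] at hu
          exact fun A => ⟨fun hA => hp.1 (Multiset.mem_map.2 ⟨_, hA, rfl⟩),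
            fun hA => hu.1 (Multiset.mem_map.2 ⟨_, hA, rfl⟩)⟩
      · exact Or.inl (Multiset.mem_add.2 (Or.inr hl))
    -- A dead channel stays dead: the only channel ever added is untyped before the step, whereas
    -- the channel of a seen message is typed.
    · right
      rw [provs_add, uses_add] at hd ⊢
      cases hc with
      | keep _ h₁ h₂ => rwa [h₁, h₂]
      | add _ _ hr h₁ h₂ =>
        obtain ⟨B, hB, -⟩ := hH.typed a m ham
        have han := hn hr _ hB
        intro A
        rw [h₁, h₂, Multiset.cons_add, Multiset.cons_add, Multiset.mem_cons, Multiset.mem_cons]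
        refine ⟨?_, ?_⟩ <;> rintro (hA | hA)
        · cases hA; exact han rfl
        · exact (hd A).1 hA
        · cases hA; exact han rfl
        · exact (hd A).2 hA
      | remove _ h₁ h₂ =>
        intro A
        have := hd A
        rw [h₁, h₂, Multiset.cons_add, Multiset.cons_add] at this
        exact ⟨fun hA => this.1 (Multiset.mem_cons_of_mem hA),
          fun hA => this.2 (Multiset.mem_cons_of_mem hA)⟩
  have new : ∀ a m, .msg a m ∈ G'.map Cell.judg → .msg a m ∈ (G' + G₀).map Cell.judg := by
    intro a m hm
    rw [Multiset.map_add]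
    exact Multiset.mem_add.2 (Or.inl hm)
  have old_new : ∀ a m m', (a, m) ∈ H → .msg a m' ∈ G'.map Cell.judg → m = m' := by
    intro a m m' hm hm'
    rcases live a m hm with hl | hd
    · exact h'.msg_unique hl (new _ _ hm')
    · obtain ⟨A, -, -, hA⟩ := h'.msg_mem (new _ _ hm')
      exact absurd hA (not_or.2 (hd A))
  refine ⟨?_, ?_, ?_, ?_⟩
  · rintro a m m' (hm | hm) (hm' | hm')
    · exact hH.func a m m' hm hm'
    · exact old_new a m m' hm hm'
    · exact (old_new a m' m hm' hm).symm
    · exact h'.msg_unique (new _ _ hm) (new _ _ hm')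
  · rintro a m (hm | hm)
    · obtain ⟨A, hA, ht⟩ := hH.typed a m hm
      exact ⟨A, Multiset.mem_add.2 (Or.inr hA),
        ht.mono fun x hx => Multiset.mem_add.2 (Or.inr hx)⟩
    · obtain ⟨A, hA, ht, -⟩ := h'.msg_mem (new _ _ hm)
      exact ⟨A, hA, ht⟩
  · rintro a m (hm | hm)
    · exact live a m hm
    · exact Or.inl (new _ _ hm)
  · intro a m hm
    rw [Multiset.map_add] at hm
    rcases Multiset.mem_add.1 hm with hm | hm
    · exact Or.inr hm
    · exact Or.inl (hH.all a m (by rw [Multiset.map_add]; exact Multiset.mem_add.2 (Or.inr hm)))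

theorem le_of_le_add_of_disjoint {α : Type*} {s t u : Multiset α} (h : s ≤ t + u)
    (hd : ∀ x ∈ s, x ∉ u) : s ≤ t := by
  classical
  rw [Multiset.le_iff_count] at h ⊢
  intro a
  by_cases ha : a ∈ s
  · simpa [Multiset.count_eq_zero_of_notMem (hd a ha)] using h a
  · simp [Multiset.count_eq_zero_of_notMem ha]

/-- Lifts a splitting of judgments to one of the cells that carry them. -/
theorem exists_add_of_map_eq_add {α β : Type*} {f : α → β} {u v : Multiset β} :
    ∀ {s : Multiset α}, s.map f = u + v → ∃ s₁ s₂, s = s₁ + s₂ ∧ s₁.map f = u ∧ s₂.map f = v := by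
  classical
  induction u using Multiset.induction with
  | empty => exact fun {s} h => ⟨0, s, (zero_add _).symm, rfl, by simpa using h⟩
  | cons b u ih =>
    intro s h
    rw [Multiset.cons_add] at h
    obtain ⟨a, ha, hb, hs⟩ := (Multiset.map_eq_cons ..).2 h
    obtain ⟨s₁, s₂, h₁, rfl, rfl⟩ := ih hs
    exact ⟨a ::ₘ s₁, s₂, by rw [Multiset.cons_add, ← h₁, Multiset.cons_erase ha], by simp [hb], rfl⟩

/-- The judgments consumed by an applicable rule, as part of a typed configuration. -/
theorem WT.split {G : Multiset Cell} {Θ : LCtx} {r : Inst} {V : Config}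
    (h : G.map Cell.judg + typs Θ = r.eph + V) :
    ∃ G₁ G₀, G = G₁ + G₀ ∧ G₁.map Cell.judg = r.eph ∧ V = G₀.map Cell.judg + typs Θ := by
  have hle : r.eph ≤ G.map Cell.judg := by
    refine le_of_le_add_of_disjoint (u := typs Θ) (h ▸ Multiset.le_add_right _ _) fun j hj => ?_
    rw [Inst.mem_eph] at hj
    rcases hj with rfl | ⟨a, m, -, rfl⟩ <;> simp [typs]
  obtain ⟨E, hE⟩ := Multiset.le_iff_exists_add.1 hle
  obtain ⟨G₁, G₀, rfl, h₁, h₂⟩ := exists_add_of_map_eq_add hE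
  refine ⟨G₁, G₀, rfl, h₁, ?_⟩
  rw [Multiset.map_add, h₁, add_assoc] at h
  exact (add_left_cancel h).symm

/-- Subject reduction. -/
theorem Good.step {X Y : State} {r : Inst} {n : Chan} (hX : Good X) (h : StepBy r n X Y) :
    Good Y := by
  obtain ⟨G, Θ, rk, hG, hwt, hseen⟩ := hX
  obtain ⟨V, hV, hper, hY, hfr, hYs⟩ := h
  obtain ⟨G₁, G₀, rfl, h₁, rfl⟩ := WT.split (hG ▸ hV)
  have hn : r.bindsFresh → ∀ x ∈ Θ, x.1 ≠ n := by
    rintro hr ⟨x, A⟩ hx rfl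
    refine hfr hr A ?_
    rw [hG]
    exact Multiset.mem_add.2 (Or.inr (mem_typs.2 hx))
  have hp : ∀ x, r.per = some x → x ∈ Θ := fun x hx =>
    mem_typs.1 ((Multiset.mem_add.1 (hper x hx)).resolve_left
      (typ_notMem_judg (hwt.mono (Multiset.le_add_left _ _))))
  -- Preservation is proved for the consumed cells alone, and the remaining cells are then framed
  -- back in.
  obtain ⟨G', Θ', hout, hok, hc⟩ :=
    Inst.local_preservation (hwt.mono (Multiset.le_add_right _ _)) h₁ hp hn
  obtain ⟨rk', hwt'⟩ := hwt.change hok hc hn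
  refine ⟨G' + G₀, Θ' + Θ, rk', ?_, hwt', ?_⟩
  · rw [hY, hout, Multiset.map_add, typs, typs, typs, Multiset.map_add, add_add_add_comm]
  · have := hseen.change hwt h₁ hc hn hwt'
    convert this using 1
    rw [hYs, hout]
    congr 1
    ext x
    simp [typs]

/-- `r` is applicable to `M`, in terms of the parts of `r`. -/
theorem Inst.applicable_iff {r : Inst} {M : Config} :
    r.Applicable M ↔ ∃ V, M = r.eph + V ∧ ∀ x, r.per = some x → .typ x.1 x.2 ∈ V := by
  unfold Inst.Applicable
  rw [Inst.lhs_eq]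
  rcases hr : r.per with - | x
  · simp [typs]
  · simp only [Option.elim_some, typs, Multiset.map_singleton, Option.some.injEq, forall_eq',
      add_assoc, Multiset.singleton_add]
    constructor
    · rintro ⟨V, h⟩
      exact ⟨_, h, Multiset.mem_cons_self _ _⟩
    · rintro ⟨V, h, hx⟩
      obtain ⟨V', rfl⟩ := Multiset.exists_cons_of_mem hx
      exact ⟨V', h⟩

/-- Applicable rules of a typed state do not compete for ephemeral judgments. -/
theorem Good.deterministic {X : State} (hX : Good X) {r s : Inst} (hr : r.Applicable X.cfg)
    (hs : s.Applicable X.cfg) {j : Judg} (hjr : j ∈ r.eph) (hjs : j ∈ s.eph) : r = s := by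
  obtain ⟨G, Θ, rk, hG, hwt, -⟩ := hX
  rw [Inst.applicable_iff] at hr hs
  obtain ⟨V, hV, hper⟩ := hr
  obtain ⟨W, hW, hper'⟩ := hs
  have mem : ∀ {r : Inst} {V}, X.cfg = r.eph + V → ∀ j ∈ r.eph, ∃ g ∈ G, g.judg = j := by
    intro r V hV j hj
    obtain ⟨G₁, G₀, rfl, h₁, -⟩ := WT.split (hG ▸ hV)
    rw [← h₁] at hj
    obtain ⟨g, hg, h⟩ := Multiset.mem_map.1 hj
    exact ⟨g, Multiset.mem_add.2 (Or.inl hg), h⟩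
  have memt : ∀ {r : Inst} {V}, X.cfg = r.eph + V → ∀ x : Chan × Ty, .typ x.1 x.2 ∈ V →
      x ∈ Θ := by
    intro r V hV x hx
    have : Judg.typ x.1 x.2 ∈ X.cfg := hV ▸ Multiset.mem_add.2 (Or.inr hx)
    rw [hG] at this
    exact mem_typs.1 ((Multiset.mem_add.1 this).resolve_left (typ_notMem_judg hwt))
  obtain ⟨g, hg, hj⟩ := mem hV _ (Inst.mem_eph.2 (Or.inl rfl))
  obtain ⟨g', hg', hj'⟩ := mem hW _ (Inst.mem_eph.2 (Or.inl rfl))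
  -- Both rules rewrite the same cell: a shared process is the unique provider of its channel, and a
  -- shared message has a unique receiver. The mixed cases compare a process with a message.
  have hgg : g = g' := by
    rw [Inst.mem_eph] at hjr hjs
    rcases hjr with rfl | ⟨a, m, hr, rfl⟩ <;> rcases hjs with h | ⟨a', m', hs, h⟩
    · refine hwt.eq_of_prov hg hg' ?_
      rw [(hwt.procWT hg hj).1, (hwt.procWT hg' hj').1]
      exact (Judg.proc.inj h).1
    · cases h
    · cases h
    · cases h
      exact hwt.receiver_unique hg hg' hj hj' hr hs
  subst hgg
  have := hj.symm.trans hj'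
  simp only [Judg.proc.injEq] at this
  refine Inst.eq_of_proc_eq this.1 this.2 ?_ ?_
  · intro a m m' hr hs
    obtain ⟨g₁, hg₁, hj₁⟩ := mem hV _ (Inst.mem_eph.2 (Or.inr ⟨a, m, hr, rfl⟩))
    obtain ⟨g₂, hg₂, hj₂⟩ := mem hW _ (Inst.mem_eph.2 (Or.inr ⟨a, m', hs, rfl⟩))
    exact hwt.msg_unique (Multiset.mem_map.2 ⟨_, hg₁, hj₁⟩) (Multiset.mem_map.2 ⟨_, hg₂, hj₂⟩)
  · intro a A B hr hs
    exact hwt.func _ _ _ (memt hV _ (hper _ hr)) (memt hW _ (hper' _ hs))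

/-! ### Permutations of channel names -/

/-- Renaming of the channels in a message. -/
def Msg.ren (f : Chan → Chan) : Msg → Msg
  | .close => .close
  | .chan e d => .chan (f e) (f d)
  | .label k d => .label k (f d)
  | .unfold d => .unfold (f d)

/-- Renaming of the channels in a judgment. -/
def Judg.ren (f : Chan → Chan) : Judg → Judg
  | .proc c P => .proc (f c) (P.ren f)
  | .msg a m => .msg (f a) (m.ren f)
  | .typ a A => .typ (f a) A

/-- Renaming of the channels in a rule instantiation. -/
def Inst.ren (σ : Equiv.Perm Chan) : Inst → Inst
  | .fwd a b m => .fwd (σ a) (σ b) (m.ren σ)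
  | .cut c A P Q => .cut (σ c) A (P.ren (liftRen σ)) (Q.ren (liftRen σ))
  | .close a => .close (σ a)
  | .wait a c P => .wait (σ a) (σ c) (P.ren σ)
  | .sendC a b P B A => .sendC (σ a) (σ b) (P.ren σ) B A
  | .recvC a e d c P => .recvC (σ a) (σ e) (σ d) (σ c) (P.ren (liftRen σ))
  | .plusSend a L A k P => .plusSend (σ a) L A k (P.ren σ)
  | .plusRecv a d c ne L k P =>
      .plusRecv (σ a) (σ d) (σ c) (σ.injective.ne ne) L k (fun l => (P l).ren σ)
  | .ampSend a c L A k P => .ampSend (σ a) (σ c) L A k (P.ren σ)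
  | .ampRecv a d L k P => .ampRecv (σ a) (σ d) L k (fun l => (P l).ren σ)
  | .sendU a A P => .sendU (σ a) A (P.ren σ)
  | .recvU a d c P => .recvU (σ a) (σ d) (σ c) (P.ren σ)
  | .fix c P => .fix (σ c) (P.ren σ)

theorem Msg.ren_ren (m : Msg) (f g : Chan → Chan) : (m.ren f).ren g = m.ren (g ∘ f) := by
  cases m <;> rfl

theorem Msg.ren_id (m : Msg) : m.ren id = m := by cases m <;> rfl

theorem Judg.ren_ren (j : Judg) (f g : Chan → Chan) : (j.ren f).ren g = j.ren (g ∘ f) := by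
  cases j <;> simp [Judg.ren, Proc.ren_ren, Msg.ren_ren]

theorem Judg.ren_id (j : Judg) : j.ren id = j := by
  cases j <;> simp [Judg.ren, Proc.ren_id, Msg.ren_id]

theorem Inst.ren_chan (r : Inst) (σ : Equiv.Perm Chan) : (r.ren σ).chan = σ r.chan := by
  cases r <;> rfl

theorem Inst.ren_proc (r : Inst) (σ : Equiv.Perm Chan) : (r.ren σ).proc = r.proc.ren σ := by
  cases r <;> rfl

theorem Inst.ren_inp (r : Inst) (σ : Equiv.Perm Chan) :
    (r.ren σ).inp = r.inp.map fun x => (σ x.1, x.2.ren σ) := by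
  cases r <;> rfl

theorem Inst.ren_per (r : Inst) (σ : Equiv.Perm Chan) :
    (r.ren σ).per = r.per.map fun x => (σ x.1, x.2) := by
  cases r <;> rfl

theorem Inst.ren_bindsFresh (r : Inst) (σ : Equiv.Perm Chan) :
    (r.ren σ).bindsFresh ↔ r.bindsFresh := by
  cases r <;> rfl

theorem Inst.ren_eph (r : Inst) (σ : Equiv.Perm Chan) :
    (r.ren σ).eph = r.eph.map (Judg.ren σ) := by
  unfold Inst.eph
  rw [Inst.ren_chan, Inst.ren_proc, Inst.ren_inp]
  rcases r.inp with - | x <;> simp [msgs, Judg.ren]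

theorem Proc.ren_recvRen (P : Proc) (σ : Equiv.Perm Chan) (a e d : Chan) :
    (P.ren (recvRen a e d)).ren σ = (P.ren (liftRen σ)).ren (recvRen (σ a) (σ e) (σ d)) := by
  rw [Proc.ren_ren, Proc.ren_ren]
  congr 1
  funext x
  rcases x with - | x
  · rfl
  · by_cases h : x = a <;> simp [recvRen, liftRen, h]

/-- The rules treat channel names uniformly, so rewriting is equivariant under permutations of
names. -/
theorem Inst.ren_out (r : Inst) (σ : Equiv.Perm Chan) (n : Chan) :
    (r.ren σ).out (σ n) = (r.out n).map (Judg.ren σ) := by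
  cases r <;> simp [Inst.ren, Inst.out, Judg.ren, Msg.ren, Proc.ren_inst, Proc.ren_recvRen,
    Proc.ren_rename _ σ.injective, Proc.ren_unfold]

/-- The action of a permutation of channels on states. -/
def State.act (σ : Equiv.Perm Chan) (X : State) : State :=
  ⟨X.cfg.map (Judg.ren σ), {x | (σ.symm x.1, x.2.ren σ.symm) ∈ X.seen}⟩

theorem State.act_act (σ τ : Equiv.Perm Chan) (X : State) :
    (X.act τ).act σ = X.act (σ * τ) := by
  ext1
  · simp only [State.act, Multiset.map_map]
    refine Multiset.map_congr rfl fun j _ => ?_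
    simp [Judg.ren_ren, Equiv.Perm.coe_mul]
  · ext x
    simp only [State.act, Set.mem_ofPred_eq, Msg.ren_ren]
    rfl

theorem State.act_one (X : State) : X.act 1 = X := by
  ext1
  · exact (Multiset.map_congr rfl fun j _ => j.ren_id).trans (Multiset.map_id _)
  · ext x
    simp only [State.act, Set.mem_ofPred_eq]
    exact iff_of_eq (congrArg (· ∈ X.seen) (Prod.ext rfl x.2.ren_id))

theorem Judg.ren_symm_ren (j : Judg) (σ : Equiv.Perm Chan) : (j.ren σ.symm).ren σ = j := by
  rw [Judg.ren_ren, Equiv.self_comp_symm, Judg.ren_id]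

theorem Judg.ren_ren_symm (j : Judg) (σ : Equiv.Perm Chan) : (j.ren σ).ren σ.symm = j := by
  rw [Judg.ren_ren, Equiv.symm_comp_self, Judg.ren_id]

theorem mem_map_ren {M : Config} {σ : Equiv.Perm Chan} {j : Judg} :
    j ∈ M.map (Judg.ren σ) ↔ j.ren σ.symm ∈ M := by
  rw [Multiset.mem_map]
  constructor
  · rintro ⟨i, hi, rfl⟩
    rwa [Judg.ren_ren_symm]
  · exact fun h => ⟨_, h, j.ren_symm_ren σ⟩

theorem StepBy.act {r : Inst} {n : Chan} {X Y : State} (h : StepBy r n X Y)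
    (σ : Equiv.Perm Chan) : StepBy (r.ren σ) (σ n) (X.act σ) (Y.act σ) := by
  obtain ⟨V, hX, hp, hY, hf, hs⟩ := h
  refine ⟨V.map (Judg.ren σ), ?_, ?_, ?_, ?_, ?_⟩
  · simp [State.act, hX, Inst.ren_eph]
  · intro x hx
    rw [Inst.ren_per, Option.map_eq_some_iff] at hx
    obtain ⟨y, hy, rfl⟩ := hx
    exact Multiset.mem_map_of_mem (Judg.ren σ) (hp y hy)
  · simp [State.act, hY, Inst.ren_out]
  · intro hr A hA
    rw [Inst.ren_bindsFresh] at hr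
    have := mem_map_ren.1 hA
    simp only [Judg.ren, Equiv.symm_apply_apply] at this
    exact hf hr A this
  · ext x
    simp only [State.act, hs, Set.mem_ofPred_eq, Set.mem_union, Inst.ren_out, mem_map_ren]
    rfl

/-- The channels that have a type. -/
def State.dom (X : State) : Set Chan := {x | ∃ A, .typ x A ∈ X.cfg}

/-- Guarantees a supply of fresh names. The values of `f` on judgments other than types are
irrelevant. -/
theorem State.dom_finite (X : State) : X.dom.Finite := by
  let f : Judg → Chan := fun j => match j with
    | .typ x _ => x
    | .proc x _ => x
    | .msg x _ => x
  refine (X.cfg.map f).finite_toSet.subset ?_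
  rintro x ⟨A, hA⟩
  exact Multiset.mem_map.2 ⟨_, hA, rfl⟩

/-- A permutation that fixes the typed channels of a state. -/
def Fixes (σ : Equiv.Perm Chan) (X : State) : Prop := ∀ x ∈ X.dom, σ x = x

theorem Fixes.symm {σ : Equiv.Perm Chan} {X : State} (h : Fixes σ X) : Fixes σ.symm X :=
  fun x hx => by rw [Equiv.symm_apply_eq, h x hx]

theorem Fixes.mul {σ τ : Equiv.Perm Chan} {X : State} (hσ : Fixes σ X) (hτ : Fixes τ X) :
    Fixes (σ * τ) X :=
  fun x hx => by rw [Equiv.Perm.mul_apply, hτ x hx, hσ x hx]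

theorem Fixes.mono {σ : Equiv.Perm Chan} {X Y : State} (h : Fixes σ Y) (hd : X.dom ⊆ Y.dom) :
    Fixes σ X := fun x hx => h x (hd hx)

theorem mem_cfg_typ {X : State} {G : Multiset Cell} {Θ : LCtx} {rk : Chan → ℚ}
    (hG : X.cfg = G.map Cell.judg + typs Θ) (h : WT G Θ rk) {a : Chan} {A : Ty} :
    .typ a A ∈ X.cfg ↔ (a, A) ∈ Θ := by
  rw [hG, Multiset.mem_add, mem_typs]
  exact or_iff_right (typ_notMem_judg h)

theorem MTyped.ren_eq_self {Θ : Set (Chan × Ty)} {m : Msg} {A : Ty} (h : MTyped Θ m A)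
    {f : Chan → Chan} (hf : ∀ x ∈ Θ, f x.1 = x.1) : m.ren f = m := by
  cases h with
  | close => rfl
  | chan h₁ h₂ => simp [Msg.ren, hf _ h₁, hf _ h₂]
  | plus k hk h => simp [Msg.ren, hf _ h]
  | amp k hk h => simp [Msg.ren, hf _ h]
  | unfold h => simp [Msg.ren, hf _ h]

/-- All names in a typed configuration are typed. -/
theorem Good.names_subset {X : State} (hX : Good X) : Config.names X.cfg ⊆ X.dom := by
  obtain ⟨G, Θ, rk, hG, hwt, -⟩ := hX
  have hd : ∀ x : Chan × Ty, x ∈ Θ → x.1 ∈ X.dom := fun x hx =>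
    ⟨x.2, (mem_cfg_typ hG hwt).2 hx⟩
  rintro x ⟨j, hj, hx⟩
  have hj' := hj
  rw [hG, Multiset.mem_add] at hj
  rcases hj with hj | hj
  · obtain ⟨g, hg, rfl⟩ := Multiset.mem_map.1 hj
    rcases hj : g.judg with ⟨c, P⟩ | ⟨a, m⟩ | ⟨a, A⟩
    · obtain ⟨hc, hP⟩ := hwt.procWT hg hj
      rw [hj] at hx
      have hc := hd _ hP.prov
      rcases hx with rfl | hx
      · exact hc
      · rcases hP.typed.fcn x hx with rfl | ⟨A, hA⟩
        · exact hc
        · exact hd _ (hP.use _ hA)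
    · obtain ⟨A, hA, ht, -⟩ := hwt.msg_mem (hj ▸ Multiset.mem_map_of_mem Cell.judg hg)
      rw [hj] at hx
      rcases hx with rfl | hx
      · exact hd _ hA
      · cases ht with
        | close => cases hx
        | chan h₁ h₂ =>
          rcases hx with rfl | rfl
          · exact hd _ h₁
          · exact hd _ h₂
        | plus k hk h => cases hx; exact hd _ h
        | amp k hk h => cases hx; exact hd _ h
        | unfold h => cases hx; exact hd _ h
    · rw [hj] at hj'
      rw [hj] at hx
      cases hx
      exact ⟨A, hj'⟩
  · obtain ⟨y, hy, rfl⟩ := Multiset.mem_map.1 hj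
    cases hx
    exact ⟨y.2, hj'⟩

theorem Judg.ren_eq_self {j : Judg} {f : Chan → Chan} (h : ∀ x ∈ j.names, f x = x) :
    j.ren f = j := by
  rcases j with ⟨c, P⟩ | ⟨a, m⟩ | ⟨a, A⟩
  · simp only [Judg.ren, Judg.proc.injEq]
    exact ⟨h c (Or.inl rfl), Proc.ren_eq_self fun x hx => h x (Or.inr hx)⟩
  · simp only [Judg.ren, Judg.msg.injEq]
    refine ⟨h a (Or.inl rfl), ?_⟩
    cases m with
    | close => rfl
    | chan e d =>
      simp [Msg.ren, h e (Or.inr (Or.inl rfl)), h d (Or.inr (Or.inr rfl))]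
    | label k d => simp [Msg.ren, h d (Or.inr rfl)]
    | unfold d => simp [Msg.ren, h d (Or.inr rfl)]
  · simp only [Judg.ren, h a rfl]

theorem Good.judg_ren_eq_self {X : State} (hX : Good X) {σ : Equiv.Perm Chan} (hσ : Fixes σ X)
    {j : Judg} (hj : j ∈ X.cfg) : j.ren σ = j :=
  Judg.ren_eq_self fun x hx => hσ x (hX.names_subset ⟨j, hj, hx⟩)

/-- Every name in the configuration is typed, and so is every name in the messages seen so far,
including those already consumed. -/
theorem Good.act_eq_self {X : State} (hX : Good X) {σ : Equiv.Perm Chan} (hσ : Fixes σ X) :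
    X.act σ = X := by
  have seen : ∀ τ : Equiv.Perm Chan, Fixes τ X → ∀ a m, (a, m) ∈ X.seen →
      τ a = a ∧ m.ren τ = m := by
    intro τ hτ a m ham
    obtain ⟨G, Θ, rk, hG, hwt, hs⟩ := hX
    have hd : ∀ x : Chan × Ty, x ∈ Θ → τ x.1 = x.1 := fun x hx =>
      hτ _ ⟨x.2, (mem_cfg_typ hG hwt).2 hx⟩
    obtain ⟨A, hA, ht⟩ := hs.typed a m ham
    exact ⟨hd _ hA, ht.ren_eq_self hd⟩
  ext1
  · exact (Multiset.map_congr rfl fun j hj => hX.judg_ren_eq_self hσ hj).trans (Multiset.map_id _)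
  · ext ⟨a, m⟩
    simp only [State.act, Set.mem_ofPred_eq]
    constructor
    · intro h
      obtain ⟨h₁, h₂⟩ := seen σ hσ _ _ h
      rw [Equiv.apply_symm_apply] at h₁
      rw [Msg.ren_ren, Equiv.self_comp_symm, Msg.ren_id] at h₂
      rwa [← h₁, ← h₂] at h
    · intro h
      obtain ⟨h₁, h₂⟩ := seen σ.symm hσ.symm _ _ h
      rwa [h₁, h₂]

/-! ### Confluence -/

/-- Finite sequences of rewriting steps. -/
def Path : State → State → Prop := Relation.ReflTransGen fun X Y => ∃ r n, StepBy r n X Y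

theorem StepBy.path {r : Inst} {n : Chan} {X Y : State} (h : StepBy r n X Y) : Path X Y :=
  Relation.ReflTransGen.single ⟨r, n, h⟩

theorem Path.act {X Y : State} (h : Path X Y) (σ : Equiv.Perm Chan) :
    Path (X.act σ) (Y.act σ) := by
  induction h with
  | refl => exact .refl
  | tail _ h ih =>
    obtain ⟨r, n, h⟩ := h
    exact ih.tail ⟨_, _, h.act σ⟩

theorem Good.path {X Y : State} (hX : Good X) (h : Path X Y) : Good Y := by
  induction h with
  | refl => exact hX
  | tail _ h ih =>
    obtain ⟨r, n, h⟩ := h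
    exact ih.step h

theorem Inst.typ_mem_out {r : Inst} {n a : Chan} {A : Ty} (h : .typ a A ∈ r.out n) :
    r.bindsFresh ∧ a = n := by
  cases r <;> simp_all [Inst.out, Inst.bindsFresh]

theorem Inst.out_eq_of_not_bindsFresh {r : Inst} (h : ¬ r.bindsFresh) (n m : Chan) :
    r.out n = r.out m := by
  cases r <;> simp_all [Inst.out, Inst.bindsFresh]

theorem StepBy.dom_mono {r : Inst} {n : Chan} {X Y : State} (h : StepBy r n X Y) :
    X.dom ⊆ Y.dom := by
  obtain ⟨V, hX, -, hY, -⟩ := h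
  rintro x ⟨A, hA⟩
  rw [hX, Multiset.mem_add, Inst.mem_eph] at hA
  refine ⟨A, hY ▸ Multiset.mem_add.2 (Or.inr (hA.resolve_left ?_))⟩
  rintro (h | ⟨a, m, -, h⟩) <;> cases h

theorem StepBy.dom_subset {r : Inst} {n : Chan} {X Y : State} (h : StepBy r n X Y) {x : Chan}
    (hx : x ∈ Y.dom) : x ∈ X.dom ∨ r.bindsFresh ∧ x = n := by
  obtain ⟨V, hX, -, hY, -⟩ := h
  obtain ⟨A, hA⟩ := hx
  rw [hY, Multiset.mem_add] at hA
  rcases hA with hA | hA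
  · exact Or.inr (Inst.typ_mem_out hA)
  · exact Or.inl ⟨A, hX ▸ Multiset.mem_add.2 (Or.inr hA)⟩

theorem Path.dom_mono {X Y : State} (h : Path X Y) : X.dom ⊆ Y.dom := by
  induction h with
  | refl => exact subset_rfl
  | tail _ h ih =>
    obtain ⟨r, n, h⟩ := h
    exact ih.trans h.dom_mono

theorem StepBy.applicable {r : Inst} {n : Chan} {X Y : State} (h : StepBy r n X Y) :
    r.Applicable X.cfg := by
  obtain ⟨V, hX, hp, -⟩ := h
  exact Inst.applicable_iff.2 ⟨V, hX, hp⟩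

theorem StepBy.unique {r : Inst} {n : Chan} {X Y Y' : State} (h : StepBy r n X Y)
    (h' : StepBy r n X Y') : Y = Y' := by
  obtain ⟨V, hX, -, hY, -, hs⟩ := h
  obtain ⟨V', hX', -, hY', -, hs'⟩ := h'
  obtain rfl : V = V' := add_left_cancel (hX.symm.trans hX')
  exact State.ext (hY.trans hY'.symm) (hs.trans hs'.symm)

theorem StepBy.change_name {r : Inst} {n m : Chan} {X Y : State} (h : StepBy r n X Y)
    (hr : ¬ r.bindsFresh) : StepBy r m X Y := by
  obtain ⟨V, hX, hp, hY, hf, hs⟩ := h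
  rw [Inst.out_eq_of_not_bindsFresh hr n m] at hY hs
  exact ⟨V, hX, hp, hY, fun h => absurd h hr, hs⟩

/-- The set `s` gives control over the fresh name beyond freshness itself; commuting two steps
requires their names to differ. -/
theorem exists_step {r : Inst} {X : State} (h : r.Applicable X.cfg) {s : Set Chan}
    (hs : s.Finite) : ∃ n Y, n ∉ s ∧ StepBy r n X Y := by
  obtain ⟨V, hX, hp⟩ := Inst.applicable_iff.1 h
  obtain ⟨n, hn⟩ := (hs.union X.dom_finite).exists_notMem
  rw [Set.mem_union, not_or] at hn
  exact ⟨n, ⟨r.out n + V, _⟩, hn.1, V, hX, hp, rfl, fun _ A hA => hn.2 ⟨A, hA⟩, rfl⟩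

theorem StepBy.fresh {r : Inst} {n : Chan} {X Y : State} (h : StepBy r n X Y)
    (hr : r.bindsFresh) : n ∉ X.dom := by
  obtain ⟨V, -, -, -, hf, -⟩ := h
  rintro ⟨A, hA⟩
  exact hf hr A hA

/-- The choice of the fresh name is immaterial. -/
theorem StepBy.rename {r : Inst} {n n' : Chan} {X Y Y' : State} (hX : Good X)
    (h : StepBy r n X Y) (h' : StepBy r n' X Y') : ∃ σ, Fixes σ X ∧ Y = Y'.act σ := by
  by_cases hr : r.bindsFresh
  -- Both names are untyped in `X`, so exchanging them leaves `X` alone and turns one step into the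
  -- other.
  · have hfix : Fixes (Equiv.swap n n') X := fun x hx => Equiv.swap_apply_of_ne_of_ne
      (fun e => h.fresh hr (e ▸ hx)) (fun e => h'.fresh hr (e ▸ hx))
    refine ⟨_, hfix, ?_⟩
    have h₂ := h'.act (Equiv.swap n n')
    rw [hX.act_eq_self hfix, Equiv.swap_apply_right] at h₂
    obtain ⟨V, hV, -⟩ := id h
    have hj : Judg.proc r.chan r.proc ∈ r.eph := Inst.mem_eph.2 (Or.inl rfl)
    have hj' := Multiset.mem_map_of_mem (Judg.ren (Equiv.swap n n')) hj
    rw [hX.judg_ren_eq_self hfix (hV ▸ Multiset.mem_add.2 (Or.inl hj)), ← Inst.ren_eph] at hj'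
    -- The renamed rule rewrites the same process, because the names of that process are typed; by
    -- determinism it is the rule `r` itself.
    have := hX.deterministic h.applicable h₂.applicable hj hj'
    rw [← this] at h₂
    exact h.unique h₂
  · exact ⟨1, fun _ _ => rfl, by rw [State.act_one]; exact h.unique (h'.change_name hr)⟩

/-- Distinct applicable rules commute. -/
theorem StepBy.diamond {r s : Inst} {n m : Chan} {X Y Z : State} (hX : Good X)
    (h : StepBy r n X Y) (h' : StepBy s m X Z) (hne : r ≠ s)
    (hnm : r.bindsFresh → s.bindsFresh → n ≠ m) : ∃ W, StepBy s m Y W ∧ StepBy r n Z W := by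
  classical
  have hdom := fun x => h.dom_subset (x := x)
  have hdom' := fun x => h'.dom_subset (x := x)
  have hfr := h.fresh
  have hfr' := h'.fresh
  have hdisj : Disjoint r.eph s.eph := Multiset.disjoint_left.2 fun {j} hj hj' =>
    hne (hX.deterministic h.applicable h'.applicable hj hj')
  obtain ⟨V, hV, hp, hY, -, hs⟩ := h
  obtain ⟨V', hV', hp', hZ, -, hs'⟩ := h'
  -- Distinct rules consume disjoint multisets, whose sum is their union; it is contained in the
  -- configuration as soon as each of them is.
  have hle : r.eph + s.eph ≤ X.cfg := by
    rw [Multiset.add_eq_union_iff_disjoint.2 hdisj]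
    exact Multiset.union_le (hV ▸ Multiset.le_add_right _ _) (hV' ▸ Multiset.le_add_right _ _)
  obtain ⟨U, hU⟩ := Multiset.le_iff_exists_add.1 hle
  obtain rfl : V = s.eph + U := by
    rw [hU, add_assoc] at hV
    exact (add_left_cancel hV).symm
  obtain rfl : V' = r.eph + U := by
    rw [hU, add_comm r.eph, add_assoc] at hV'
    exact (add_left_cancel hV').symm
  -- Types are never consumed, so the types that either rule reads lie in the common remainder `U`.
  have typ_mem : ∀ {q : Inst} {x : Chan × Ty}, Judg.typ x.1 x.2 ∈ q.eph + U →
      Judg.typ x.1 x.2 ∈ U := by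
    intro q x hx
    rw [Multiset.mem_add, Inst.mem_eph] at hx
    refine hx.resolve_left ?_
    rintro (h | ⟨a, m, -, h⟩) <;> cases h
  refine ⟨⟨r.out n + s.out m + U, X.seen ∪ {x | .msg x.1 x.2 ∈ r.out n} ∪
    {x | .msg x.1 x.2 ∈ s.out m}⟩, ⟨r.out n + U, ?_, ?_, ?_, ?_, ?_⟩,
    ⟨s.out m + U, ?_, ?_, ?_, ?_, ?_⟩⟩
  · rw [hY, add_left_comm]
  · exact fun x hx => Multiset.mem_add.2 (Or.inr (typ_mem (hp' x hx)))
  · simp only [add_left_comm, add_assoc]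
  · intro hsb A hA
    rcases hdom m ⟨A, hA⟩ with h | ⟨hrb, h⟩
    · exact hfr' hsb h
    · exact hnm hrb hsb h.symm
  · rw [hs]
  · rw [hZ, add_left_comm]
  · exact fun x hx => Multiset.mem_add.2 (Or.inr (typ_mem (hp x hx)))
  · simp only [add_assoc]
  · intro hrb A hA
    rcases hdom' n ⟨A, hA⟩ with h | ⟨hsb, h⟩
    · exact hfr hrb h
    · exact hnm hrb hsb h
  · rw [hs', Set.union_right_comm]

/-- A step can be moved to the front of a sequence of steps, up to renaming: either the sequence
already performs it, or it stays applicable. -/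
theorem Path.strip {X Y : State} (p : Path X Y) : ∀ {X' : State} {r : Inst} {n : Chan}, Good X →
    StepBy r n X X' → (∃ σ, Fixes σ X ∧ Path X' (Y.act σ)) ∨
      (r.Applicable Y.cfg ∧ ∀ n' Y', StepBy r n' Y Y' → ∃ σ, Fixes σ X ∧ Path X' (Y'.act σ)) := by
  induction p using Relation.ReflTransGen.head_induction_on with
  | refl =>
    intro X' r n hX h
    refine Or.inr ⟨h.applicable, fun n' Y' h' => ?_⟩
    obtain ⟨σ, hσ, rfl⟩ := h.rename hX h'
    exact ⟨σ, hσ, .refl⟩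
  | @head X X₁ hs p ih =>
    intro X' r n hX h
    obtain ⟨s, m, hs⟩ := hs
    -- If the path starts with `r` itself, it already performs the step, up to the choice of the
    -- fresh name.
    by_cases hrs : r = s
    · subst hrs
      obtain ⟨σ, hσ, rfl⟩ := h.rename hX hs
      exact Or.inl ⟨σ, hσ, Path.act p σ⟩
    · obtain ⟨n₁, X'', hn₁, h₁⟩ := exists_step h.applicable (Set.finite_singleton m)
      obtain ⟨τ, hτ, rfl⟩ := h.rename hX h₁
      obtain ⟨W, hW, hW'⟩ := h₁.diamond hX hs hrs fun _ _ => hn₁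
      have lift : ∀ {Z : State}, (∃ σ, Fixes σ X₁ ∧ Path W (Z.act σ)) →
          ∃ σ, Fixes σ X ∧ Path (X''.act τ) (Z.act σ) := by
        rintro Z ⟨σ, hσ, hp⟩
        refine ⟨τ * σ, hτ.mul (hσ.mono hs.dom_mono), ?_⟩
        rw [← State.act_act]
        exact Path.act (hW.path.trans hp) τ
      rcases ih (hX.step hs) hW' with h | ⟨ha, h⟩
      · exact Or.inl (lift h)
      · exact Or.inr ⟨ha, fun n' Y' h' => lift (h n' Y' h')⟩

/-! ### Observations along paths -/

/-- The root of the communication that a message contributes to. -/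
def Msg.head : Msg → CommHead
  | .close => .star
  | .chan _ _ => .pair
  | .label k _ => .label k
  | .unfold _ => .unfold

/-- The channels that carry the immediate subtrees of a communication. -/
def Msg.child : Msg → Bool → Option Chan
  | .close, _ => none
  | .chan e d, b => some (if b then d else e)
  | .label _ d, _ => some d
  | .unfold d, _ => some d

/-- `Sees H c π h`: the messages `H` determine the label `h` at the position `π` of the
communication on `c`. -/
def Sees (H : Set (Chan × Msg)) : Chan → List Bool → CommHead → Prop
  | c, [], h => ∃ m, (c, m) ∈ H ∧ m.head = h
  | c, b :: π, h => ∃ m d, (c, m) ∈ H ∧ m.child b = some d ∧ Sees H d π h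

theorem Sees.mono {H H' : Set (Chan × Msg)} (hH : H ⊆ H') {c : Chan} {π : List Bool}
    {h : CommHead} (hs : Sees H c π h) : Sees H' c π h := by
  induction π generalizing c with
  | nil =>
    obtain ⟨m, hm, he⟩ := hs
    exact ⟨m, hH hm, he⟩
  | cons b π ih =>
    obtain ⟨m, d, hm, hd, hs⟩ := hs
    exact ⟨m, d, hH hm, hd, ih hs⟩

theorem Sees.act {X : State} {c : Chan} {π : List Bool} {h : CommHead} (hs : Sees X.seen c π h)
    (σ : Equiv.Perm Chan) : Sees (X.act σ).seen (σ c) π h := by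
  have mem : ∀ {c m}, (c, m) ∈ X.seen → (σ c, m.ren σ) ∈ (X.act σ).seen := by
    intro c m hm
    simpa [State.act, Msg.ren_ren, Msg.ren_id] using hm
  induction π generalizing c with
  | nil =>
    obtain ⟨m, hm, he⟩ := hs
    exact ⟨_, mem hm, by rw [← he]; cases m <;> rfl⟩
  | cons b π ih =>
    obtain ⟨m, d, hm, hd, hs⟩ := hs
    refine ⟨_, σ d, mem hm, ?_, ih hs⟩
    cases m <;> simp only [Msg.child, Msg.ren, Option.some.injEq, reduceCtorEq] at hd ⊢
    · rw [← hd, apply_ite σ]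
    · rw [hd]
    · rw [hd]

theorem Sees.of_act {X : State} {σ : Equiv.Perm Chan} {c : Chan} {π : List Bool} {h : CommHead}
    (hs : Sees (X.act σ).seen c π h) (hc : σ c = c) : Sees X.seen c π h := by
  have := hs.act σ⁻¹
  rw [State.act_act, inv_mul_cancel, State.act_one] at this
  rwa [Equiv.Perm.inv_eq_iff_eq.2 hc.symm] at this

theorem Sees.cons_iff {H : Set (Chan × Msg)} (hH : ∀ a m m', (a, m) ∈ H → (a, m') ∈ H → m = m')
    {c d : Chan} {m : Msg} {b : Bool} (hm : (c, m) ∈ H) (hd : m.child b = some d)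
    {π : List Bool} {h : CommHead} : Sees H c (b :: π) h ↔ Sees H d π h := by
  constructor
  · rintro ⟨m', d', hm', hd', hs⟩
    obtain rfl := hH _ _ _ hm hm'
    rw [hd, Option.some.injEq] at hd'
    rwa [hd']
  · exact fun hs => ⟨m, d, hm, hd, hs⟩

/-- Some sequence of steps makes an observation. -/
def May (X : State) (c : Chan) (π : List Bool) (h : CommHead) : Prop :=
  ∃ Y, Path X Y ∧ Sees Y.seen c π h

theorem StepBy.seen_mono {r : Inst} {n : Chan} {X Y : State} (h : StepBy r n X Y) :
    X.seen ⊆ Y.seen := by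
  obtain ⟨V, -, -, -, -, hs⟩ := h
  rw [hs]
  exact Set.subset_union_left

theorem Path.seen_mono {X Y : State} (h : Path X Y) : X.seen ⊆ Y.seen := by
  induction h with
  | refl => exact subset_rfl
  | tail _ h ih =>
    obtain ⟨r, n, h⟩ := h
    exact ih.trans h.seen_mono

/-- No step forecloses an observation. -/
theorem May.step {X X' : State} {r : Inst} {n : Chan} (hX : Good X) (h : StepBy r n X X')
    {c : Chan} (hc : c ∈ X.dom) {π : List Bool} {e : CommHead} (hm : May X c π e) :
    May X' c π e := by
  obtain ⟨Y, p, hs⟩ := hm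
  -- Either the observing path already contains the step, or the step is fired after it, which only
  -- adds to the messages seen. The permutation fixes `c`, so the observation is still one on `c`.
  rcases p.strip hX h with ⟨σ, hσ, hp⟩ | ⟨ha, hY⟩
  · exact ⟨_, hp, by simpa [hσ c hc] using hs.act σ⟩
  · obtain ⟨n', Y', -, h'⟩ := exists_step ha Set.finite_empty
    obtain ⟨σ, hσ, hp⟩ := hY n' Y' h'
    exact ⟨_, hp, by simpa [hσ c hc] using (hs.mono h'.seen_mono).act σ⟩

/-! ### Traces -/

/-- The messages in a set of judgments. -/
def msgSet (U : Set Judg) : Set (Chan × Msg) := {x | .msg x.1 x.2 ∈ U}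

/-- The initial state with a given configuration. -/
def State.init (M : Config) : State := ⟨M, {x | .msg x.1 x.2 ∈ M}⟩

/-- The states of a trace. -/
def Trace.st {M : Config} (T : Trace M) (k : ℕ) : State :=
  ⟨T.state k, {x | ∃ i ≤ k, .msg x.1 x.2 ∈ T.state i}⟩

theorem Trace.st_zero {M : Config} (T : Trace M) : T.st 0 = State.init M := by
  ext1
  · exact T.start
  · ext x
    simp [Trace.st, State.init, T.start]

theorem Trace.stepBy {M : Config} (T : Trace M) {k : ℕ} (hk : (k : ℕ∞) < T.len) :
    StepBy (T.inst k) (T.fresh k) (T.st k) (T.st (k + 1)) := by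
  obtain ⟨M', h₁, h₂⟩ := T.step k hk
  rw [Inst.lhs_eq, add_assoc] at h₁
  rw [Inst.rhs_eq, add_assoc] at h₂
  refine ⟨_, h₁, ?_, h₂, ?_, ?_⟩
  · intro x hx
    rw [hx]
    exact Multiset.mem_add.2 (Or.inl (Multiset.mem_singleton_self _))
  · intro hr A hA
    exact T.fresh_new k k le_rfl hk hr ⟨_, hA, rfl⟩
  · ext x
    simp only [Trace.st, Set.mem_union, Set.mem_ofPred_eq]
    constructor
    · rintro ⟨i, hi, hx⟩
      rcases Nat.le_succ_iff.1 hi with hi | rfl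
      · exact Or.inl ⟨i, hi, hx⟩
      · rw [h₂] at hx
        rcases Multiset.mem_add.1 hx with hx | hx
        · exact Or.inr hx
        · exact Or.inl ⟨k, le_rfl, h₁ ▸ Multiset.mem_add.2 (Or.inr hx)⟩
    · rintro (⟨i, hi, hx⟩ | hx)
      · exact ⟨i, hi.trans k.le_succ, hx⟩
      · exact ⟨k + 1, le_rfl, h₂ ▸ Multiset.mem_add.2 (Or.inl hx)⟩

theorem Trace.path {M : Config} (T : Trace M) {i j : ℕ} (hij : i ≤ j) (hj : (j : ℕ∞) ≤ T.len) :
    Path (T.st i) (T.st j) := by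
  induction j, hij using Nat.le_induction with
  | base => exact .refl
  | succ j _ ih =>
    have hlt : (j : ℕ∞) < T.len := lt_of_lt_of_le (by exact_mod_cast j.lt_succ_self) hj
    exact (ih hlt.le).tail ⟨_, _, T.stepBy hlt⟩

/-- A fair trace performs every finite sequence of steps, up to renaming. -/
theorem Trace.IsFair.complete {M : Config} {T : Trace M} (hT : T.IsFair) (hG : Good (T.st 0))
    {Y : State} (p : Path (T.st 0) Y) :
    ∃ (k : ℕ) (σ : Equiv.Perm Chan), (k : ℕ∞) ≤ T.len ∧ Fixes σ (T.st 0) ∧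
      Path Y ((T.st k).act σ) := by
  induction p with
  | refl => exact ⟨0, 1, by simp, fun _ _ => rfl, by rw [State.act_one]; exact .refl⟩
  | @tail Y Y' p h ih =>
    obtain ⟨k, σ, hk, hσ, q⟩ := ih
    obtain ⟨r, n, h⟩ := h
    have hY := hG.path p
    have fixes : ∀ {τ : Equiv.Perm Chan}, Fixes τ Y → Fixes (τ * σ) (T.st 0) := fun hτ =>
      (hτ.mono (Path.dom_mono p)).mul hσ
    -- Either the trace has performed the step by time `k`, or the rule, renamed back by `σ⁻¹`, is
    -- applicable there and fairness fires it at some later time `j`.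
    rcases q.strip hY h with ⟨τ, hτ, q'⟩ | ⟨ha, -⟩
    · exact ⟨k, τ * σ, hk, fixes hτ, by rwa [State.act_act] at q'⟩
    · have ha' : (r.ren σ⁻¹).Applicable (T.st k).cfg := by
        obtain ⟨m, Z, -, hZ⟩ := exists_step ha Set.finite_empty
        have := (hZ.act σ⁻¹).applicable
        rwa [State.act_act, inv_mul_cancel, State.act_one] at this
      obtain ⟨j, hkj, hj, heq⟩ := hT.2 k hk _ ha'
      have q₂ : Path Y ((T.st j).act σ) := Relation.ReflTransGen.trans q ((T.path hkj hj.le).act σ)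
      -- The same alternative is taken at time `j`, since the rule might have been absorbed between
      -- `k` and `j`.
      rcases q₂.strip hY h with ⟨τ, hτ, q'⟩ | ⟨ha₂, hstep⟩
      · exact ⟨j, τ * σ, hj.le, fixes hτ, by rwa [State.act_act] at q'⟩
      · have hs := (T.stepBy hj).act σ
        -- Fairness provides only an equivalent instantiation. It consumes the same process, which
        -- by determinism makes its renaming equal to `r`.
        have hmem : Judg.proc (r.ren σ⁻¹).chan (r.ren σ⁻¹).proc ∈ (T.inst j).eph := by
          have : Judg.proc (r.ren σ⁻¹).chan (r.ren σ⁻¹).proc ∈ (T.inst j).lhs := by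
            rw [heq.1, Inst.lhs_eq]
            exact Multiset.mem_add.2 (Or.inl (Inst.mem_eph.2 (Or.inl rfl)))
          rw [Inst.lhs_eq, Multiset.mem_add] at this
          refine this.resolve_right fun h => ?_
          simp [typs] at h
        have hmem' := Multiset.mem_map_of_mem (Judg.ren σ) hmem
        rw [← Inst.ren_eph, Inst.ren_chan, Inst.ren_proc] at hmem'
        have hrσ := Judg.ren_symm_ren (.proc r.chan r.proc) σ
        simp only [Judg.ren] at hrσ hmem'
        replace hmem' : Judg.proc r.chan r.proc ∈ ((T.inst j).ren σ).eph := hrσ ▸ hmem'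
        have := (hY.path q₂).deterministic ha₂ hs.applicable (Inst.mem_eph.2 (Or.inl rfl)) hmem'
        rw [← this] at hs
        obtain ⟨τ, hτ, q'⟩ := hstep _ _ hs
        exact ⟨j + 1, τ * σ, by exact_mod_cast Order.add_one_le_of_lt hj, fixes hτ, by rwa [State.act_act] at q'⟩

theorem Trace.seen_subset {M : Config} (T : Trace M) {k : ℕ} (hk : (k : ℕ∞) ≤ T.len) :
    (T.st k).seen ⊆ msgSet T.union := by
  rintro x ⟨i, hi, hx⟩
  exact ⟨i, le_trans (by exact_mod_cast hi) hk, hx⟩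

theorem Trace.seen_mono {M : Config} (T : Trace M) {i j : ℕ} (h : i ≤ j) :
    (T.st i).seen ⊆ (T.st j).seen :=
  fun _ ⟨k, hk, hx⟩ => ⟨k, hk.trans h, hx⟩

/-- A position is a finite path in the tree, so it involves finitely many messages, and seen
messages accumulate. -/
theorem Trace.exists_sees {M : Config} (T : Trace M) {c : Chan} {π : List Bool} {h : CommHead}
    (hs : Sees (msgSet T.union) c π h) : ∃ k : ℕ, (k : ℕ∞) ≤ T.len ∧ Sees (T.st k).seen c π h := by
  induction π generalizing c with
  | nil =>
    obtain ⟨m, ⟨k, hk, hm⟩, he⟩ := hs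
    exact ⟨k, hk, m, ⟨k, le_rfl, hm⟩, he⟩
  | cons b π ih =>
    obtain ⟨m, d, ⟨k, hk, hm⟩, hd, hs⟩ := hs
    obtain ⟨k', hk', hs⟩ := ih hs
    refine ⟨max k k', ?_, m, d, ⟨k, le_max_left _ _, hm⟩, hd,
      hs.mono (T.seen_mono (le_max_right _ _))⟩
    rcases max_choice k k' with h | h <;> rwa [h]

/-- A fair trace makes exactly the observations that some sequence of steps makes. -/
theorem Trace.IsFair.sees_iff {M : Config} {T : Trace M} (hT : T.IsFair)
    (hG : Good (State.init M)) {c : Chan} (hc : c ∈ (State.init M).dom) {π : List Bool}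
    {h : CommHead} : Sees (msgSet T.union) c π h ↔ May (State.init M) c π h := by
  rw [← T.st_zero] at hG hc ⊢
  constructor
  · intro hs
    obtain ⟨k, hk, hs⟩ := T.exists_sees hs
    exact ⟨_, T.path (Nat.zero_le k) hk, hs⟩
  · rintro ⟨Y, p, hs⟩
    obtain ⟨k, σ, hk, hσ, q⟩ := hT.complete hG p
    exact ((hs.mono (Path.seen_mono q)).of_act (hσ c hc)).mono (T.seen_subset hk)

/-! ### Existence of fair traces -/

/-- No rule disables another, by the diamond property. This persistence is what makes a round-robin
strategy fair. -/
theorem Inst.Applicable.step {r s : Inst} {m : Chan} {X Y : State} (hX : Good X)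
    (h : r.Applicable X.cfg) (hs : StepBy s m X Y) (hne : r ≠ s) : r.Applicable Y.cfg := by
  obtain ⟨n, Z, hn, hZ⟩ := exists_step h (Set.finite_singleton m)
  obtain ⟨W, -, hW⟩ := hZ.diamond hX hs hne fun _ _ => hn
  exact hW.applicable

/-- The length is the first index at which `p` fails, or infinite. Applied to the existence of an
applicable rule, it makes the trace maximal. -/
theorem exists_length (p : ℕ → Prop) :
    ∃ len : ℕ∞, (∀ i : ℕ, (i : ℕ∞) < len → p i) ∧ ∀ n : ℕ, len = n → ¬ p n := by
  classical
  by_cases h : ∃ n, ¬ p n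
  · refine ⟨(Nat.find h : ℕ), fun i hi => ?_, fun n hn => ?_⟩
    · exact not_not.1 (Nat.find_min h (by exact_mod_cast hi))
    · rw [Nat.cast_inj] at hn
      exact hn ▸ Nat.find_spec h
  · push Not at h
    exact ⟨⊤, fun i _ => h i, fun n hn => absurd hn (ENat.top_ne_natCast n)⟩

/-- A step that rewrites a given process whenever possible. -/
theorem Good.exists_next {X : State} (hX : Good X) (j : Judg) :
    ∃ (Y : State) (r : Inst) (n : Chan), Good Y ∧ X.dom ⊆ Y.dom ∧
      ((∃ s : Inst, s.Applicable X.cfg) → StepBy r n X Y ∧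
        ∀ s : Inst, s.Applicable X.cfg → j ∈ s.eph → s = r) := by
  by_cases h : ∃ s : Inst, s.Applicable X.cfg
  · obtain ⟨r, hr, hrj⟩ : ∃ r : Inst, r.Applicable X.cfg ∧
        ∀ s : Inst, s.Applicable X.cfg → j ∈ s.eph → s = r := by
      by_cases hj : ∃ s : Inst, s.Applicable X.cfg ∧ j ∈ s.eph
      · obtain ⟨r, hr, hj⟩ := hj
        exact ⟨r, hr, fun s hs hsj => hX.deterministic hs hr hsj hj⟩
      · obtain ⟨r, hr⟩ := h
        exact ⟨r, hr, fun s hs hsj => absurd ⟨s, hs, hsj⟩ hj⟩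
    obtain ⟨n, Y, -, hY⟩ := exists_step hr Set.finite_empty
    exact ⟨Y, r, n, hX.step hY, hY.dom_mono, fun _ => ⟨hY, hrj⟩⟩
  -- Nothing is applicable: the state is repeated, and the rule and the name are dummies that the
  -- trace never reaches.
  · exact ⟨X, .close 0, 0, hX, subset_rfl, fun h' => absurd h' h⟩

/-- From every typed configuration there is an infinite sequence of states that passes by every
process infinitely often: position `k` of state `i` is considered at time `Nat.pair i k`. -/
theorem Good.exists_schedule {X : State} (hX : Good X) :
    ∃ (st : ℕ → State) (inst : ℕ → Inst) (fresh : ℕ → Chan), st 0 = X ∧ (∀ t, Good (st t)) ∧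
      (∀ t, (st t).dom ⊆ (st (t + 1)).dom) ∧
      ∀ t, (∃ s : Inst, s.Applicable (st t).cfg) →
        StepBy (inst t) (fresh t) (st t) (st (t + 1)) ∧
        ∀ s : Inst, s.Applicable (st t).cfg →
          (st (Nat.unpair t).1).cfg.toList.getD (Nat.unpair t).2 (.typ 0 .one) ∈ s.eph →
          s = inst t := by
  choose next inst fresh hgood hdom hstep using
    fun (X : {X // Good X}) (j : Judg) => X.2.exists_next j
  -- A position beyond the end of the list yields a type judgment, which no rule consumes, so it
  -- imposes no requirement on the step.
  let target : ℕ → (ℕ → {X // Good X}) → Judg := fun t past =>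
    (past (Nat.unpair t).1).1.cfg.toList.getD (Nat.unpair t).2 (.typ 0 .one)
  -- The recursion carries a table of the earlier states, because the target at time `t` is taken
  -- from state `(Nat.unpair t).1`, which is at most `t` steps old.
  let seq : ℕ → {X // Good X} × (ℕ → {X // Good X}) := fun t =>
    Nat.rec (⟨X, hX⟩, fun _ => ⟨X, hX⟩) (fun t s =>
      (⟨next s.1 (target t s.2), hgood _ _⟩,
        Function.update s.2 (t + 1) ⟨next s.1 (target t s.2), hgood _ _⟩)) t
  have past : ∀ t i, i ≤ t → (seq t).2 i = (seq i).1 := by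
    intro t
    induction t with
    | zero => intro i hi; rw [Nat.le_zero.1 hi]; rfl
    | succ t ih =>
      intro i hi
      rcases Nat.le_succ_iff.1 hi with h | rfl
      · exact (Function.update_of_ne (by omega) _ _).trans (ih i h)
      · exact Function.update_self _ _ _
  refine ⟨fun t => (seq t).1.1, fun t => inst (seq t).1 (target t (seq t).2),
    fun t => fresh (seq t).1 (target t (seq t).2), rfl, fun t => (seq t).1.2,
    fun t => hdom _ _, fun t ht => ?_⟩
  have := hstep (seq t).1 (target t (seq t).2) ht
  refine ⟨this.1, fun s hs hj => this.2 s hs ?_⟩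
  simp only [target]
  rwa [past t _ (Nat.unpair_left_le t)]

theorem Good.exists_fair {M : Config} (hM : Good (State.init M)) : ∃ T : Trace M, T.IsFair := by
  obtain ⟨st, inst, fresh, h0, hgood, hdom, hstep⟩ := hM.exists_schedule
  obtain ⟨len, hlen, hend⟩ := exists_length fun t => ∃ s : Inst, s.Applicable (st t).cfg
  have hmono : Monotone fun t => (st t).dom := monotone_nat_of_le_succ hdom
  let T : Trace M :=
    { len := len
      state := fun t => (st t).cfg
      inst := inst
      fresh := fresh
      start := by rw [h0]; rfl
      step := by
        intro i hi
        obtain ⟨⟨V, hV, hp, hV', -⟩, -⟩ := hstep i (hlen i hi)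
        rw [hV, hV', Inst.lhs_eq, Inst.rhs_eq]
        rcases hr : (inst i).per with - | x
        · exact ⟨V, by simp [typs], by simp [typs]⟩
        · obtain ⟨V', rfl⟩ := Multiset.exists_cons_of_mem (hp x hr)
          exact ⟨V', by simp [typs, add_assoc], by simp [typs, add_assoc]⟩
      -- All names of an earlier state are typed there and remain typed, so a name that is untyped
      -- now occurs in no earlier state.
      fresh_new := by
        intro i j hij hj hr hn
        exact (hstep j (hlen j hj)).1.fresh hr (hmono hij ((hgood i).names_subset hn)) }
  refine ⟨T, fun n hn r hr => hend n hn ⟨r, hr⟩, fun i hi r hr => ?_⟩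
  -- Until `r` is fired it stays applicable, and as long as it is applicable the trace cannot end.
  have persist : ∀ u, i ≤ u → (∃ j, i ≤ j ∧ (j : ℕ∞) < len ∧ inst j = r) ∨
      (r.Applicable (st u).cfg ∧ (u : ℕ∞) < len) := by
    have lt_len : ∀ u : ℕ, (u : ℕ∞) ≤ len → r.Applicable (st u).cfg → (u : ℕ∞) < len :=
      fun u hu ha => lt_of_le_of_ne hu fun he => hend u he.symm ⟨r, ha⟩
    intro u hu
    induction u, hu using Nat.le_induction with
    | base => exact Or.inr ⟨hr, lt_len i hi hr⟩
    | succ u hu ih =>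
      rcases ih with h | ⟨ha, hlt⟩
      · exact Or.inl h
      · by_cases hru : inst u = r
        · exact Or.inl ⟨u, hu, hlt, hru⟩
        · have := ha.step (hgood u) (hstep u (hlen u hlt)).1 fun e => hru e.symm
          exact Or.inr ⟨this, lt_len _ (by exact_mod_cast Order.add_one_le_of_lt hlt) this⟩
  have fired : ∃ j, i ≤ j ∧ (j : ℕ∞) < len ∧ inst j = r := by
    have hmem : Judg.proc r.chan r.proc ∈ (st i).cfg.toList := by
      obtain ⟨V, hV, -⟩ := Inst.applicable_iff.1 hr
      rw [Multiset.mem_toList]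
      change _ ∈ T.state i
      rw [hV]
      exact Multiset.mem_add.2 (Or.inl (Inst.mem_eph.2 (Or.inl rfl)))
    obtain ⟨k, hk, hget⟩ := List.getElem_of_mem hmem
    -- At time `Nat.pair i k` the scheduler targets the process that `r` rewrites; if `r` has not
    -- been fired earlier, it is fired then.
    rcases persist (Nat.pair i k) (Nat.left_le_pair i k) with h | ⟨ha, hlt⟩
    · exact h
    · refine ⟨_, Nat.left_le_pair i k, hlt, ((hstep _ (hlen _ hlt)).2 r ha ?_).symm⟩
      rw [Nat.unpair_pair, List.getD_eq_getElem _ _ hk, hget]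
      exact Inst.mem_eph.2 (Or.inl rfl)
  obtain ⟨j, hij, hj, rfl⟩ := fired
  exact ⟨j, hij, hj, rfl, Iff.rfl, fun _ => rfl⟩

/-! ### Existence and uniqueness of observed communications -/

/-- A set of judgments in which every channel has at most one type and carries at most one message,
which respects the types. -/
structure Coherent (U : Set Judg) : Prop where
  func : ∀ a m m', (a, m) ∈ msgSet U → (a, m') ∈ msgSet U → m = m'
  tfunc : ∀ a A B, .typ a A ∈ U → .typ a B ∈ U → A = B
  typed : ∀ a m, .msg a m ∈ U → ∃ A, .typ a A ∈ U ∧ MTyped {x | .typ x.1 x.2 ∈ U} m A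

/-- Types persist and seen messages accumulate, so judgments from two moments of the trace can be
compared in the later of the two states. -/
theorem Trace.coherent {M : Config} (T : Trace M) (hM : Good (State.init M)) :
    Coherent T.union := by
  have hgood : ∀ k : ℕ, (k : ℕ∞) ≤ T.len → Good (T.st k) := fun k hk =>
    Good.path (T.st_zero ▸ hM) (T.path (Nat.zero_le k) hk)
  have hmax : ∀ i j : ℕ, (i : ℕ∞) ≤ T.len → (j : ℕ∞) ≤ T.len → ((max i j : ℕ) : ℕ∞) ≤ T.len := by
    intro i j hi hj
    rcases max_choice i j with h | h <;> rwa [h]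
  have htyp : ∀ {i j : ℕ}, i ≤ j → (j : ℕ∞) ≤ T.len → ∀ {a A}, .typ a A ∈ T.state i →
      .typ a A ∈ T.state j := by
    intro i j hij hj a A ha
    induction j, hij using Nat.le_induction with
    | base => exact ha
    | succ j _ ih =>
      have hlt : (j : ℕ∞) < T.len := lt_of_lt_of_le (by exact_mod_cast j.lt_succ_self) hj
      obtain ⟨V, hV, -, hV', -⟩ := T.stepBy hlt
      have hj := ih hlt.le
      change _ ∈ (T.st j).cfg at hj
      change _ ∈ (T.st (j + 1)).cfg
      rw [hV, Multiset.mem_add, Inst.mem_eph] at hj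
      rw [hV', Multiset.mem_add]
      refine Or.inr (hj.resolve_left ?_)
      rintro (h | ⟨a, m, -, h⟩) <;> cases h
  refine ⟨?_, ?_, ?_⟩
  · rintro a m m' ⟨i, hi, hm⟩ ⟨j, hj, hm'⟩
    obtain ⟨G, Θ, rk, -, -, hs⟩ := hgood _ (hmax i j hi hj)
    exact hs.func a m m' ⟨i, le_max_left _ _, hm⟩ ⟨j, le_max_right _ _, hm'⟩
  · rintro a A B ⟨i, hi, hA⟩ ⟨j, hj, hB⟩
    obtain ⟨G, Θ, rk, hG, hwt, -⟩ := hgood _ (hmax i j hi hj)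
    exact hwt.func a A B ((mem_cfg_typ hG hwt).1 (htyp (le_max_left _ _) (hmax i j hi hj) hA))
      ((mem_cfg_typ hG hwt).1 (htyp (le_max_right _ _) (hmax i j hi hj) hB))
  · rintro a m ⟨i, hi, hm⟩
    obtain ⟨G, Θ, rk, hG, hwt, hs⟩ := hgood i hi
    obtain ⟨A, hA, ht⟩ := hs.typed a m ⟨i, le_rfl, hm⟩
    have hU : ∀ x : Chan × Ty, x ∈ Θ → .typ x.1 x.2 ∈ T.union := fun x hx =>
      ⟨i, hi, (mem_cfg_typ hG hwt).2 hx⟩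
    exact ⟨A, hU _ hA, ht.mono hU⟩

theorem Observes.rule {U : Set Judg} {v : Comm} {c : Chan} {A : Ty} (h : Observes U v c A) :
    ObsRule U (Observes U) v c A := by
  obtain ⟨R, hR, h⟩ := h
  have up : ∀ {v c A}, R v c A → Observes U v c A := fun h => ⟨R, hR, h⟩
  cases hR _ _ _ h with
  | bot h₁ h₂ => exact .bot h₁ h₂
  | one h₁ => exact .one h₁
  | plus l h₁ h₂ h₃ => exact .plus l h₁ (up h₂) h₃
  | amp l h₁ h₂ h₃ => exact .amp l h₁ (up h₂) h₃
  | tensor h₁ h₂ h₃ => exact .tensor h₁ (up h₂) (up h₃)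
  | mu h₁ h₂ => exact .mu h₁ (up h₂)

theorem Coherent.exists_observes {U : Set Judg} (hU : Coherent U) {c : Chan} {A : Ty}
    (hc : .typ c A ∈ U) : ∃ v, Observes U v c A := by
  let S := {x : Chan × Ty // .typ x.1 x.2 ∈ U}
  -- One layer of the tree above a typed channel, with typed channels as leaves. It is correct for
  -- every way `f` of filling the leaves, so in particular for the corecursive one that is being
  -- defined.
  have shape : ∀ s : S, ∃ o : PFunctor.Obj ⟨CommHead, CommHead.Arity⟩ S,
      ∀ (f : S → Comm) (R : Comm → Chan → Ty → Prop), (∀ s' : S, R (f s') s'.1.1 s'.1.2) →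
        ObsRule U R (PFunctor.M.mk (PFunctor.map _ f o)) s.1.1 s.1.2 := by
    rintro ⟨⟨a, A⟩, ha⟩
    by_cases hm : ∃ m, .msg a m ∈ U
    · obtain ⟨m, hm⟩ := hm
      obtain ⟨B, hB, ht⟩ := hU.typed a m hm
      obtain rfl := hU.tfunc a A B ha hB
      cases ht with
      | close =>
        refine ⟨⟨.star, fun e : Empty => e.elim⟩, fun f R _ => ?_⟩
        have e : PFunctor.M.mk (PFunctor.map _ f ⟨.star, fun e : Empty => e.elim⟩) = Comm.star :=
          congrArg PFunctor.M.mk (Sigma.ext rfl (heq_of_eq (funext nofun)))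
        exact (congrArg (fun v => ObsRule U R v a .one) e).mpr (.one hm)
      | @chan e d B A he hd =>
        refine ⟨⟨.pair, fun b : Bool => if b then ⟨(d, A), hd⟩ else ⟨(e, B), he⟩⟩,
          fun f R hR => ?_⟩
        have e : PFunctor.M.mk (PFunctor.map _ f
            ⟨.pair, fun b : Bool => if b then ⟨(d, A), hd⟩ else ⟨(e, B), he⟩⟩) =
            Comm.pair (f ⟨(e, B), he⟩) (f ⟨(d, A), hd⟩) :=
          congrArg PFunctor.M.mk (Sigma.ext rfl (heq_of_eq (funext fun b : Bool => by
            cases b <;> rfl)))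
        exact (congrArg (fun v => ObsRule U R v a (.tensor B A)) e).mpr
          (.tensor hm (hR ⟨(_, B), he⟩) (hR ⟨(d, A), hd⟩))
      | @plus d l L A k hk hd =>
        subst hk
        exact ⟨⟨.label k.1, fun _ : Unit => ⟨(d, A k), hd⟩⟩,
          fun f R hR => .plus k hm (hR ⟨(d, A k), hd⟩) ha⟩
      | @amp d l L A k hk hd =>
        subst hk
        exact ⟨⟨.label k.1, fun _ : Unit => ⟨(d, A k), hd⟩⟩,
          fun f R hR => .amp k hm (hR ⟨(d, A k), hd⟩) ha⟩
      | @unfold d A hd =>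
        exact ⟨⟨.unfold, fun _ : Unit => ⟨(d, A.unfold), hd⟩⟩,
          fun f R hR => .mu hm (hR ⟨(d, A.unfold), hd⟩)⟩
    · refine ⟨⟨.bot A, fun e : Empty => e.elim⟩, fun f R _ => ?_⟩
      have e : PFunctor.M.mk (PFunctor.map _ f ⟨.bot A, fun e : Empty => e.elim⟩) = Comm.bot A :=
        congrArg PFunctor.M.mk (Sigma.ext rfl (heq_of_eq (funext nofun)))
      exact (congrArg (fun v => ObsRule U R v a A) e).mpr (.bot ha fun m h => hm ⟨m, h⟩)
  choose o ho using shape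
  refine ⟨PFunctor.M.corec o ⟨(c, A), hc⟩,
    fun v c A => ∃ h : Judg.typ c A ∈ U, v = PFunctor.M.corec o ⟨(c, A), h⟩, ?_, hc, rfl⟩
  rintro v c A ⟨h, rfl⟩
  rw [PFunctor.M.corec_def]
  exact ho ⟨(c, A), h⟩ _ _ fun s => ⟨s.2, rfl⟩

theorem Observes.eq {U U' : Set Judg} (hU : Coherent U) (hU' : Coherent U') {c c' : Chan} {A : Ty}
    {v v' : Comm} (h : Observes U v c A) (h' : Observes U' v' c' A)
    (hs : ∀ π e, Sees (msgSet U) c π e ↔ Sees (msgSet U') c' π e) : v = v' := by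
  -- Two observed trees are related when their channels have the same type and show the same labels
  -- at all positions. Equal labels at the root give equal heads, and prefixing positions passes the
  -- relation to the subtrees.
  refine PFunctor.M.bisim (fun v v' => ∃ c c' A, Observes U v c A ∧ Observes U' v' c' A ∧
    ∀ π e, Sees (msgSet U) c π e ↔ Sees (msgSet U') c' π e) ?_ v v' ⟨c, c', A, h, h', hs⟩
  clear! c c' A v v'
  rintro v v' ⟨c, c', A, h, h', hs⟩
  have none₁ : (∀ m, Judg.msg c m ∉ U) → ∀ m, Judg.msg c' m ∉ U' := fun hn m hm => by
    obtain ⟨m', hm', -⟩ := (hs [] m.head).2 ⟨m, hm, rfl⟩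
    exact hn m' hm'
  have none₂ : (∀ m, Judg.msg c' m ∉ U') → ∀ m, Judg.msg c m ∉ U := fun hn m hm => by
    obtain ⟨m', hm', -⟩ := (hs [] m.head).1 ⟨m, hm, rfl⟩
    exact hn m' hm'
  have child : ∀ {m m' : Msg} {b d d'}, Judg.msg c m ∈ U → Judg.msg c' m' ∈ U' →
      m.child b = some d → m'.child b = some d' →
      ∀ π e, Sees (msgSet U) d π e ↔ Sees (msgSet U') d' π e := by
    intro m m' b d d' hm hm' hd hd' π e
    rw [← Sees.cons_iff hU.func hm hd, ← Sees.cons_iff hU'.func hm' hd']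
    exact hs (b :: π) e
  have label : ∀ {l l' : Label} {d d'}, Judg.msg c (.label l d) ∈ U →
      Judg.msg c' (.label l' d') ∈ U' → l = l' := by
    intro l l' d d' hm hm'
    obtain ⟨m, h₁, h₂⟩ := (hs [] _).1 ⟨_, hm, rfl⟩
    cases hU'.func _ _ _ h₁ hm'
    cases h₂
    rfl
  rcases h.rule with ⟨ht, hn⟩ | hm | ⟨l, hm, hv, ht⟩ | ⟨l, hm, hv, ht⟩ | ⟨hm, hu, hv⟩ | ⟨hm, hv⟩
  · cases h'.rule with
    | bot ht' hn' => exact ⟨_, _, _, rfl, rfl, nofun⟩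
    | one hm' => exact absurd hm' (none₁ hn _)
    | plus l' hm' => exact absurd hm' (none₁ hn _)
    | amp l' hm' => exact absurd hm' (none₁ hn _)
    | tensor hm' => exact absurd hm' (none₁ hn _)
    | mu hm' => exact absurd hm' (none₁ hn _)
  · cases h'.rule with
    | bot ht' hn' => exact absurd hm (none₂ hn' _)
    | one hm' => exact ⟨_, _, _, rfl, rfl, nofun⟩
  · cases h'.rule with
    | bot ht' hn' => exact absurd hm (none₂ hn' _)
    | plus l' hm' hv' ht' =>
      obtain rfl := Subtype.ext (label hm hm')
      -- `Msg.child` sends both booleans to the only continuation of a label message, so `true` is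
      -- an arbitrary choice.
      exact ⟨_, _, _, rfl, rfl, fun _ => ⟨_, _, _, hv, hv', child hm hm' (b := true) rfl rfl⟩⟩
  · cases h'.rule with
    | bot ht' hn' => exact absurd hm (none₂ hn' _)
    | amp l' hm' hv' ht' =>
      obtain rfl := Subtype.ext (label hm hm')
      exact ⟨_, _, _, rfl, rfl, fun _ => ⟨_, _, _, hv, hv', child hm hm' (b := true) rfl rfl⟩⟩
  · cases h'.rule with
    | bot ht' hn' => exact absurd hm (none₂ hn' _)
    | tensor hm' hu' hv' =>
      refine ⟨_, _, _, rfl, rfl, fun b => ?_⟩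
      cases b
      · exact ⟨_, _, _, hu, hu', child hm hm' (b := false) rfl rfl⟩
      · exact ⟨_, _, _, hv, hv', child hm hm' (b := true) rfl rfl⟩
  · cases h'.rule with
    | bot ht' hn' => exact absurd hm (none₂ hn' _)
    | mu hm' hv' =>
      exact ⟨_, _, _, rfl, rfl, fun _ => ⟨_, _, _, hv, hv', child hm hm' (b := true) rfl rfl⟩⟩

/-! ### Typed processes -/

theorem Typed.good {Δ : LCtx} {P : Proc} {c : Chan} {C : Ty} (h : Typed Δ P c C) :
    Good (State.init (initial Δ P c C)) := by
  obtain ⟨hwf, ht⟩ := h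
  have hwf' := hwf
  rw [WF, Multiset.nodup_cons] at hwf
  have hne : ∀ x ∈ Δ, x.1 ≠ c := fun x hx he => hwf.1 (Multiset.mem_map.2 ⟨x, hx, he⟩)
  -- With a single process it suffices to rank the provided channel above all others.
  refine ⟨{⟨.proc c P, Δ, c, C⟩}, (c, C) ::ₘ Δ, fun x => if x = c then 1 else 0, ?_, ?_, ?_⟩
  · simp only [State.init, initial, typs, Multiset.map_singleton, Multiset.map_cons,
      Multiset.singleton_add]
  · refine ⟨?_, ?_, ?_, ?_, ?_, ?_, ?_⟩
    · simpa using .proc ht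
    · simp [provs]
    · simpa [uses] using hwf.2
    · simp [provs]
    · intro x hx
      simp only [uses, Multiset.singleton_bind] at hx
      exact Multiset.mem_cons_of_mem hx
    · intro x A B hA hB
      have hinj : ((((c, C) ::ₘ Δ) : LCtx).map Prod.fst).Nodup := by
        rw [Multiset.map_cons]; exact hwf'
      exact (Prod.mk.injEq .. ▸ Multiset.inj_on_of_nodup_map hinj _ hA _ hB rfl).2
    · simp only [Multiset.mem_singleton, forall_eq, if_true]
      intro x hx
      rw [if_neg (hne x hx)]
      norm_num
  · have : (State.init (initial Δ P c C)).seen = ∅ := by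
      ext x; simp [State.init, initial]
    rw [this]
    exact ⟨nofun, nofun, nofun, by simp⟩

theorem mem_dom_initial {Δ : LCtx} {P : Proc} {c : Chan} {C : Ty} {x : Chan × Ty}
    (hx : x ∈ (c, C) ::ₘ Δ) : .typ x.1 x.2 ∈ initial Δ P c C := by
  rcases Multiset.mem_cons.1 hx with rfl | hx
  · simp [initial]
  · simp only [initial, Multiset.mem_cons, Multiset.mem_map]
    exact Or.inr (Or.inr ⟨x, hx, rfl⟩)

/-- Typed processes that may make the same observations have the same operational observation. -/
theorem exists_isObservation {Δ : LCtx} {P Q : Proc} {c : Chan} {C : Ty} (hP : Typed Δ P c C)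
    (hQ : Typed Δ Q c C)
    (hPQ : ∀ x ∈ (c, C) ::ₘ Δ, ∀ π e, May (State.init (initial Δ P c C)) x.1 π e ↔
      May (State.init (initial Δ Q c C)) x.1 π e) :
    ∃ v : ObsTuple Δ c C, IsObservation Δ P c C v ∧ IsObservation Δ Q c C v := by
  have obs : ∀ {R : Proc}, Typed Δ R c C → ∃ v : ObsTuple Δ c C, v ∈ observations Δ R c C := by
    intro R hR
    obtain ⟨T, hT⟩ := hR.good.exists_fair
    have : ∀ x : {x : Chan × Ty // x ∈ (c, C) ::ₘ Δ},
        ∃ v, Observes T.union v x.1.1 x.1.2 := fun x =>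
      (T.coherent hR.good).exists_observes
        ⟨0, by simp, by rw [T.start]; exact mem_dom_initial x.2⟩
    choose v hv using this
    exact ⟨v, T, hT, hv⟩
  have dom : ∀ {R : Proc} {x : Chan × Ty}, x ∈ (c, C) ::ₘ Δ →
      x.1 ∈ (State.init (initial Δ R c C)).dom := fun hx => ⟨_, mem_dom_initial hx⟩
  have uniq : ∀ {R R' : Proc}, Typed Δ R c C → Typed Δ R' c C →
      (∀ x ∈ (c, C) ::ₘ Δ, ∀ π e, May (State.init (initial Δ R c C)) x.1 π e ↔
        May (State.init (initial Δ R' c C)) x.1 π e) →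
      ∀ v ∈ observations Δ R c C, ∀ v' ∈ observations Δ R' c C, v = v' := by
    rintro R R' hR hR' hRR v ⟨T, hT, hv⟩ v' ⟨T', hT', hv'⟩
    funext x
    refine (hv x).eq (T.coherent hR.good) (T'.coherent hR'.good) (hv' x) fun π e => ?_
    rw [hT.sees_iff hR.good (dom x.2), hT'.sees_iff hR'.good (dom x.2)]
    exact hRR x.1 x.2 π e
  obtain ⟨v, hv⟩ := obs hP
  refine ⟨v, ?_, ?_⟩
  · exact Set.eq_singleton_iff_unique_mem.2 ⟨hv, fun w hw =>
      uniq hP hP (fun _ _ _ _ => Iff.rfl) w hw v hv⟩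
  · obtain ⟨w, hw⟩ := obs hQ
    have := uniq hP hQ hPQ v hv w hw
    subst this
    exact Set.eq_singleton_iff_unique_mem.2 ⟨hw, fun u hu =>
      uniq hQ hQ (fun _ _ _ _ => Iff.rfl) u hu v hw⟩

/-! ### Associativity of composition -/

/-- Exchange the two most recently bound channels. -/
def swapRen : ℕ → ℕ
  | 0 => 1
  | 1 => 0
  | n + 2 => n + 2

/-- The two ways of composing three processes. In `p₂` both channels are bound: `0` is the one
shared with `p₃` and `1` is the one shared with `p₁`. -/
inductive Assoc : Proc → Proc → Prop
  | left (A B : Ty) (p₁ p₂ p₃ : Proc) :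
      Assoc (.cut A p₁ (.cut B p₂ (p₃.ren (liftRen Nat.succ))))
        (.cut B (.cut A (p₁.ren (liftRen Nat.succ)) (p₂.ren swapRen)) p₃)
  | right (A B : Ty) (p₁ p₂ p₃ : Proc) :
      Assoc (.cut B (.cut A (p₁.ren (liftRen Nat.succ)) (p₂.ren swapRen)) p₃)
        (.cut A p₁ (.cut B p₂ (p₃.ren (liftRen Nat.succ))))

/-- Processes that differ by reassociating a composition at one place, not below a `fix`. -/
inductive Differ : Proc → Proc → Prop
  | assoc {P P' : Proc} : Assoc P P' → Differ P P'
  | cutL {A : Ty} {P P' Q : Proc} : Differ P P' → Differ (.cut A P Q) (.cut A P' Q)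
  | cutR {A : Ty} {P Q Q' : Proc} : Differ Q Q' → Differ (.cut A P Q) (.cut A P Q')
  | wait {a : Chan} {P P' : Proc} : Differ P P' → Differ (.wait a P) (.wait a P')
  | sendC {a b : Chan} {P P' : Proc} : Differ P P' → Differ (.sendC a b P) (.sendC a b P')
  | recvC {a : Chan} {P P' : Proc} : Differ P P' → Differ (.recvC a P) (.recvC a P')
  | sendL {a : Chan} {k : Label} {P P' : Proc} : Differ P P' → Differ (.sendL a k P) (.sendL a k P')
  | branch {a : Chan} {L : Finset Label} {P P' : {l // l ∈ L} → Proc} (k : {l // l ∈ L}) :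
      Differ (P k) (P' k) → (∀ l, l ≠ k → P l = P' l) → Differ (.branch a L P) (.branch a L P')
  | sendU {a : Chan} {P P' : Proc} : Differ P P' → Differ (.sendU a P) (.sendU a P')
  | recvU {a : Chan} {P P' : Proc} : Differ P P' → Differ (.recvU a P) (.recvU a P')

theorem Proc.ren_liftRen_succ (P : Proc) (f : ℕ → ℕ) :
    (P.ren (liftRen Nat.succ)).ren (liftRen (liftRen f)) =
      (P.ren (liftRen f)).ren (liftRen Nat.succ) := by
  rw [Proc.ren_ren, Proc.ren_ren, liftRen_comp, liftRen_comp]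
  rfl

theorem Proc.ren_swapRen (P : Proc) (f : ℕ → ℕ) :
    (P.ren swapRen).ren (liftRen (liftRen f)) = (P.ren (liftRen (liftRen f))).ren swapRen := by
  rw [Proc.ren_ren, Proc.ren_ren]
  congr 1
  funext x
  rcases x with - | - | x <;> rfl

theorem Assoc.symm {P P' : Proc} (h : Assoc P P') : Assoc P' P := by
  cases h with
  | left => exact .right ..
  | right => exact .left ..

theorem Assoc.ren {P P' : Proc} (h : Assoc P P') (f : ℕ → ℕ) : Assoc (P.ren f) (P'.ren f) := by
  cases h with
  | left =>
    simp only [Proc.ren, Proc.ren_liftRen_succ, Proc.ren_swapRen]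
    exact .left ..
  | right =>
    simp only [Proc.ren, Proc.ren_liftRen_succ, Proc.ren_swapRen]
    exact .right ..

theorem Differ.symm {P P' : Proc} (h : Differ P P') : Differ P' P := by
  induction h with
  | assoc h => exact .assoc h.symm
  | cutL _ ih => exact .cutL ih
  | cutR _ ih => exact .cutR ih
  | wait _ ih => exact .wait ih
  | sendC _ ih => exact .sendC ih
  | recvC _ ih => exact .recvC ih
  | sendL _ ih => exact .sendL ih
  | branch k _ h ih => exact .branch k ih fun l hl => (h l hl).symm
  | sendU _ ih => exact .sendU ih
  | recvU _ ih => exact .recvU ih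

theorem Differ.ren {P P' : Proc} (h : Differ P P') : ∀ f : ℕ → ℕ, Differ (P.ren f) (P'.ren f) := by
  induction h with
  | assoc h => exact fun f => .assoc (h.ren f)
  | cutL _ ih => exact fun f => .cutL (ih _)
  | cutR _ ih => exact fun f => .cutR (ih _)
  | wait _ ih => exact fun f => .wait (ih _)
  | sendC _ ih => exact fun f => .sendC (ih _)
  | recvC _ ih => exact fun f => .recvC (ih _)
  | sendL _ ih => exact fun f => .sendL (ih _)
  | branch k _ h ih => exact fun f => .branch k (ih _) fun l hl => by rw [h l hl]
  | sendU _ ih => exact fun f => .sendU (ih _)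
  | recvU _ ih => exact fun f => .recvU (ih _)

/-- Configurations that differ in at most one process. -/
def CfgRel (M M' : Config) : Prop :=
  M = M' ∨ ∃ N c P P', Differ P P' ∧ M = .proc c P ::ₘ N ∧ M' = .proc c P' ::ₘ N

theorem CfgRel.add {M M' : Config} (h : CfgRel M M') (V : Config) : CfgRel (M + V) (M' + V) := by
  rcases h with rfl | ⟨N, c, P, P', hP, rfl, rfl⟩
  · exact Or.inl rfl
  · exact Or.inr ⟨N + V, c, P, P', hP, Multiset.cons_add .., Multiset.cons_add ..⟩

theorem CfgRel.mem_iff {M M' : Config} (h : CfgRel M M') {j : Judg} (hj : ∀ c P, j ≠ .proc c P) :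
    j ∈ M ↔ j ∈ M' := by
  rcases h with rfl | ⟨N, c, P, P', hP, rfl, rfl⟩
  · rfl
  · simp [hj]

theorem CfgRel.single {c : Chan} {P P' : Proc} (h : Differ P P') {M : Config} :
    CfgRel (.proc c P ::ₘ M) (.proc c P' ::ₘ M) :=
  Or.inr ⟨M, c, P, P', h, rfl, rfl⟩

theorem CfgRel.fst {c : Chan} {P P' : Proc} (h : Differ P P') {j k : Judg} :
    CfgRel {.proc c P, j, k} {.proc c P', j, k} :=
  Or.inr ⟨{j, k}, c, P, P', h, rfl, rfl⟩

theorem CfgRel.snd {c : Chan} {P P' : Proc} (h : Differ P P') {j k : Judg} :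
    CfgRel {j, .proc c P, k} {j, .proc c P', k} :=
  Or.inr ⟨{j, k}, c, P, P', h, Multiset.cons_swap .., Multiset.cons_swap ..⟩

/-- A rule that rewrites a process also rewrites one that differs from it below the root. -/
theorem Differ.rule {P P' : Proc} (h : Differ P P') : Assoc P P' ∨
    ∀ r : Inst, r.proc = P → ∃ r' : Inst, r'.chan = r.chan ∧ r'.proc = P' ∧ r'.inp = r.inp ∧
      r'.per = r.per ∧ (r'.bindsFresh ↔ r.bindsFresh) ∧ ∀ n, CfgRel (r.out n) (r'.out n) := by
  cases h with
  | assoc h => exact Or.inl h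
  | @cutL A P P' Q h =>
    refine Or.inr fun r hr => ?_
    cases r <;> cases hr
    exact ⟨.cut _ A P' Q, rfl, rfl, rfl, rfl, Iff.rfl, fun n => CfgRel.fst (h.ren _)⟩
  | @cutR A P Q Q' h =>
    refine Or.inr fun r hr => ?_
    cases r <;> cases hr
    exact ⟨.cut _ A P Q', rfl, rfl, rfl, rfl, Iff.rfl, fun n => CfgRel.snd (h.ren _)⟩
  | @wait a P P' h =>
    refine Or.inr fun r hr => ?_
    cases r <;> cases hr
    exact ⟨.wait a _ P', rfl, rfl, rfl, rfl, Iff.rfl, fun n => CfgRel.single (M := 0) h⟩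
  | @sendC a b P P' h =>
    refine Or.inr fun r hr => ?_
    cases r <;> cases hr
    exact ⟨.sendC a b P' _ _, rfl, rfl, rfl, rfl, Iff.rfl, fun n => CfgRel.fst (h.ren _)⟩
  | @recvC a P P' h =>
    refine Or.inr fun r hr => ?_
    cases r <;> cases hr
    exact ⟨.recvC a _ _ _ P', rfl, rfl, rfl, rfl, Iff.rfl, fun n => CfgRel.single (M := 0) (h.ren _)⟩
  | @sendL a k P P' h =>
    refine Or.inr fun r hr => ?_
    cases r <;> cases hr
    · exact ⟨.plusSend a _ _ _ P', rfl, rfl, rfl, rfl, Iff.rfl, fun n => CfgRel.snd (h.ren _)⟩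
    · exact ⟨.ampSend a _ _ _ _ P', rfl, rfl, rfl, rfl, Iff.rfl, fun n => CfgRel.snd (h.ren _)⟩
  | @branch a L P P' k h hl =>
    refine Or.inr fun r hr => ?_
    -- The received label selects one branch. If it is not the differing one, the difference is
    -- discarded and the configurations become equal.
    have key : ∀ (l : {l // l ∈ L}) (c d : Chan),
        CfgRel {.proc c ((P l).rename a d)} {.proc c ((P' l).rename a d)} := by
      intro l c d
      by_cases hlk : l = k
      · subst hlk
        exact .single (h.ren _)
      · rw [hl l hlk]
        exact Or.inl rfl
    cases r <;> cases hr
    case branch.plusRecv.refl d c ne k' =>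
      exact ⟨.plusRecv a d c ne L k' P', rfl, rfl, rfl, rfl, Iff.rfl, fun n => key _ _ _⟩
    case branch.ampRecv.refl d k' =>
      exact ⟨.ampRecv a d L k' P', rfl, rfl, rfl, rfl, Iff.rfl, fun n => key _ _ _⟩
  | @sendU a P P' h =>
    refine Or.inr fun r hr => ?_
    cases r <;> cases hr
    exact ⟨.sendU a _ P', rfl, rfl, rfl, rfl, Iff.rfl, fun n => CfgRel.snd (h.ren _)⟩
  | @recvU a P P' h =>
    refine Or.inr fun r hr => ?_
    cases r <;> cases hr
    exact ⟨.recvU a _ _ P', rfl, rfl, rfl, rfl, Iff.rfl, fun n => CfgRel.single (M := 0) (h.ren _)⟩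

/-- The renaming that instantiates the outermost bound channel. -/
def instRen (b : Chan) : ℕ → ℕ
  | 0 => b
  | n + 1 => n

theorem Proc.inst_eq (P : Proc) (b : Chan) : P.inst b = P.ren (instRen b) := by
  rfl

theorem Proc.inst_cut (A : Ty) (P Q : Proc) (b : Chan) :
    (Proc.cut A P Q).inst b = .cut A (P.ren (liftRen (instRen b))) (Q.ren (liftRen (instRen b))) := by
  rw [Proc.inst_eq, Proc.ren]

theorem stepBy_cut {X Y : State} {c b : Chan} {A : Ty} {P Q : Proc} {N : Config}
    (hX : X.cfg = .proc c (.cut A P Q) ::ₘ N) (hb : b ∉ X.dom)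
    (hY : Y.cfg = .proc b (P.inst b) ::ₘ .proc c (Q.inst b) ::ₘ .typ b A ::ₘ N)
    (hs : Y.seen = X.seen) : StepBy (.cut c A P Q) b X Y := by
  refine ⟨N, hX, nofun, hY.trans ?_, fun _ A hA => hb ⟨A, hA⟩, hs.trans ?_⟩
  · simp [Inst.out]
  · simp [Inst.out]

/-- Both compositions of three processes reduce to the same configuration. -/
theorem Assoc.join {X X' : State} {c : Chan} {P P' : Proc} {N : Config} (h : Assoc P P')
    (hX : X.cfg = .proc c P ::ₘ N) (hX' : X'.cfg = .proc c P' ::ₘ N) (hs : X.seen = X'.seen) :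
    ∃ (r : Inst) (n : Chan) (Y : State) (r' : Inst) (n' : Chan) (Z : State),
      StepBy r n X Y ∧ StepBy r' n' Y Z ∧ Path X' Z := by
  -- All four steps are exhibited separately, so that either side can play the part whose individual
  -- steps are required.
  have key : ∀ {X X' : State} {A B : Ty} {p₁ p₂ p₃ : Proc},
      X.cfg = .proc c (.cut A p₁ (.cut B p₂ (p₃.ren (liftRen Nat.succ)))) ::ₘ N →
      X'.cfg = .proc c (.cut B (.cut A (p₁.ren (liftRen Nat.succ)) (p₂.ren swapRen)) p₃) ::ₘ N →
      X.seen = X'.seen → ∃ (r : Inst) (n : Chan) (Y : State) (r' : Inst) (n' : Chan) (s : Inst)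
        (m : Chan) (Y' : State) (s' : Inst) (m' : Chan) (Z : State),
        StepBy r n X Y ∧ StepBy r' n' Y Z ∧ StepBy s m X' Y' ∧ StepBy s' m' Y' Z := by
    clear hX hX' hs X X'
    intro X X' A B p₁ p₂ p₃ hX hX' hs
    -- The names are fresh for both states, so that both sides can use the same two channels
    -- although they create them in opposite orders.
    obtain ⟨b₁, hb₁⟩ := (X.dom_finite.union X'.dom_finite).exists_notMem
    obtain ⟨b₂, hb₂⟩ := ((X.dom_finite.union X'.dom_finite).union
      (Set.finite_singleton b₁)).exists_notMem
    simp only [Set.mem_union, Set.mem_singleton_iff, not_or] at hb₁ hb₂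
    let Y : State := ⟨.proc b₁ (p₁.inst b₁) ::ₘ
      .proc c (.cut B (p₂.ren (liftRen (instRen b₁)))
        ((p₃.ren (liftRen Nat.succ)).ren (liftRen (instRen b₁)))) ::ₘ .typ b₁ A ::ₘ N, X.seen⟩
    let Y' : State := ⟨.proc b₂ (.cut A ((p₁.ren (liftRen Nat.succ)).ren (liftRen (instRen b₂)))
        ((p₂.ren swapRen).ren (liftRen (instRen b₂))))
      ::ₘ .proc c (p₃.inst b₂) ::ₘ .typ b₂ B ::ₘ N, X.seen⟩
    -- The middle process is the one with both bound channels: index `0` is shared with `p₃`, index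
    -- `1` with `p₁`.
    let f : ℕ → ℕ := fun x => match x with | 0 => b₂ | 1 => b₁ | n + 2 => n
    let Z : State := ⟨.proc b₁ (p₁.inst b₁) ::ₘ .proc b₂ (p₂.ren f) ::ₘ .proc c (p₃.inst b₂) ::ₘ
      .typ b₁ A ::ₘ .typ b₂ B ::ₘ N, X.seen⟩
    -- An outer process was weakened by the channel that it does not use; instantiating that channel
    -- undoes the weakening.
    have inst_inst : ∀ (P : Proc) (b b' : Chan),
        ((P.ren (liftRen Nat.succ)).ren (liftRen (instRen b))).inst b'
          = P.inst b' := by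
      intro P b b'
      unfold Proc.inst
      rw [Proc.ren_ren, Proc.ren_ren]
      congr 1
      funext x
      rcases x with - | x <;> rfl
    have h₁ : (p₂.ren (liftRen (instRen b₁))).inst b₂ = p₂.ren f := by
      unfold Proc.inst
      rw [Proc.ren_ren]
      congr 1
      funext x
      rcases x with - | - | x <;> rfl
    have h₂ : ((p₂.ren swapRen).ren (liftRen (instRen b₂))).inst b₁
        = p₂.ren f := by
      unfold Proc.inst
      rw [Proc.ren_ren, Proc.ren_ren]
      congr 1
      funext x
      rcases x with - | - | x <;> rfl
    have hXY : StepBy (.cut c A p₁ (.cut B p₂ (p₃.ren (liftRen Nat.succ)))) b₁ X Y :=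
      stepBy_cut hX hb₁.1 (by rw [Proc.inst_cut]) rfl
    have hXY' : StepBy (.cut c B (.cut A (p₁.ren (liftRen Nat.succ)) (p₂.ren swapRen)) p₃) b₂ X' Y' :=
      stepBy_cut hX' hb₂.1.2 (by rw [Proc.inst_cut]) hs
    have hbY : b₂ ∉ Y.dom := fun h => (hXY.dom_subset h).elim hb₂.1.1 fun h => hb₂.2 h.2
    have hbY' : b₁ ∉ Y'.dom := fun h => (hXY'.dom_subset h).elim hb₁.2 fun h => hb₂.2 h.2.symm
    refine ⟨_, _, Y, _, _, _, _, Y', _, _, Z, hXY,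
      stepBy_cut (Multiset.cons_swap ..) hbY ?_ rfl, hXY', stepBy_cut rfl hbY' ?_ rfl⟩
    · rw [inst_inst, h₁]
      simp only [Z, ← Multiset.singleton_add]
      abel
    · rw [inst_inst, h₂]
      simp only [Z, ← Multiset.singleton_add]
      abel
  cases h with
  | left =>
    obtain ⟨r, n, Y, r', n', s, m, Y', s', m', Z, h₁, h₂, h₃, h₄⟩ := key hX hX' hs
    exact ⟨r, n, Y, r', n', Z, h₁, h₂, h₃.path.trans h₄.path⟩
  | right =>
    obtain ⟨r, n, Y, r', n', s, m, Y', s', m', Z, h₁, h₂, h₃, h₄⟩ := key hX' hX hs.symm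
    exact ⟨s, m, Y', s', m', Z, h₃, h₄, h₁.path.trans h₂.path⟩

/-- Reassociating a composition forecloses no observation. -/
theorem May.of_cfgRel {X X' : State} (hX : Good X) (hs : X.seen = X'.seen)
    (hr : CfgRel X.cfg X'.cfg) {c : Chan} (hc : c ∈ X.dom) {π : List Bool} {e : CommHead}
    (h : May X c π e) : May X' c π e := by
  obtain ⟨Y, p, hY⟩ := h
  induction p using Relation.ReflTransGen.head_induction_on generalizing X' with
  | refl => exact ⟨X', .refl, hs ▸ hY⟩
  | @head X X₁ h p ih =>
    obtain ⟨r, n, h⟩ := h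
    rcases id hr with he | ⟨N, d, P, P', hP, hN, hN'⟩
    · obtain rfl : X = X' := State.ext he hs
      exact ⟨Y, h.path.trans p, hY⟩
    rcases hP.rule with ha | hrule
    · obtain ⟨r₁, n₁, Z₁, r₂, n₂, Z, h₁, h₂, q⟩ := ha.join hN hN' hs
      obtain ⟨W, hW, hsees⟩ :=
        May.step (hX.step h₁) h₂ (h₁.dom_mono hc) (May.step hX h₁ hc ⟨Y, h.path.trans p, hY⟩)
      exact ⟨W, Relation.ReflTransGen.trans q hW, hsees⟩
    · have hX₁ := hX.step h
      have hc₁ := h.dom_mono hc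
      obtain ⟨V, hV, hp, hV', hf, hs'⟩ := h
      have hfr : r.bindsFresh → ∀ A, .typ n A ∉ X'.cfg := fun hb A hA =>
        hf hb A ((hr.mem_iff (j := .typ n A) nofun).2 hA)
      -- Once a matching step of `X'` is found, both sides have produced the same messages, and the
      -- induction hypothesis applies to the rest of the path.
      have finish : ∀ {r' : Inst} {V' : Config}, X'.cfg = r'.eph + V' →
          (∀ x, r'.per = some x → .typ x.1 x.2 ∈ V') → (r'.bindsFresh ↔ r.bindsFresh) →
          CfgRel (r.out n) (r'.out n) → CfgRel (r.out n + V) (r'.out n + V') →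
          May X' c π e := by
        intro r' V' h₁ h₂ h₃ h₄ h₅
        have hset : {x : Chan × Msg | .msg x.1 x.2 ∈ r.out n} = {x | .msg x.1 x.2 ∈ r'.out n} :=
          Set.ext fun x => h₄.mem_iff nofun
        have hstep : StepBy r' n X' ⟨r'.out n + V', X₁.seen⟩ :=
          ⟨V', h₁, h₂, rfl, fun hb => hfr (h₃.1 hb), by rw [← hset, ← hs]; exact hs'⟩
        obtain ⟨W, hW, hsees⟩ := ih hX₁ (X' := ⟨r'.out n + V', X₁.seen⟩) rfl (hV' ▸ h₅) hc₁
        exact ⟨W, hstep.path.trans hW, hsees⟩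
      -- If the step rewrites the differing process, it is matched by the corresponding rule for
      -- `P'`. Otherwise that process belongs to the remainder `V` and the same rule fires on both
      -- sides.
      by_cases hd : r.chan = d ∧ r.proc = P
      · obtain ⟨rfl, rfl⟩ := hd
        obtain ⟨r', hch, rfl, hi, hpe, hb, hout⟩ := hrule r rfl
        have hNV := hN.symm.trans hV
        rw [Inst.eph, Multiset.cons_add, Multiset.cons_inj_right] at hNV
        refine finish (V' := V) ?_ ?_ hb (hout n) ((hout n).add V)
        · rw [hN', Inst.eph, hch, hi, Multiset.cons_add, hNV]
        · rwa [hpe]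
      · have hmem : Judg.proc d P ∈ V := by
          have : Judg.proc d P ∈ r.eph + V := hV ▸ hN ▸ Multiset.mem_cons_self _ _
          rw [Multiset.mem_add, Inst.mem_eph] at this
          refine this.resolve_left ?_
          rintro (h | ⟨a, m, -, h⟩)
          · cases h; exact hd ⟨rfl, rfl⟩
          · cases h
        obtain ⟨V₀, rfl⟩ := Multiset.exists_cons_of_mem hmem
        have hNV := hN.symm.trans hV
        rw [Multiset.add_cons, Multiset.cons_inj_right] at hNV
        refine finish (r' := r) (V' := .proc d P' ::ₘ V₀) ?_ ?_ Iff.rfl (Or.inl rfl) ?_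
        · rw [hN', hNV, Multiset.add_cons]
        · intro x hx
          simpa using hp x hx
        · rw [Multiset.add_cons, Multiset.add_cons]
          exact .single hP

/-- Binders of the context act on the plugged process by renaming, which is why `Differ` has to be
closed under renaming. The absence of a `fix` former in `Hole` keeps the difference in a single
place. -/
theorem Differ.plug {P P' : Proc} (h : Differ P P') (K : Hole) :
    Differ (K.plug P) (K.plug P') := by
  induction K with
  | hole => exact h
  | cutL a A K Q ih => exact .cutL (ih.ren _)
  | cutR a A Q K ih => exact .cutR (ih.ren _)
  | wait a K ih => exact .wait ih
  | sendC a b K ih => exact .sendC ih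
  | recvC b a K ih => exact .recvC (ih.ren _)
  | sendL a k K ih => exact .sendL ih
  | branch a L k K Q ih =>
    refine .branch k ?_ fun l hl => ?_
    · simpa using ih
    · simp [hl]
  | sendU a K ih => exact .sendU ih
  | recvU a K ih => exact .recvU ih

/-! ### Typing of compositions and contexts -/

theorem WF.of_le {Δ Δ' : LCtx} {c : Chan} (h : WF Δ c) (hle : Δ' ≤ Δ) : WF Δ' c :=
  Multiset.nodup_of_le (Multiset.cons_le_cons _ (Multiset.map_le_map hle)) h

theorem WF.ne {Δ : LCtx} {c : Chan} (h : WF Δ c) : ∀ x ∈ Δ, x.1 ≠ c := by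
  intro x hx he
  exact (Multiset.nodup_cons.1 h).1 (Multiset.mem_map.2 ⟨x, hx, he⟩)

theorem WF.head_ne {Δ : LCtx} {a c : Chan} {A : Ty} (h : WF ((a, A) ::ₘ Δ) c) :
    (∀ x ∈ Δ, x.1 ≠ a) ∧ c ≠ a := by
  have h' := (Multiset.nodup_cons.1 h).2
  rw [Multiset.map_cons, Multiset.nodup_cons] at h'
  exact ⟨fun x hx he => h'.1 (Multiset.mem_map.2 ⟨x, hx, he⟩),
    fun he => h.ne _ (Multiset.mem_cons_self _ _) he.symm⟩

theorem LCtx.ren_bind {Δ : LCtx} {a : Chan} (h : ∀ x ∈ Δ, x.1 ≠ a) :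
    LCtx.ren (fun x => if x = a then 0 else x + 1) Δ = LCtx.shift Δ :=
  LCtx.ren_congr (g := Nat.succ) fun x hx => if_neg (h x hx)

theorem HasType.bind_provider {Δ : LCtx} {P : Proc} {a : Chan} {A : Ty} (h : HasType [] Δ P a A)
    (ha : ∀ x ∈ Δ, x.1 ≠ a) : HasType [] (LCtx.shift Δ) (P.bind a) 0 A := by
  have := h.ren_nil fun x => if x = a then 0 else x + 1
  rwa [LCtx.ren_bind ha, if_pos rfl] at this

theorem HasType.bind_client {Δ : LCtx} {P : Proc} {a c : Chan} {A C : Ty}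
    (h : HasType [] ((a, A) ::ₘ Δ) P c C) (ha : (∀ x ∈ Δ, x.1 ≠ a) ∧ c ≠ a) :
    HasType [] ((0, A) ::ₘ LCtx.shift Δ) (P.bind a) (c + 1) C := by
  have := h.ren_nil fun x => if x = a then 0 else x + 1
  rwa [LCtx.ren_cons, LCtx.ren_bind ha.1, if_pos rfl, if_neg ha.2] at this

theorem Typed.comp {Δ₁ Δ₂ : LCtx} {P Q : Proc} {a c : Chan} {A C : Ty} (hP : Typed Δ₁ P a A)
    (hQ : Typed ((a, A) ::ₘ Δ₂) Q c C) (h : WF (Δ₁ + Δ₂) c) :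
    Typed (Δ₁ + Δ₂) (Proc.comp a A P Q) c C :=
  ⟨h, .cut (hP.2.bind_provider hP.1.ne) (hQ.2.bind_client hQ.1.head_ne)⟩

theorem CtxTyped.plug {Δ Δ' : LCtx} {c c' : Chan} {C C' : Ty} {K : Hole} {P : Proc}
    (h : CtxTyped Δ' c' C' K Δ c C) (hP : Typed Δ' P c' C') : Typed Δ (K.plug P) c C := by
  induction h with
  | hole => exact hP
  | cutL h _ hQ ih => exact ih.comp hQ h
  | cutR h hQ _ ih => exact hQ.comp ih h
  | oneL h _ ih => exact ⟨h, .oneL ih.2⟩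
  | tensorR h _ ih => exact ⟨h, .tensorR ih.2⟩
  | @tensorL Δ a b c A B C K h _ ih =>
    refine ⟨h, .tensorL ?_⟩
    have hb := ih.1.head_ne
    have := ih.2.bind_client hb
    rw [LCtx.shift_eq, LCtx.ren_cons] at this
    exact this
  | plusR k h _ ih => exact ⟨h, .plusR k ih.2⟩
  | @plusL _ _ _ _ _ _ k _ _ h _ hQ ih =>
    refine ⟨h, .plusL fun l => ?_⟩
    by_cases hl : l = k
    · subst hl; simpa using ih.2
    · simpa [hl] using (hQ ⟨l, hl⟩).2
  | @ampR _ _ _ _ k _ _ h _ hQ ih =>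
    refine ⟨h, .ampR fun l => ?_⟩
    by_cases hl : l = k
    · subst hl; simpa using ih.2
    · simpa [hl] using (hQ ⟨l, hl⟩).2
  | ampL k h _ ih => exact ⟨h, .ampL k ih.2⟩
  | muR h _ ih => exact ⟨h, .muR ih.2⟩
  | muL h _ ih => exact ⟨h, .muL ih.2⟩

/-- Binding a name that does not occur in a process is mere weakening; this turns the two outer
processes into the shape that `Assoc` requires. The middle process may contain both names, and
binding them in the other order exchanges its two indices. -/
theorem Proc.comp_assoc {c₁ c₂ : Chan} (C₁ C₂ : Ty) {P₁ P₂ P₃ : Proc} (hc : c₁ ≠ c₂)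
    (h₁ : c₂ ∉ P₁.fcn) (h₃ : c₁ ∉ P₃.fcn) :
    Assoc (Proc.comp c₁ C₁ P₁ (Proc.comp c₂ C₂ P₂ P₃))
      (Proc.comp c₂ C₂ (Proc.comp c₁ C₁ P₁ P₂) P₃) := by
  have bind_bind : ∀ {P : Proc} {a b : Chan}, b ∉ P.fcn →
      (P.bind a).ren (liftRen fun x => if x = b then 0 else x + 1) =
        (P.bind a).ren (liftRen Nat.succ) := by
    intro P a b hb
    unfold Proc.bind
    rw [Proc.ren_ren, Proc.ren_ren]
    refine P.ren_congr _ _ fun x hx => ?_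
    have hxb : x ≠ b := fun e => hb (e ▸ hx)
    by_cases hxa : x = a <;> simp [hxa, liftRen, hxb]
  have hswap : (P₂.bind c₁).ren (liftRen fun x => if x = c₂ then 0 else x + 1) =
      ((P₂.bind c₂).ren (liftRen fun x => if x = c₁ then 0 else x + 1)).ren swapRen := by
    unfold Proc.bind
    rw [Proc.ren_ren, Proc.ren_ren, Proc.ren_ren]
    congr 1
    funext x
    by_cases hx₁ : x = c₁
    · subst hx₁; simp [liftRen, hc, swapRen]
    · by_cases hx₂ : x = c₂
      · subst hx₂; simp [liftRen, hc.symm, swapRen]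
      · simp [liftRen, hx₁, hx₂, swapRen]
  have := Assoc.left C₁ C₂ (P₁.bind c₁)
    ((P₂.bind c₂).ren (liftRen fun x => if x = c₁ then 0 else x + 1)) (P₃.bind c₂)
  rwa [← bind_bind h₁, ← bind_bind h₃, ← hswap] at this

theorem HasType.notMem_fcn {Δ : LCtx} {P : Proc} {c x : Chan} {C : Ty}
    (h : HasType [] Δ P c C) (hc : x ≠ c) (hx : ∀ A, (x, A) ∉ Δ) : x ∉ P.fcn := fun hf =>
  (h.fcn x hf).elim hc fun ⟨A, hA⟩ => hx A hA

/-- Processes that differ by reassociating a composition are observationally congruent. -/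
theorem Differ.obsCongruent {Δ : LCtx} {c : Chan} {C : Ty} {P P' : Proc} (h : Differ P P')
    (hP : Typed Δ P c C) (hP' : Typed Δ P' c C) : ObsCongruent Δ c C P P' := by
  refine ⟨hP, hP', fun K Δ' b B hK => exists_isObservation (hK.plug hP) (hK.plug hP') ?_⟩
  have may : ∀ {Q Q' : Proc}, Differ Q Q' → Typed Δ' Q b B → ∀ x ∈ (b, B) ::ₘ Δ', ∀ π e,
      May (State.init (initial Δ' Q b B)) x.1 π e →
        May (State.init (initial Δ' Q' b B)) x.1 π e := by
    intro Q Q' hd hQ x hx π e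
    have hr : CfgRel (initial Δ' Q b B) (initial Δ' Q' b B) := .single hd
    exact May.of_cfgRel (X' := State.init (initial Δ' Q' b B)) hQ.good
      (Set.ext fun y => hr.mem_iff (j := .msg y.1 y.2) nofun) hr ⟨_, mem_dom_initial hx⟩
  exact fun x hx π e => ⟨may (h.plug K) (hK.plug hP) x hx π e,
    may (h.plug K).symm (hK.plug hP') x hx π e⟩

end OCS

theorem mainTheorem9 (Δ₁ Δ₂ Δ₃ : LCtx) (c₁ c₂ c₃ : Chan) (C₁ C₂ C₃ : Ty) (P₁ P₂ P₃ : Proc)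
    (hP₁ : Typed Δ₁ P₁ c₁ C₁)
    (hP₂ : Typed ((c₁, C₁) ::ₘ Δ₂) P₂ c₂ C₂)
    (hP₃ : Typed ((c₂, C₂) ::ₘ Δ₃) P₃ c₃ C₃)
    (hdistinct : WF ((c₁, C₁) ::ₘ (c₂, C₂) ::ₘ (Δ₁ + Δ₂ + Δ₃)) c₃) :
    ObsCongruent (Δ₁ + Δ₂ + Δ₃) c₃ C₃
      (Proc.comp c₁ C₁ P₁ (Proc.comp c₂ C₂ P₂ P₃))
      (Proc.comp c₂ C₂ (Proc.comp c₁ C₁ P₁ P₂) P₃) := by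
  have h : (c₁ ∉ Δ₁.map Prod.fst ∧ c₁ ∉ Δ₂.map Prod.fst ∧ c₁ ∉ Δ₃.map Prod.fst) ∧
      (c₂ ∉ Δ₁.map Prod.fst ∧ c₂ ∉ Δ₂.map Prod.fst ∧ c₂ ∉ Δ₃.map Prod.fst) ∧
      c₁ ≠ c₂ ∧ c₃ ≠ c₁ ∧ (Δ₁.map Prod.fst + Δ₂.map Prod.fst).Nodup := by
    simp only [WF, Multiset.map_cons, Multiset.map_add, Multiset.nodup_cons, Multiset.mem_cons,
      Multiset.mem_add, not_or] at hdistinct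
    obtain ⟨⟨h₃₁, -, -⟩, ⟨h₁₂, ⟨h₁, h₁'⟩, h₁''⟩, ⟨⟨h₂, h₂'⟩, h₂''⟩, h⟩ := hdistinct
    exact ⟨⟨h₁, h₁', h₁''⟩, ⟨h₂, h₂', h₂''⟩, h₁₂, h₃₁,
      Multiset.nodup_of_le (Multiset.le_add_right _ _) h⟩
  obtain ⟨⟨-, -, h₁₃⟩, ⟨h₂₁, h₂₂, -⟩, h₁₂, h₃₁, hnd⟩ := h
  have hwf : WF (Δ₁ + Δ₂ + Δ₃) c₃ :=
    hdistinct.of_le ((Multiset.le_cons_self _ _).trans (Multiset.le_cons_self _ _))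
  have hwf' : WF ((c₁, C₁) ::ₘ Δ₂ + Δ₃) c₃ := by
    refine hdistinct.of_le ?_
    rw [Multiset.cons_add, add_assoc]
    exact Multiset.cons_le_cons _ ((Multiset.le_add_left _ _).trans (Multiset.le_cons_self _ _))
  -- Here `c₂` is the provided channel instead of a member of the linear context, so the claim is
  -- not a case of `WF.of_le` and is assembled from the components of `hdistinct`.
  have hwf'' : WF (Δ₁ + Δ₂) c₂ := by
    simp only [WF, Multiset.map_add, Multiset.nodup_cons, Multiset.mem_add, not_or]
    exact ⟨⟨h₂₁, h₂₂⟩, hnd⟩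
  -- Linearity supplies the scoping conditions: `c₂` is foreign to the judgment of `P₁`, and `c₁` to
  -- that of `P₃`.
  refine (Differ.assoc (Proc.comp_assoc C₁ C₂ h₁₂ ?_ ?_)).obsCongruent ?_
    ((hP₁.comp hP₂ hwf'').comp hP₃ hwf)
  · exact hP₁.2.notMem_fcn h₁₂.symm fun A hA => h₂₁ (Multiset.mem_map.2 ⟨_, hA, rfl⟩)
  · refine hP₃.2.notMem_fcn h₃₁.symm fun A hA => ?_
    rcases Multiset.mem_cons.1 hA with he | hA
    · exact h₁₂ (congrArg Prod.fst he)
    · exact h₁₃ (Multiset.mem_map.2 ⟨_, hA, rfl⟩)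
  · have h₂₃ := hP₂.comp hP₃ hwf'
    rw [Multiset.cons_add] at h₂₃
    rw [add_assoc] at hwf ⊢
    exact hP₁.comp h₂₃ hwf
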